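/- **Setting.** Let $n,m\ge 1$ and consider $\min_{x\in\mathbb R^n} f_0(x)+g(x)+h(Ax)$, where $A\in\mathbb R^{m\times n}$, $f_0:\mathbb R^n\to\mathbb R$ is convex and differentiable with $L_0$-Lipschitz gradient, and $g:\mathbb R^n\to\mathbb R\cup\{+\infty\}$, $h:\mathbb R^m\to\mathbb R\cup\{+\infty\}$ are proper, closed and convex. Let $\ell(x,\lambda)=f_0(x)+g(x)+\langle Ax,\lambda\rangle-h^*(\lambda)$, let $T_\ell(x,\lambda)=\{(v,u):(v,-u)\in\partial\ell(x,\lambda)\}$ and assume $\Omega=T_\ell^{-1}(0)\neq\emptyset$. Let $\mathcal M=\mathrm{diag}(\mathcal M^x,\mathcal M^\lambda)$ be symmetric positive definite with $\lambda_{\max}(\mathcal M)=1$, let $\|z\|_{\mathcal M}=\sqrt{\langle z,\mathcal M z\rangle}$, and put $a=\|A\|^2/\lambda_{\min}(\mathcal M^\lambda)$. Let $\mathcal E:\mathbb R^{n+m}\to[0,\infty)$ be a measurable residual function with $\mathcal E(z)\le\zeta\,\mathrm{dist}(z,\Omega)$ for all $z$, where $\zeta>0$. The user-defined parameters are $\eta_0>0$,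 $\varsigma>1$, $\varrho_\eta\in(0,1)$, $\sigma_0>0$, $\varrho_\sigma>1$, $\alpha>0$, $\delta\in(0,1/2)$, $\gamma\in(0,2)$, chosen such that $$\rho=\tfrac1{1-\delta}\Big(\sqrt{1-\tfrac{\min\{\gamma,2\gamma-\gamma^2\}\alpha^2}{\alpha^2+1}}+\delta\big(\tfrac{\min\{\gamma,1\}}{\sqrt{\alpha^2+1}}+1\big)\Big)<1 .$$ Put $\theta_C=\frac{1+\delta}{(1-\delta)(1-\sqrt{1/(\alpha^2+1)})}$, $\sigma_s=\sigma_0\varrho_\sigma^s$ and $\eta_{s,t}=\eta_0\varrho_\eta^s(1+t)^{-\varsigma}$. **Algorithm (AGPPA).** For $\sigma>0$ and a base point $\bar z=(\bar x,\bar\lambda)$ let $$\psi(u)=\max_\lambda\{\langle u,\lambda\rangle-h^*(\lambda)-\tfrac1{2\sigma}\|\lambda-\bar\lambda\|^2_{\mathcal M^\lambda}\},\qquad F(x)=f_0(x)+g(x)+\psi(Ax)+\tfrac1{2\sigma}\|x-\bar x\|^2_{\mathcal M^x},$$ let $\Lambda(x)$ be the maximizer in the definition of $\psi(Ax)$, let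 $f=f_0+\psi(A\,\cdot)$ and $L=L_0+\sigma a$, and let $\mathcal G_F(x)=\arg\min_y\{\frac L2\|y-(x-\frac1L\nabla f(x))\|^2+g(y)+\frac1{2\sigma}\|y-\bar x\|^2_{\mathcal M^x}\}$. A proximal step at $\bar z=z^{s,t}$ with $\sigma=\sigma_s$ (denote its $F$ by $F_{s,t}$) starts from $x^0=\mathcal G_F(\bar x)$ and iterates: call the randomized inner solver, $y=\mathcal A_{F}(x^k)$; replace $y$ by $x^k$ if $F(y)>F(x^k)$; set $x^{k+1}=\mathcal G_F(y)$; stop with $\tilde x=x^{k+1}$ as soon as $$\mathrm{dist}(0,\partial F(x^{k+1}))\le\tfrac{\sqrt{\lambda_{\min}(\mathcal M^x)}}{\sigma}\min\{\eta_{s,t},\ \delta\|(x^{k+1},\Lambda(x^{k+1}))-\bar z\|_{\mathcal M}\};$$ then $z^{s,t+1}=\gamma(\tilde x,\Lambda(\tilde x))+(1-\gamma)z^{s,t}$. AGPPA starts from $z^{0,0}=z^0$. It stops at the beginning of outer iteration $s$ if $\mathcal E(z^{s,0})\le\epsilon$. Otherwise it performs proximal steps $t=0,1,\dots$. After step $t$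 it stops with output $z^{s,t}$ if $\mathcal E(z^{s,t})\le\epsilon$; else, if $\|z^{s,t+1}-z^{s,t}\|_{\mathcal M}>\theta_C\min_{0\le j\le t}\rho^{t-j}\|z^{s,j+1}-z^{s,j}\|_{\mathcal M}$, it goes to outer iteration $s+1$ with $z^{s+1,0}$ a minimizer of $\mathcal E$ over $\{z^{s,0},\dots,z^{s,t+1}\}$ (the first one, in case of ties); else it goes on with step $t+1$. Assume that, for every inner problem $F_{s,t}$ (any $s,t$ and any base point), the inner solver maps $\mathrm{dom}\,g$ to itself, depends measurably on the base point, the starting point and its random choices (which are independent over all calls), and satisfies $\mathbb E[F_{s,t}(\mathcal A_{F_{s,t}}(x))-F_{s,t}^\star]\le e^{-1}(F_{s,t}(x)-F^\star_{s,t})$ for $x\in\mathrm{dom}\,g$, and that each iteration of the proximal step costs at most $\mathcal T(\sigma_s)$ elementary operations, where $\mathcal T\ge0$ is increasing on $(0,\infty)$. **Constants.** Let $\bar z^0$ be the projection of $z^0$ onto $\Omega$, let $r\ \ge\ \|\bar z^0\|+\frac1{\lambda_{\min}(\mathcal M)}\big(\mathrm{dist}_{\mathcal M}(z^0,\Omega)+\frac{\gamma\varsigma\eta_0}{(\varsigma-1)(1-\varrho_\eta)}\big)$,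 and let $\kappa_r$ be such that $\mathrm{dist}(z,\Omega)\le\kappa_r\,\mathrm{dist}(0,T_\ell(z))$ for all $\|z\|\le r$. For $\epsilon>0$, $0<p<1$ put $$\bar s=\Big\lceil\max\big(\log_{\varrho_\sigma}\tfrac{\kappa_r\alpha}{\sigma_0},0\big)\Big\rceil,\quad \bar\sigma=\alpha\kappa_r\varrho_\sigma,\quad \bar R=\frac{(1+\delta)^2\zeta r}{(1-\delta)^2\big(1-\sqrt{\frac1{\alpha^2+1}}\big)\big(1-\sqrt{\frac{\kappa_r^2}{\sigma_0^2+\kappa_r^2}}\big)\lambda_{\min}(\mathcal M)},$$ $$\bar n=\Big\lceil\max\big(\log_{1/\rho}\tfrac{\bar R}\epsilon,0\big)+1\Big\rceil,\quad \bar N=\bar s\,\bar n,\quad \bar\eta=\eta_0\varrho_\eta^{\bar s}\bar n^{-\varsigma},$$ $$\bar\zeta_1=\frac{2(L_0\bar\sigma+a\bar\sigma^2)^2r^2}{p\,\bar\eta^2\lambda_{\min}(\mathcal M^x)},\quad \bar\zeta_2=\frac{2(1+\delta)^2(L_0\bar\sigma+a\bar\sigma^2)^2}{p\,\delta^2\lambda_{\min}(\mathcal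 M^x)\lambda_{\min}(\mathcal M)} .$$ Assume that $\mathcal T(\sigma)\le c\,(\vartheta_1\sigma^\iota+\vartheta_2\sigma^{\iota/2}+\Upsilon)$ for all $\sigma>0$, with $c,\vartheta_1,\vartheta_2,\iota>0$ and $\Upsilon\ge0$. Assume moreover $\kappa_r\ge2$, $\sigma_0\le\alpha\varrho_\sigma\kappa_r$, $\epsilon\le\zeta r$, $r\ge1$ and $r(L_0+a)\ge1$. **Statement.** There is a constant $C>0$ that depends only on the user-defined parameters, on $\lambda_{\min}(\mathcal M)$ and on $c$, such that, for all data as above, with $$B=\big(\vartheta_1(\alpha\varrho_\sigma\kappa_r)^\iota+\vartheta_2(\alpha\varrho_\sigma\kappa_r)^{\iota/2}+\Upsilon\big)\cdot\ln\kappa_r\,\ln\frac{\zeta r\kappa_r}{\epsilon}\,\ln\Big(\frac{r\kappa_r(L_0+a)}{p}\ln\frac{\zeta r\kappa_r}{\epsilon}\Big),$$ 1. $\bar N\,\big\lceil\ln\bar N+\max(\ln\bar\zeta_1,\ln\bar\zeta_2,0)\big\rceil\,\mathcal T(\bar\sigma)\le C\,B$ (the left side being read as $0$ if $\bar N=0$);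 2. with probability at least $1-p$, AGPPA terminates with a point $(x,\lambda)$ satisfying $\mathcal E(x,\lambda)\le\epsilon$ after at most $C\,B$ elementary operations (the operations counted being those of the iterations of the proximal steps); 3. if $\iota=1$, $\vartheta_2\kappa_r^{1/2}+\Upsilon\le c_1\vartheta_1\kappa_r$ for some $c_1>0$, and $r(L_0+\|A\|)\ge1$, then $$B\le C(1+c_1)\,\vartheta_1\kappa_r\,\ln\kappa_r\,\ln\frac{\zeta r\kappa_r}{\epsilon}\,\ln\Big(\frac{r\kappa_r(L_0+\|A\|)}{p}\ln\frac{\zeta r\kappa_r}{\epsilon}\Big).$$ -/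

import Mathlib

open MeasureTheory
open scoped ENNReal RealInnerProductSpace

noncomputable section

namespace AGPPA

/-! ### Spaces, eigenvalues, extended-real convex functions -/

/-- Euclidean space `ℝⁿ`. -/
abbrev Vec (n : ℕ) : Type := EuclideanSpace ℝ (Fin n)

/-- The Euclidean product space `ℝⁿ⁺ᵐ = ℝⁿ × ℝᵐ` of primal-dual pairs `z = (x, lam)`. -/
abbrev PD (n m : ℕ) : Type := WithLp 2 (Vec n × Vec m)

/-- The pair `(x, lam)` as a point of `ℝⁿ⁺ᵐ`. -/
def pair {n m : ℕ} (x : Vec n) (lam : Vec m) : PD n m := WithLp.toLp 2 (x, lam)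

/-- Smallest real eigenvalue of an endomorphism. -/
def minEig {E : Type*} [AddCommGroup E] [Module ℝ E] (M : E →ₗ[ℝ] E) : ℝ :=
  sInf {a : ℝ | Module.End.HasEigenvalue M a}

/-- Largest real eigenvalue of an endomorphism. -/
def maxEig {E : Type*} [AddCommGroup E] [Module ℝ E] (M : E →ₗ[ℝ] E) : ℝ :=
  sSup {a : ℝ | Module.End.HasEigenvalue M a}

/-- Self-adjoint and positive definite. -/
def IsPosDef {E : Type*} [NormedAddCommGroup E] [InnerProductSpace ℝ E] (M : E →L[ℝ] E) : Prop :=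
  (∀ x y : E, ⟪M x, y⟫ = ⟪x, M y⟫) ∧ ∀ x : E, x ≠ 0 → 0 < ⟪x, M x⟫

/-- Proper, closed (lower semicontinuous) and convex (convex epigraph). -/
structure IsProperClosedConvex {E : Type*} [NormedAddCommGroup E] [InnerProductSpace ℝ E]
    (φ : E → EReal) : Prop where
  ne_bot : ∀ x, φ x ≠ ⊥
  exists_finite : ∃ x, φ x ≠ ⊤
  lsc : LowerSemicontinuous φ
  convex_epigraph : Convex ℝ {q : E × ℝ | φ q.1 ≤ (q.2 : EReal)}

/-- Fenchel conjugate `φ^*`. -/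
def conjugate {E : Type*} [NormedAddCommGroup E] [InnerProductSpace ℝ E] (φ : E → EReal)
    (y : E) : EReal :=
  ⨆ u : E, ((⟪u, y⟫ : ℝ) : EReal) - φ u

/-- Subdifferential of an extended-real function; it is empty where the function is not finite. -/
def subdiff {E : Type*} [NormedAddCommGroup E] [InnerProductSpace ℝ E] (φ : E → EReal)
    (x : E) : Set E :=
  {v | φ x ≠ ⊤ ∧ φ x ≠ ⊥ ∧ ∀ y, φ x + ((⟪v, y - x⟫ : ℝ) : EReal) ≤ φ y}

/-- A minimizer of `φ` over the whole space (used only where the minimizer exists and is unique). -/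
def argminPt {E : Type*} [Nonempty E] (φ : E → EReal) : E :=
  Classical.epsilon fun x => ∀ y, φ x ≤ φ y

/-! ### The problem `min f₀ x + g x + h (A x)`, its Lagrangian and its operator -/

/-- The data of the convex problem `min f₀ x + g x + h (A x)`: `f₀` is convex and differentiable
with `L₀`-Lipschitz gradient; `g`, `h` are proper, closed and convex. -/
structure Problem (n m : ℕ) where
  f₀ : Vec n → ℝ
  g : Vec n → EReal
  h : Vec m → EReal
  A : Vec n →L[ℝ] Vec m
  L₀ : ℝ
  convex_f₀ : ConvexOn ℝ Set.univ f₀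
  differentiable_f₀ : Differentiable ℝ f₀
  L₀_nonneg : 0 ≤ L₀
  lipschitz_f₀ : ∀ x y, ‖gradient f₀ x - gradient f₀ y‖ ≤ L₀ * ‖x - y‖
  g_pcc : IsProperClosedConvex g
  h_pcc : IsProperClosedConvex h

variable {n m : ℕ}

/-- The Lagrangian `ℓ(x, lam) = f₀(x) + g(x) + ⟨A x, lam⟩ - h^*(lam)`. -/
def lagrangian (P : Problem n m) (x : Vec n) (lam : Vec m) : EReal :=
  (P.f₀ x : EReal) + P.g x + ((⟪P.A x, lam⟫ : ℝ) : EReal) - conjugate P.h lam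

/-- The operator `T_ℓ(x, lam) = {(v, u) | (v, -u) ∈ ∂ℓ(x, lam)}`: `v` is a subgradient of the
convex function `ℓ(·, lam)` at `x` and `u` is a subgradient of the convex function `-ℓ(x, ·)`
at `lam`. -/
def opT (P : Problem n m) (z : PD n m) : Set (PD n m) :=
  {w | w.fst ∈ subdiff (fun x => lagrangian P x z.snd) z.fst ∧
       w.snd ∈ subdiff (fun lam => - lagrangian P z.fst lam) z.snd}

/-- The solution set `Ω = T_ℓ⁻¹(0)`. -/
def solSet (P : Problem n m) : Set (PD n m) := {z | (0 : PD n m) ∈ opT P z}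

/-- `κ` is a bounded metric subregularity constant of `T_ℓ` for the radius `r`:
`dist(z, Ω) ≤ κ dist(0, T_ℓ(z))` whenever `‖z‖ ≤ r` (the distance to `∅` is `∞`). -/
def MetricSubregularOn (P : Problem n m) (r κ : ℝ) : Prop :=
  ∀ z : PD n m, ‖z‖ ≤ r →
    Metric.infEDist z (solSet P) ≤ ENNReal.ofReal κ * Metric.infEDist 0 (opT P z)

/-! ### Preconditioner -/

/-- The block-diagonal operator `diag(Mx, Ml)` on `ℝⁿ⁺ᵐ`. -/
def blockDiag (Mx : Vec n →L[ℝ] Vec n) (Ml : Vec m →L[ℝ] Vec m) : PD n m →ₗ[ℝ] PD n m :=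
  (Mx.toLinearMap.prodMap Ml.toLinearMap).withLpMap 2

/-- A block-diagonal preconditioner `M = diag(Mx, Ml)`, positive definite, normalized by
`λ_max(M) = 1`. -/
structure Preconditioner (n m : ℕ) where
  Mx : Vec n →L[ℝ] Vec n
  Ml : Vec m →L[ℝ] Vec m
  posDef_Mx : IsPosDef Mx
  posDef_Ml : IsPosDef Ml
  maxEig_eq_one : maxEig (blockDiag Mx Ml) = 1

/-- The operator `M = diag(Mx, Ml)`. -/
def Preconditioner.op (M : Preconditioner n m) : PD n m →ₗ[ℝ] PD n m := blockDiag M.Mx M.Ml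

/-- `λ_min(M)`. -/
def Preconditioner.lamMin (M : Preconditioner n m) : ℝ := minEig M.op

/-- `λ_min(Mx)`. -/
def Preconditioner.lamMinX (M : Preconditioner n m) : ℝ := minEig M.Mx.toLinearMap

/-- `λ_min(Ml)`. -/
def Preconditioner.lamMinL (M : Preconditioner n m) : ℝ := minEig M.Ml.toLinearMap

/-- The weighted norm `‖z‖_M = √⟨z, M z⟩`. -/
def normM (M : Preconditioner n m) (z : PD n m) : ℝ := Real.sqrt ⟪z, M.op z⟫

/-- The weighted distance `dist_M(z, D)`, for nonempty `D`. -/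
def distM (M : Preconditioner n m) (z : PD n m) (D : Set (PD n m)) : ℝ :=
  sInf ((fun d => normM M (d - z)) '' D)

/-! ### User-defined parameters -/

/-- The user-defined parameters of AGPPA. -/
structure Params where
  η₀ : ℝ
  ς : ℝ
  ϱη : ℝ
  σ₀ : ℝ
  ϱσ : ℝ
  α : ℝ
  δ : ℝ
  γ : ℝ
  η₀_pos : 0 < η₀
  one_lt_ς : 1 < ς
  ϱη_pos : 0 < ϱη
  ϱη_lt_one : ϱη < 1
  σ₀_pos : 0 < σ₀
  one_lt_ϱσ : 1 < ϱσ
  α_pos : 0 < α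
  δ_pos : 0 < δ
  δ_lt_half : δ < 1 / 2
  γ_pos : 0 < γ
  γ_lt_two : γ < 2

/-- The rate `ρ`. -/
def Params.rho (q : Params) : ℝ :=
  1 / (1 - q.δ) *
    (Real.sqrt (1 - min q.γ (2 * q.γ - q.γ ^ 2) * q.α ^ 2 / (q.α ^ 2 + 1)) +
      q.δ * (min q.γ 1 / Real.sqrt (q.α ^ 2 + 1) + 1))

/-- The constant `C` of the linear-decrease test. -/
def Params.testC (q : Params) : ℝ :=
  (1 + q.δ) / ((1 - q.δ) * (1 - Real.sqrt (1 / (q.α ^ 2 + 1))))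

/-- `σ_s = σ₀ ϱσ ^ s`. -/
def Params.sig (q : Params) (s : ℕ) : ℝ := q.σ₀ * q.ϱσ ^ s

/-- `η_{s,t} = η₀ ϱη ^ s (1 + t) ^ (-ς)`. -/
def Params.eta (q : Params) (s t : ℕ) : ℝ := q.η₀ * q.ϱη ^ s * (1 + (t : ℝ)) ^ (-q.ς)

/-! ### The inner problem -/

/-- `(1/(2σ)) ‖v‖²_W`. -/
def quad {k : ℕ} (W : Vec k →L[ℝ] Vec k) (σ : ℝ) (v : Vec k) : ℝ := 1 / (2 * σ) * ⟪v, W v⟫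

/-- `ψ(u, lamBar, σ) = max_lam ⟨u, lam⟩ - h^*(lam) - (1/(2σ))‖lam - lamBar‖²_{Ml}`. -/
def psi (P : Problem n m) (M : Preconditioner n m) (σ : ℝ) (lamBar u : Vec m) : EReal :=
  ⨆ lam : Vec m, ((⟪u, lam⟫ : ℝ) : EReal) - conjugate P.h lam - (quad M.Ml σ (lam - lamBar) : EReal)

/-- `Λ(x, lamBar, σ)`: the maximizer of `⟨A x, lam⟩ - h^*(lam) - (1/(2σ))‖lam - lamBar‖²_{Ml}`,
that is, of `ℓ(x, lam) - (1/(2σ))‖lam - lamBar‖²_{Ml}` for `x ∈ dom g`. -/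
def Lam (P : Problem n m) (M : Preconditioner n m) (σ : ℝ) (lamBar : Vec m) (x : Vec n) : Vec m :=
  argminPt fun lam : Vec m =>
    conjugate P.h lam + ((quad M.Ml σ (lam - lamBar) - ⟪P.A x, lam⟫ : ℝ) : EReal)

/-- The inner objective
`F(x) = f₀(x) + g(x) + ψ(A x, lamBar, σ) + (1/(2σ))‖x - xBar‖²_{Mx}`, with base point
`zBar = (xBar, lamBar)`. -/
def objF (P : Problem n m) (M : Preconditioner n m) (σ : ℝ) (zBar : PD n m) (x : Vec n) : EReal :=
  (P.f₀ x : EReal) + P.g x + psi P M σ zBar.snd (P.A x) + (quad M.Mx σ (x - zBar.fst) : EReal)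

/-- The optimality gap `F(x) - F^⋆ ∈ [0, ∞]`. -/
def gap (P : Problem n m) (M : Preconditioner n m) (σ : ℝ) (zBar : PD n m) (x : Vec n) : ℝ≥0∞ :=
  (objF P M σ zBar x - ⨅ y, objF P M σ zBar y).toENNReal

/-- The smooth part `f(x) = f₀(x) + ψ(A x, lamBar, σ)` (it is finite everywhere). -/
def smoothPart (P : Problem n m) (M : Preconditioner n m) (σ : ℝ) (lamBar : Vec m) (x : Vec n) : ℝ :=
  P.f₀ x + (psi P M σ lamBar (P.A x)).toReal

/-- The constant `a = ‖A‖² / λ_min(Ml)`. -/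
def cstA (P : Problem n m) (M : Preconditioner n m) : ℝ := ‖P.A‖ ^ 2 / M.lamMinL

/-- The Lipschitz constant `L = L₀ + σ ‖A‖² / λ_min(Ml)` of the gradient of the smooth part. -/
def lipL (P : Problem n m) (M : Preconditioner n m) (σ : ℝ) : ℝ := P.L₀ + σ / M.lamMinL * ‖P.A‖ ^ 2

/-- The proximal gradient operator
`G_F(x) = argmin_y (L/2)‖y - (x - (1/L) ∇f(x))‖² + g(y) + (1/(2σ))‖y - xBar‖²_{Mx}`. -/
def proxGrad (P : Problem n m) (M : Preconditioner n m) (σ : ℝ) (zBar : PD n m) (x : Vec n) :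
    Vec n :=
  argminPt fun y : Vec n =>
    ((lipL P M σ / 2 *
        ‖y - (x - (1 / lipL P M σ) • gradient (smoothPart P M σ zBar.snd) x)‖ ^ 2 : ℝ) : EReal)
      + (P.g y + (quad M.Mx σ (y - zBar.fst) : EReal))

/-- The point `(x, Λ(x, lamBar, σ))`. -/
def liftPt (P : Problem n m) (M : Preconditioner n m) (σ : ℝ) (zBar : PD n m) (x : Vec n) :
    PD n m :=
  pair x (Lam P M σ zBar.snd x)

/-- The computable stopping criterion of the inner algorithm:
`dist(0, ∂F(x)) ≤ (√λ_min(Mx) / σ) min {η, δ ‖(x, Λ(x)) - (xBar, lamBar)‖_M}`. -/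
def stopCrit (P : Problem n m) (M : Preconditioner n m) (σ η δ : ℝ) (zBar : PD n m) (x : Vec n) :
    Prop :=
  Metric.infEDist 0 (subdiff (objF P M σ zBar) x) ≤
    ENNReal.ofReal (Real.sqrt M.lamMinX / σ *
      min η (δ * normM M (liftPt P M σ zBar x - zBar)))

/-- A randomized inner solver. In the inner problem `F_{s,t}` with base point `zBar`, one call from
`x` with random choices `ξ` returns `solve s t zBar x ξ`, and `cost s t zBar x ξ` is the number of
elementary operations of the corresponding iteration (solver call and tests) of the inner
algorithm. -/
structure InnerSolver (n m : ℕ) (Ξ : Type*) where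
  solve : ℕ → ℕ → PD n m → Vec n → Ξ → Vec n
  cost : ℕ → ℕ → PD n m → Vec n → Ξ → ℕ

/-- The homogeneous objective decrease property: the solver maps `dom g` to itself, and
`E[F_{s,t}(solve x) - F^⋆] ≤ e⁻¹ (F_{s,t}(x) - F^⋆)` for `x ∈ dom g`, for every inner problem. -/
structure IsHOOD {Ξ : Type*} [MeasurableSpace Ξ] (ν : Measure Ξ) (P : Problem n m)
    (M : Preconditioner n m) (q : Params) (S : InnerSolver n m Ξ) : Prop where
  measurable_solve : ∀ s t,
    Measurable fun w : PD n m × Vec n × Ξ => S.solve s t w.1 w.2.1 w.2.2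
  mem_dom : ∀ s t zBar x ξ, P.g x ≠ ⊤ → P.g (S.solve s t zBar x ξ) ≠ ⊤
  decrease : ∀ s t zBar x, P.g x ≠ ⊤ →
    ∫⁻ ξ, gap P M (q.sig s) zBar (S.solve s t zBar x ξ) ∂ν ≤
      ENNReal.ofReal (Real.exp (-1)) * gap P M (q.sig s) zBar x

/-! ### AGPPA as a machine

One step of the machine is one iteration of the inner algorithm. The random choices of inner
iteration `k` of the proximal step `(s, t)` are `ω (s, t, k)`. -/

/-- State of AGPPA: outer counter `s`, proximal-step counter `t`, inner iteration counter `k`, the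
points `path j = z^{s,j}` for `j ≤ t`, the current inner iterate `x = x^k`, the number `ops` of
elementary operations used so far, and the output, once the algorithm has terminated. -/
structure State (n m : ℕ) where
  s : ℕ
  t : ℕ
  k : ℕ
  path : ℕ → PD n m
  x : Vec n
  ops : ℕ
  out : Option (PD n m)

open Classical in
/-- Beginning of the outer iteration `s` at `z = z^{s,0}`: terminate if `E(z) ≤ ε`, otherwise start
the inner algorithm at `x⁰ = G_F(xBar)`. -/
def enterOuter (P : Problem n m) (M : Preconditioner n m) (q : Params) (E : PD n m → ℝ) (ε : ℝ)
    (s : ℕ) (z : PD n m) (ops : ℕ) : State n m where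
  s := s
  t := 0
  k := 0
  path := fun _ => z
  x := proxGrad P M (q.sig s) z z.fst
  ops := ops
  out := if E z ≤ ε then some z else none

/-- The linear-decrease test fails at `t`:
`‖z^{s,t+1} - z^{s,t}‖_M > C min_{0 ≤ j ≤ t} ρ^{t-j} ‖z^{s,j+1} - z^{s,j}‖_M`. -/
def testFails (M : Preconditioner n m) (q : Params) (path : ℕ → PD n m) (t : ℕ) : Prop :=
  ∃ j ≤ t, q.testC * (q.rho ^ (t - j) * normM M (path (j + 1) - path j)) <
    normM M (path (t + 1) - path t)

/-- The first index at which `E` is minimal among `path 0, …, path N`. -/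
def bestIdx (E : PD n m → ℝ) (path : ℕ → PD n m) (N : ℕ) : ℕ :=
  sInf {j | j ≤ N ∧ ∀ i ≤ N, E (path j) ≤ E (path i)}

open Classical in
/-- One step of AGPPA with random choices `ξ`. From the inner iterate `x = x^k`, call the solver,
keep the better of `x` and the result, and apply the proximal gradient operator. If the stopping
criterion is not met, go on with the inner algorithm. If it is met, the proximal step is complete:
`z^{s,t+1} = γ w + (1 - γ) z^{s,t}` with `w = (x^{k+1}, Λ(x^{k+1}))`. Then terminate if
`E(z^{s,t}) ≤ ε`, begin a new outer iteration (from the best point, with increased `σ`) if the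
linear-decrease test fails, and continue with the proximal step `(s, t + 1)` otherwise. -/
def step {Ξ : Type*} (P : Problem n m) (M : Preconditioner n m) (q : Params) (E : PD n m → ℝ)
    (ε : ℝ) (S : InnerSolver n m Ξ) (st : State n m) (ξ : Ξ) : State n m :=
  match st.out with
  | some _ => st
  | none =>
    let z := st.path st.t
    let σ := q.sig st.s
    let y := S.solve st.s st.t z st.x ξ
    let y₁ := if objF P M σ z st.x < objF P M σ z y then st.x else y
    let x₁ := proxGrad P M σ z y₁
    let ops₁ := st.ops + S.cost st.s st.t z st.x ξ
    if stopCrit P M σ (q.eta st.s st.t) q.δ z x₁ then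
      let w := liftPt P M σ z x₁
      let zNext := q.γ • w + (1 - q.γ) • z
      let path₁ := Function.update st.path (st.t + 1) zNext
      if E z ≤ ε then
        { st with ops := ops₁, out := some z }
      else if testFails M q path₁ st.t then
        enterOuter P M q E ε (st.s + 1) (path₁ (bestIdx E path₁ (st.t + 1))) ops₁
      else
        { s := st.s, t := st.t + 1, k := 0, path := path₁,
          x := proxGrad P M σ zNext zNext.fst, ops := ops₁, out := none }
    else
      { st with k := st.k + 1, x := x₁, ops := ops₁ }

/-- The state of AGPPA, started at `z0`, after `N` steps with random choices `ω`. -/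
def run {Ξ : Type*} (P : Problem n m) (M : Preconditioner n m) (q : Params) (E : PD n m → ℝ)
    (ε : ℝ) (S : InnerSolver n m Ξ) (z0 : PD n m) (ω : ℕ × ℕ × ℕ → Ξ) : ℕ → State n m
  | 0 => enterOuter P M q E ε 0 z0 0
  | N + 1 =>
    let st := run P M q E ε S z0 ω N
    step P M q E ε S st (ω (st.s, st.t, st.k))

/-- AGPPA terminates with an output `z`, `E(z) ≤ ε`, after at most `B` elementary operations. -/
def SolvesWithin {Ξ : Type*} (P : Problem n m) (M : Preconditioner n m) (q : Params)
    (E : PD n m → ℝ) (ε : ℝ) (S : InnerSolver n m Ξ) (z0 : PD n m) (ω : ℕ × ℕ × ℕ → Ξ)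
    (B : ℝ) : Prop :=
  ∃ (N : ℕ) (z : PD n m), (run P M q E ε S z0 ω N).out = some z ∧ E z ≤ ε ∧
    ((run P M q E ε S z0 ω N).ops : ℝ) ≤ B

/-! ### The quantities of the complexity bound -/

/-- `‖zProj‖ + (1/λ_min(M)) (dist_M(z0, Ω) + γ ς η₀ / ((ς - 1) (1 - ϱη)))`. -/
def radius (P : Problem n m) (M : Preconditioner n m) (q : Params) (z0 zProj : PD n m) : ℝ :=
  ‖zProj‖ + 1 / M.lamMin *
    (distM M z0 (solSet P) + q.γ * q.ς * q.η₀ / ((q.ς - 1) * (1 - q.ϱη)))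

/-- `sBar = ⌈max (log_{ϱσ} (κ α / σ₀), 0)⌉`. -/
def sBar (q : Params) (κ : ℝ) : ℕ := ⌈max (Real.logb q.ϱσ (κ * q.α / q.σ₀)) 0⌉₊

/-- `sigmaBar = α κ ϱσ`. -/
def sigmaBar (q : Params) (κ : ℝ) : ℝ := q.α * κ * q.ϱσ

/-- `RBar`. -/
def RBar (q : Params) (lamMin ζ r κ : ℝ) : ℝ :=
  (1 + q.δ) ^ 2 * ζ * r /
    ((1 - q.δ) ^ 2 * (1 - Real.sqrt (1 / (q.α ^ 2 + 1))) *
      (1 - Real.sqrt (κ ^ 2 / (q.σ₀ ^ 2 + κ ^ 2))) * lamMin)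

/-- `⌈max (log_{1/ρ} (RBar / ε), 0) + 1⌉`. -/
def innerCount (q : Params) (lamMin ζ r κ ε : ℝ) : ℕ :=
  ⌈max (Real.logb (1 / q.rho) (RBar q lamMin ζ r κ / ε)) 0 + 1⌉₊

/-- `NBar = sBar ⌈max (log_{1/ρ} (RBar / ε), 0) + 1⌉`. -/
def NBar (q : Params) (lamMin ζ r κ ε : ℝ) : ℕ := sBar q κ * innerCount q lamMin ζ r κ ε

/-- `etaBar = η₀ ϱη^sBar ⌈max (log_{1/ρ} (RBar / ε), 0) + 1⌉^(-ς)`. -/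
def etaBar (q : Params) (lamMin ζ r κ ε : ℝ) : ℝ :=
  q.η₀ * q.ϱη ^ sBar q κ * (innerCount q lamMin ζ r κ ε : ℝ) ^ (-q.ς)

/-- `zetaBar₁ = 2 (L₀ sigmaBar + a sigmaBar²)² r² / (p etaBar² λ_min(Mx))`. -/
def zetaBar₁ (P : Problem n m) (M : Preconditioner n m) (q : Params) (ζ r κ ε p : ℝ) : ℝ :=
  2 * (P.L₀ * sigmaBar q κ + cstA P M * sigmaBar q κ ^ 2) ^ 2 * r ^ 2 /
    (p * etaBar q M.lamMin ζ r κ ε ^ 2 * M.lamMinX)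

/-- `zetaBar₂ = 2 (1+δ)² (L₀ sigmaBar + a sigmaBar²)² / (p δ² λ_min(Mx) λ_min(M))`. -/
def zetaBar₂ (P : Problem n m) (M : Preconditioner n m) (q : Params) (κ p : ℝ) : ℝ :=
  2 * (1 + q.δ) ^ 2 * (P.L₀ * sigmaBar q κ + cstA P M * sigmaBar q κ ^ 2) ^ 2 /
    (p * q.δ ^ 2 * M.lamMinX * M.lamMin)

/-- The general complexity expression
`NBar ⌈ln NBar + max (ln zetaBar₁, ln zetaBar₂, 0)⌉ 𝒯(sigmaBar)`. -/
def generalBound (P : Problem n m) (M : Preconditioner n m) (q : Params) (T : ℝ → ℝ)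
    (ζ r κ ε p : ℝ) : ℝ :=
  (NBar q M.lamMin ζ r κ ε : ℝ) *
    (⌈Real.log (NBar q M.lamMin ζ r κ ε) +
        max (max (Real.log (zetaBar₁ P M q ζ r κ ε p)) (Real.log (zetaBar₂ P M q κ p))) 0⌉ : ℝ) *
    T (sigmaBar q κ)

/-- `(ϑ₁ (α ϱσ κ)^ι + ϑ₂ (α ϱσ κ)^(ι/2) + Υ) ·
ln κ · ln (ζ r κ / ε) · ln ((r κ (L₀ + a) / p) ln (ζ r κ / ε))`. -/
def explicitBound (P : Problem n m) (M : Preconditioner n m) (q : Params) (ϑ₁ ϑ₂ Υ ι : ℝ)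
    (ζ r κ ε p : ℝ) : ℝ :=
  (ϑ₁ * (q.α * q.ϱσ * κ) ^ ι + ϑ₂ * (q.α * q.ϱσ * κ) ^ (ι / 2) + Υ) *
    (Real.log κ * Real.log (ζ * r * κ / ε) *
      Real.log (r * κ * (P.L₀ + cstA P M) / p * Real.log (ζ * r * κ / ε)))

/-- `ϑ₁ κ · ln κ · ln (ζ r κ / ε) · ln ((r κ (L₀ + ‖A‖) / p) ln (ζ r κ / ε))`. -/
def reducedBound (P : Problem n m) (ϑ₁ : ℝ) (ζ r κ ε p : ℝ) : ℝ :=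
  ϑ₁ * κ * Real.log κ * Real.log (ζ * r * κ / ε) *
    Real.log (r * κ * (P.L₀ + ‖P.A‖) / p * Real.log (ζ * r * κ / ε))

end AGPPA

end

/-! The exact proximal point `wStar` of a base point `z` is the resolvent of `T_ℓ` with the metric
`M/σ`. Monotonicity of `T_ℓ` makes this map firmly nonexpansive towards every solution, so the
squared displacement `‖z - w‖_M²` plus `dist_M(w, Ω)²` is at most `dist_M(z, Ω)²`. Metric
subregularity at `w` gives `σ dist_M(w, Ω) ≤ κ ‖z - w‖_M`. Together they contract the distance to
`Ω` by `contr a` whenever `0 < a` and `a κ ≤ σ`.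

The inner stopping criterion places the computed point within `η` of `wStar`, and within `δ` times
the length of the move. The absolute errors are summable, so all iterates stay in a weighted ball
around `zProj` and all exact proximal points have norm at most `r`, which is where subregularity is
available. The relative errors preserve linear convergence: for `σ_s ≥ α κ` each step contracts by
`ρ` (`InexactStep.distM_le`). Step lengths are comparable with distances to `Ω`, so in that regime
the linear-decrease test cannot fail (`Setting.not_testFails`), and the outer counter never exceeds
`sBar`. Conversely, a passed test bounds the residual by `RBar ρ^t` for every `σ_s ≥ σ₀`
(`Setting.E_le_of_test`), hence `t < innerCount`. Thus every sample path has at most `(sBar + 1) *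
innerCount` proximal steps.

Randomness only affects the length of a proximal step. If an inner iteration does not stop, the
current optimality gap is at least the initial one divided by `2 p max(ζ₁, ζ₂)`
(`Setting.gap_base_le_of_not_stopCrit`). The gap relative to the initial one has mean at most `e⁻ᵏ`
after `k` iterations (`Setting.tsum_meanRelGap_le`). Markov's inequality and a union bound over all
admissible counters `(s, t)` show that, outside an event of probability at most `p`, no proximal
step needs more than about `ln(2 (sBar + 1) innerCount) + max(ln ζ₁, ln ζ₂, 0)` iterations
(`Setting.le_measure_solvesWithin`).

It remains to compare logarithms: the three factors are of order `ln κ`, `ln(ζ r κ / ε)` and the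
last logarithm of the bound (`exists_totalSteps_mul_le`). Squaring inside a logarithm costs only a
constant, which gives the reduced form (`exists_explicitBound_le`). -/

noncomputable section

namespace AGPPA

/-! ### Extended-real convex functions: subgradients, proximal points, conjugates. -/

section ConvexAnalysis

variable {E : Type*} [NormedAddCommGroup E] [InnerProductSpace ℝ E] {φ : E → EReal}

theorem IsProperClosedConvex.coe_toReal (h : IsProperClosedConvex φ) {x : E} (hx : φ x ≠ ⊤) :
    ((φ x).toReal : EReal) = φ x :=
  EReal.coe_toReal hx (h.ne_bot x)

theorem IsProperClosedConvex.combo (h : IsProperClosedConvex φ) {x y : E} (hx : φ x ≠ ⊤)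
    (hy : φ y ≠ ⊤) {a b : ℝ} (ha : 0 ≤ a) (hb : 0 ≤ b) (hab : a + b = 1) :
    φ (a • x + b • y) ≠ ⊤ ∧
      (φ (a • x + b • y)).toReal ≤ a * (φ x).toReal + b * (φ y).toReal := by
  have hx' : ((x, (φ x).toReal) : E × ℝ) ∈ {q : E × ℝ | φ q.1 ≤ (q.2 : EReal)} :=
    (h.coe_toReal hx).ge
  have hy' : ((y, (φ y).toReal) : E × ℝ) ∈ {q : E × ℝ | φ q.1 ≤ (q.2 : EReal)} :=
    (h.coe_toReal hy).ge
  have := h.convex_epigraph hx' hy' ha hb hab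
  simp only [Set.mem_ofPred_eq, Prod.smul_mk, Prod.mk_add_mk, smul_eq_mul] at this
  have h1 : φ (a • x + b • y) ≠ ⊤ := fun h => by
    rw [h] at this; exact absurd (top_le_iff.1 this) (EReal.coe_ne_top _)
  refine ⟨h1, ?_⟩
  rw [← h.coe_toReal h1] at this
  exact_mod_cast this

theorem IsProperClosedConvex.toReal_lineMap_le (h : IsProperClosedConvex φ) {x y : E}
    (hx : φ x ≠ ⊤) (hy : φ y ≠ ⊤) {t : ℝ} (h0 : 0 ≤ t) (h1 : t ≤ 1) :
    φ (x + t • (y - x)) ≠ ⊤ ∧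
      (φ (x + t • (y - x))).toReal ≤ (φ x).toReal + t * ((φ y).toReal - (φ x).toReal) := by
  have := h.combo hx hy (sub_nonneg.2 h1) h0 (by ring)
  have e : x + t • (y - x) = (1 - t) • x + t • y := by module
  rw [e]
  exact ⟨this.1, this.2.trans (by linarith)⟩

/-- Subgradients, in terms of the real values of the function on its domain. -/
def IsSubgrad (φ : E → EReal) (p v : E) : Prop :=
  φ p ≠ ⊤ ∧ ∀ y, φ y ≠ ⊤ → (φ p).toReal + ⟪v, y - p⟫ ≤ (φ y).toReal

theorem IsSubgrad.monotone {p p' v v' : E} (h : IsSubgrad φ p v) (h' : IsSubgrad φ p' v') :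
    0 ≤ ⟪v - v', p - p'⟫ := by
  have h1 := h.2 p' h'.1
  have h2 := h'.2 p h.1
  have : ⟪v, p' - p⟫ = - ⟪v, p - p'⟫ := by rw [← inner_neg_right, neg_sub]
  rw [inner_sub_left]
  linarith

/-- Replaces the limit `t → 0`. If `A < 0`, then `t = min 1 (-A/(2K))` gives `K t ≤ -A/2 < -A`, a
contradiction. -/
theorem nonneg_of_forall_mul_le {A K : ℝ} (h : ∀ t : ℝ, 0 < t → t ≤ 1 → -(K * t) ≤ A) : 0 ≤ A := by
  by_contra! hA
  have hK : 0 < K := by have := h 1 one_pos le_rfl; linarith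
  have h1 := h (min 1 (-A / (2 * K))) (lt_min one_pos (by apply div_pos <;> linarith))
    (min_le_left _ _)
  have h2 : K * min 1 (-A / (2 * K)) ≤ K * (-A / (2 * K)) := by gcongr; exact min_le_right _ _
  have h3 : K * (-A / (2 * K)) = -A / 2 := by field_simp
  linarith

/-- First-order optimality condition for the sum of a convex function and a function with a
quadratic upper model. -/
theorem IsProperClosedConvex.isSubgrad_of_isMin (h : IsProperClosedConvex φ) {Q : E → ℝ}
    {p q : E} {K : ℝ} (hp : φ p ≠ ⊤)
    (hmin : ∀ y, φ y ≠ ⊤ → (φ p).toReal + Q p ≤ (φ y).toReal + Q y)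
    (hQ : ∀ y, Q y ≤ Q p + ⟪q, y - p⟫ + K * ‖y - p‖ ^ 2) : IsSubgrad φ p (-q) := by
  refine ⟨hp, fun y hy => ?_⟩
  rw [inner_neg_left]
  suffices 0 ≤ (φ y).toReal - (φ p).toReal + ⟪q, y - p⟫ by linarith
  -- Move from `p` towards `y` by the fraction `t`. Convexity bounds the change of `φ` linearly in
  -- `t`, the model of `Q` adds a term of order `t²`, and division by `t` leaves an error of order
  -- `t`.
  refine nonneg_of_forall_mul_le (K := K * ‖y - p‖ ^ 2) fun t ht ht1 => ?_
  obtain ⟨h1, h2⟩ := h.toReal_lineMap_le hp hy ht.le ht1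
  have h3 := hmin _ h1
  have h4 := hQ (p + t • (y - p))
  rw [add_sub_cancel_left, inner_smul_right, norm_smul, Real.norm_of_nonneg ht.le] at h4
  have : t * -(K * ‖y - p‖ ^ 2 * t) ≤ t * ((φ y).toReal - (φ p).toReal + ⟪q, y - p⟫) := by
    nlinarith
  exact le_of_mul_le_mul_left this ht

/-- Existence of minimizers of the sum of a proper closed convex function and a continuous
function with quadratic growth. -/
theorem IsProperClosedConvex.exists_isMin_add [FiniteDimensional ℝ E] (h : IsProperClosedConvex φ) {Q : E → ℝ}
    (hc : Continuous Q)
    (hQ : ∀ x₀, ∃ (q : E) (m : ℝ), 0 < m ∧ ∀ y, Q x₀ + ⟪q, y - x₀⟫ + m * ‖y - x₀‖ ^ 2 ≤ Q y) :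
    ∃ p, φ p ≠ ⊤ ∧ ∀ y, φ y ≠ ⊤ → (φ p).toReal + Q p ≤ (φ y).toReal + Q y := by
  obtain ⟨x₀, hx₀⟩ := h.exists_finite
  obtain ⟨q, m, hm, hQ⟩ := hQ x₀
  obtain ⟨u, hu, humin⟩ := (h.lsc.lowerSemicontinuousOn _).exists_isMinOn
    ⟨x₀, Metric.mem_closedBall_self zero_le_one⟩ (isCompact_closedBall x₀ 1)
  have hu0 : φ u ≠ ⊤ := by
    intro hu'
    have := humin (Metric.mem_closedBall_self zero_le_one : x₀ ∈ Metric.closedBall x₀ 1)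
    simp only [Set.mem_ofPred_eq, hu', top_le_iff] at this
    exact hx₀ this
  set K := (φ x₀).toReal - (φ u).toReal with hK
  have hball : ∀ y ∈ Metric.closedBall x₀ 1, φ y ≠ ⊤ → (φ u).toReal ≤ (φ y).toReal := by
    intro y hy hy'
    have := humin hy
    simp only [Set.mem_ofPred_eq] at this
    rw [← h.coe_toReal hu0, ← h.coe_toReal hy'] at this
    exact_mod_cast this
  have hK0 : 0 ≤ K := sub_nonneg.2 (hball x₀ (Metric.mem_closedBall_self zero_le_one) hx₀)
  -- `φ` is bounded below on the unit ball by compactness; convexity along rays from `x₀` then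
  -- allows at most linear decrease outside it.
  have hlow : ∀ y, φ y ≠ ⊤ → 1 ≤ ‖y - x₀‖ → (φ x₀).toReal - ‖y - x₀‖ * K ≤ (φ y).toReal := by
    intro y hy hR
    set R := ‖y - x₀‖
    have hR0 : 0 < R := by linarith
    obtain ⟨h1, h2⟩ := h.toReal_lineMap_le hx₀ hy (inv_nonneg.2 hR0.le) (inv_le_one_of_one_le₀ hR)
    have h3 := hball _ (by
      rw [Metric.mem_closedBall, dist_eq_norm, add_sub_cancel_left, norm_smul, norm_inv,
        Real.norm_of_nonneg hR0.le, inv_mul_cancel₀ hR0.ne']) h1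
    have h4 : R * (φ u).toReal ≤ R * ((φ x₀).toReal + R⁻¹ * ((φ y).toReal - (φ x₀).toReal)) := by
      gcongr; linarith
    rw [mul_add, ← mul_assoc, mul_inv_cancel₀ hR0.ne'] at h4
    rw [hK]; linarith
  set S : E → EReal := fun y => φ y + (Q y : EReal) with hS
  have hSl : LowerSemicontinuous S := by
    refine LowerSemicontinuous.add' h.lsc ?_ ?_
    · exact (continuous_coe_real_ereal.comp hc).lowerSemicontinuous
    · intro x
      exact EReal.continuousAt_add (Or.inr (EReal.coe_ne_bot _)) (Or.inr (EReal.coe_ne_top _))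
  -- Beyond this radius the quadratic growth `m R²` beats the linear losses `K R` from `φ` and `‖q‖
  -- R` from `Q`, so the minimum over the ball is global.
  set R₀ := max 1 ((K + ‖q‖) / m) with hR₀
  obtain ⟨p, hp, hpmin⟩ := (hSl.lowerSemicontinuousOn _).exists_isMinOn
    ⟨x₀, Metric.mem_closedBall_self (zero_le_one.trans (le_max_left _ _))⟩
    (isCompact_closedBall x₀ R₀)
  have hpx₀ : S p ≤ S x₀ :=
    hpmin (Metric.mem_closedBall_self (zero_le_one.trans (le_max_left _ _)))
  have hp0 : φ p ≠ ⊤ := by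
    intro hp'
    simp only [hS, hp', EReal.top_add_coe, top_le_iff] at hpx₀
    rw [← h.coe_toReal hx₀] at hpx₀
    exact absurd hpx₀ (by norm_cast; exact EReal.coe_ne_top _)
  have hSr : ∀ y, φ y ≠ ⊤ → S y = (((φ y).toReal + Q y : ℝ) : EReal) := by
    intro y hy
    simp only [hS]
    rw [EReal.coe_add, h.coe_toReal hy]
  rw [hSr _ hp0, hSr _ hx₀, EReal.coe_le_coe_iff] at hpx₀
  refine ⟨p, hp0, fun y hy => ?_⟩
  by_cases hyR : y ∈ Metric.closedBall x₀ R₀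
  · have : S p ≤ S y := hpmin hyR
    rw [hSr _ hp0, hSr _ hy] at this
    exact_mod_cast this
  · rw [Metric.mem_closedBall, dist_eq_norm, not_le] at hyR
    have h1 := hlow y hy ((le_max_left _ _).trans hyR.le)
    have h2 := hQ y
    have h3 : (K + ‖q‖) / m ≤ ‖y - x₀‖ := (le_max_right _ _).trans hyR.le
    rw [div_le_iff₀ hm] at h3
    have h4 := neg_le_of_abs_le (abs_real_inner_le_norm q (y - x₀))
    have h5 := norm_nonneg (y - x₀)
    nlinarith

/-- A symmetric operator with `ω ‖v‖² ≤ ⟪v, W v⟫`. -/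
structure IsCoercive (W : E →L[ℝ] E) (ω : ℝ) : Prop where
  pos : 0 < ω
  symm : ∀ x y : E, ⟪W x, y⟫ = ⟪x, W y⟫
  le : ∀ v : E, ω * ‖v‖ ^ 2 ≤ ⟪v, W v⟫

theorem IsCoercive.expand {W : E →L[ℝ] E} {ω : ℝ} (hW : IsCoercive W ω) (x y : E) :
    ⟪y, W y⟫ = ⟪x, W x⟫ + 2 * ⟪W x, y - x⟫ + ⟪y - x, W (y - x)⟫ := by
  obtain ⟨d, rfl⟩ : ∃ d, y = x + d := ⟨y - x, by abel⟩
  simp only [add_sub_cancel_left, map_add, inner_add_left, inner_add_right]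
  rw [hW.symm x d, ← hW.symm d x, real_inner_comm x (W d)]
  ring

/-- Optimality condition of a strongly convex problem. The dual maximizer and the proximal gradient
step are both instances of this inclusion, with different weights `W`. -/
theorem IsProperClosedConvex.exists_prox [FiniteDimensional ℝ E] (h : IsProperClosedConvex φ) {W : E →L[ℝ] E} {ω : ℝ}
    (hW : IsCoercive W ω) (b : E) : ∃ p, IsSubgrad φ p (b - W p) := by
  set Q : E → ℝ := fun y => 1 / 2 * ⟪y, W y⟫ - ⟪b, y⟫ with hQ
  have hexp : ∀ x y, Q y = Q x + ⟪W x - b, y - x⟫ + 1 / 2 * ⟪y - x, W (y - x)⟫ := by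
    intro x y
    simp only [hQ]
    rw [hW.expand x y, inner_sub_left (W x), inner_sub_right b]
    ring
  obtain ⟨p, hp, hmin⟩ := h.exists_isMin_add (Q := Q) (by fun_prop) (fun x₀ =>
    ⟨W x₀ - b, ω / 2, by have := hW.pos; positivity, fun y => by
      rw [hexp x₀ y]; have := hW.le (y - x₀); linarith⟩)
  refine ⟨p, ?_⟩
  rw [← neg_sub]
  refine h.isSubgrad_of_isMin (K := 1 / 2 * ‖W‖) hp hmin fun y => ?_
  rw [hexp p y]
  have h1 := real_inner_le_norm (y - p) (W (y - p))
  have h2 := mul_le_mul_of_nonneg_left (W.le_opNorm (y - p)) (norm_nonneg (y - p))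
  nlinarith

theorem IsCoercive.prox_lipschitz {W : E →L[ℝ] E} {ω : ℝ} (hW : IsCoercive W ω) {b b' p p' : E}
    (h : IsSubgrad φ p (b - W p)) (h' : IsSubgrad φ p' (b' - W p')) :
    ω * ‖p - p'‖ ^ 2 ≤ ⟪b - b', p - p'⟫ := by
  have h1 := h.monotone h'
  have h2 := hW.le (p - p')
  have e : b - W p - (b' - W p') = (b - b') - W (p - p') := by rw [map_sub]; abel
  rw [e, inner_sub_left, real_inner_comm (p - p') (W (p - p'))] at h1
  linarith

theorem IsCoercive.prox_norm_le {W : E →L[ℝ] E} {ω : ℝ} (hW : IsCoercive W ω) {b b' p p' : E}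
    (h : IsSubgrad φ p (b - W p)) (h' : IsSubgrad φ p' (b' - W p')) :
    ‖p - p'‖ ≤ ω⁻¹ * ‖b - b'‖ := by
  have h1 := hW.prox_lipschitz h h'
  have h2 := h1.trans (real_inner_le_norm _ _)
  rw [inv_mul_eq_div, le_div_iff₀ hW.pos]
  rcases (norm_nonneg (p - p')).eq_or_lt with h0 | h0
  · rw [← h0]; simp
  · nlinarith

/-- The proximal point: the minimizer of `φ y + ½⟪y, W y⟫ - ⟪b, y⟫`. -/
def proxPt (φ : E → EReal) (W : E →L[ℝ] E) (b : E) : E :=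
  Classical.epsilon fun p => IsSubgrad φ p (b - W p)

theorem IsProperClosedConvex.isSubgrad_proxPt [FiniteDimensional ℝ E] (h : IsProperClosedConvex φ) {W : E →L[ℝ] E} {ω : ℝ}
    (hW : IsCoercive W ω) (b : E) : IsSubgrad φ (proxPt φ W b) (b - W (proxPt φ W b)) :=
  Classical.epsilon_spec (h.exists_prox hW b)

theorem IsProperClosedConvex.continuous_proxPt [FiniteDimensional ℝ E] (h : IsProperClosedConvex φ) {W : E →L[ℝ] E} {ω : ℝ}
    (hW : IsCoercive W ω) : Continuous (proxPt φ W) := by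
  refine (LipschitzWith.of_dist_le_mul (K := ω⁻¹.toNNReal) fun b b' => ?_).continuous
  rw [dist_eq_norm, dist_eq_norm, Real.coe_toNNReal _ (inv_nonneg.2 hW.pos.le)]
  exact hW.prox_norm_le (h.isSubgrad_proxPt hW b) (h.isSubgrad_proxPt hW b')

/-- Quadratic growth at the proximal point. -/
theorem IsCoercive.prox_growth {W : E →L[ℝ] E} {ω : ℝ} (hW : IsCoercive W ω) {b p : E}
    (h : IsSubgrad φ p (b - W p)) {y : E} (hy : φ y ≠ ⊤) :
    (φ p).toReal + (1 / 2 * ⟪p, W p⟫ - ⟪b, p⟫) + 1 / 2 * ⟪y - p, W (y - p)⟫ ≤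
      (φ y).toReal + (1 / 2 * ⟪y, W y⟫ - ⟪b, y⟫) := by
  have h1 := h.2 y hy
  rw [hW.expand p y]
  rw [inner_sub_left, inner_sub_right b] at h1
  linarith

/-- `argminPt` of a function that differs by a finite constant from
`φ y + ½⟪y, W y⟫ - ⟪b, y⟫` is the proximal point. -/
theorem IsProperClosedConvex.argminPt_eq (h : IsProperClosedConvex φ) {W : E →L[ℝ] E} {ω : ℝ}
    (hW : IsCoercive W ω) {b p : E} (hp : IsSubgrad φ p (b - W p)) {f : E → EReal} {cst : ℝ}
    (hf : ∀ y, f y = φ y + ((1 / 2 * ⟪y, W y⟫ - ⟪b, y⟫ + cst : ℝ) : EReal)) :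
    argminPt f = p := by
  have hfin : ∀ y, φ y ≠ ⊤ →
      f y = (((φ y).toReal + (1 / 2 * ⟪y, W y⟫ - ⟪b, y⟫ + cst) : ℝ) : EReal) := by
    intro y hy
    rw [hf, EReal.coe_add (φ y).toReal, h.coe_toReal hy]
  have htop : ∀ y, φ y = ⊤ → f y = ⊤ := by
    intro y hy
    rw [hf, hy, EReal.top_add_coe]
  have hmin : ∀ y, f p ≤ f y := by
    intro y
    by_cases hy : φ y = ⊤
    · rw [htop y hy]; exact le_top
    · rw [hfin p hp.1, hfin y hy, EReal.coe_le_coe_iff]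
      have := hW.prox_growth hp hy
      have := (mul_nonneg hW.pos.le (sq_nonneg _)).trans (hW.le (y - p))
      linarith
  have hspec : ∀ y, f (argminPt f) ≤ f y :=
    Classical.epsilon_spec (p := fun x => ∀ y, f x ≤ f y) ⟨p, hmin⟩
  set x := argminPt f
  have hx : φ x ≠ ⊤ := by
    intro hx
    have := hspec p
    rw [htop x hx, hfin p hp.1, top_le_iff] at this
    exact EReal.coe_ne_top _ this
  have h1 := hspec p
  rw [hfin p hp.1, hfin x hx, EReal.coe_le_coe_iff] at h1
  -- `argminPt` is a choice among minimizers; quadratic growth at `p` makes the minimizer unique.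
  have h2 := hW.prox_growth hp hx
  have h3 := hW.le (x - p)
  have h4 : ‖x - p‖ ^ 2 ≤ 0 := by
    have := hW.pos
    have : ω * ‖x - p‖ ^ 2 ≤ ω * 0 := by linarith
    exact le_of_mul_le_mul_left this hW.pos
  have : ‖x - p‖ = 0 := by
    have := sq_nonneg ‖x - p‖
    exact pow_eq_zero_iff two_ne_zero |>.1 (le_antisymm h4 this)
  exact sub_eq_zero.1 (norm_eq_zero.1 this)

theorem isCoercive_one : IsCoercive (ContinuousLinearMap.id ℝ E) 1 where
  pos := one_pos
  symm _ _ := rfl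
  le v := by simp

/-- Only properness needs an idea: the proximal point `p` of `0` satisfies `-p ∈ ∂φ(p)`, so the
conjugate is finite at `-p`. The other properties hold because it is a supremum of affine functions
indexed by `dom φ`. -/
theorem IsProperClosedConvex.conjugate [FiniteDimensional ℝ E] (h : IsProperClosedConvex φ) :
    IsProperClosedConvex (conjugate φ) where
  ne_bot y := by
    obtain ⟨u, hu⟩ := h.exists_finite
    have : ((⟪u, y⟫ : ℝ) : EReal) - φ u ≤ AGPPA.conjugate φ y :=
      le_iSup (fun u : E => ((⟪u, y⟫ : ℝ) : EReal) - φ u) u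
    rw [← h.coe_toReal hu, ← EReal.coe_sub] at this
    intro h'
    rw [h', le_bot_iff] at this
    exact EReal.coe_ne_bot _ this
  exists_finite := by
    obtain ⟨p, hp⟩ := h.exists_prox isCoercive_one 0
    simp only [ContinuousLinearMap.id_apply, zero_sub] at hp
    refine ⟨-p, fun h' => ?_⟩
    have : AGPPA.conjugate φ (-p) ≤ ((⟪p, -p⟫ - (φ p).toReal : ℝ) : EReal) := by
      refine iSup_le fun u => ?_
      by_cases hu : φ u = ⊤
      · rw [hu, EReal.sub_top]; exact bot_le
      · rw [← h.coe_toReal hu, ← EReal.coe_sub, EReal.coe_le_coe_iff]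
        have h1 := hp.2 u hu
        rw [inner_sub_right] at h1
        rw [real_inner_comm (-p) u, real_inner_comm (-p) p]
        linarith
    rw [h', top_le_iff] at this
    exact EReal.coe_ne_top _ this
  lsc := by
    refine lowerSemicontinuous_iSup fun u => ?_
    by_cases hu : φ u = ⊤
    · simp only [hu, EReal.sub_top]; exact lowerSemicontinuous_const
    · rw [← h.coe_toReal hu]
      refine Continuous.lowerSemicontinuous ?_
      simp only [← EReal.coe_sub]
      exact continuous_coe_real_ereal.comp (by fun_prop)
  convex_epigraph := by
    have : {q : E × ℝ | AGPPA.conjugate φ q.1 ≤ (q.2 : EReal)} =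
        ⋂ u : {u : E // φ u ≠ ⊤}, {q : E × ℝ | ⟪(u : E), q.1⟫ - (φ u).toReal ≤ q.2} := by
      ext q
      simp only [AGPPA.conjugate, iSup_le_iff, Set.mem_ofPred_eq, Set.mem_iInter, Subtype.forall]
      refine forall_congr' fun u => ?_
      by_cases hu : φ u = ⊤
      · simp [hu]
      · simp only [ne_eq, hu, not_false_eq_true, forall_const]
        nth_rw 1 [← h.coe_toReal hu]
        rw [← EReal.coe_sub, EReal.coe_le_coe_iff]
    rw [this]
    refine convex_iInter fun u => ?_
    intro x hx y hy a b ha hb hab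
    simp only [Set.mem_ofPred_eq, Prod.fst_add, Prod.smul_fst, Prod.snd_add, Prod.smul_snd,
      smul_eq_mul, inner_add_right, inner_smul_right] at *
    obtain rfl : a = 1 - b := by linarith
    nlinarith

end ConvexAnalysis

end AGPPA

end

/-! ### Eigenvalue bounds, the preconditioner, the weighted norm and distance. -/

noncomputable section

namespace AGPPA

section Eigenvalues

variable {E : Type*} [NormedAddCommGroup E] [InnerProductSpace ℝ E] [FiniteDimensional ℝ E]

theorem finite_eigenvalues (T : E →ₗ[ℝ] E) : {a : ℝ | Module.End.HasEigenvalue T a}.Finite :=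
  Module.End.finite_hasEigenvalue T

theorem inner_apply_eq_sum {T : E →ₗ[ℝ] E} (hT : T.IsSymmetric) (x : E) :
    ⟪x, T x⟫ = ∑ i, hT.eigenvalues rfl i * ⟪hT.eigenvectorBasis rfl i, x⟫ ^ 2 := by
  rw [← (hT.eigenvectorBasis rfl).sum_inner_mul_inner x (T x)]
  refine Finset.sum_congr rfl fun i _ => ?_
  rw [← hT, hT.apply_eigenvectorBasis, real_inner_smul_left, real_inner_comm]
  simp
  ring

theorem norm_sq_eq_sum {T : E →ₗ[ℝ] E} (hT : T.IsSymmetric) (x : E) :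
    ‖x‖ ^ 2 = ∑ i, ⟪hT.eigenvectorBasis rfl i, x⟫ ^ 2 := by
  rw [← real_inner_self_eq_norm_sq, ← (hT.eigenvectorBasis rfl).sum_inner_mul_inner x x]
  refine Finset.sum_congr rfl fun i _ => ?_
  rw [real_inner_comm, sq]

theorem minEig_mul_le {T : E →ₗ[ℝ] E} (hT : T.IsSymmetric) (x : E) :
    minEig T * ‖x‖ ^ 2 ≤ ⟪x, T x⟫ := by
  rw [inner_apply_eq_sum hT, norm_sq_eq_sum hT, Finset.mul_sum]
  refine Finset.sum_le_sum fun i _ => mul_le_mul_of_nonneg_right ?_ (sq_nonneg _)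
  exact csInf_le (finite_eigenvalues T).bddBelow (hT.hasEigenvalue_eigenvalues rfl i)

theorem le_maxEig_mul {T : E →ₗ[ℝ] E} (hT : T.IsSymmetric) (x : E) :
    ⟪x, T x⟫ ≤ maxEig T * ‖x‖ ^ 2 := by
  rw [inner_apply_eq_sum hT, norm_sq_eq_sum hT, Finset.mul_sum]
  refine Finset.sum_le_sum fun i _ => mul_le_mul_of_nonneg_right ?_ (sq_nonneg _)
  exact le_csSup (finite_eigenvalues T).bddAbove (hT.hasEigenvalue_eigenvalues rfl i)

theorem exists_eigenvalue [Nontrivial E] {T : E →ₗ[ℝ] E} (hT : T.IsSymmetric) :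
    {a : ℝ | Module.End.HasEigenvalue T a}.Nonempty :=
  ⟨_, hT.hasEigenvalue_iInf_of_finiteDimensional⟩

theorem minEig_pos [Nontrivial E] {T : E →ₗ[ℝ] E} (hT : T.IsSymmetric)
    (hpos : ∀ x : E, x ≠ 0 → 0 < ⟪x, T x⟫) : 0 < minEig T := by
  have h := (exists_eigenvalue hT).csInf_mem (finite_eigenvalues T)
  obtain ⟨v, hv⟩ := Module.End.HasEigenvalue.exists_hasEigenvector (show Module.End.HasEigenvalue T (minEig T) from h)
  have h1 := hpos v hv.2
  rw [hv.apply_eq_smul, real_inner_smul_right] at h1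
  exact pos_of_mul_pos_left h1 real_inner_self_nonneg

end Eigenvalues

variable {n m : ℕ}

theorem inner_PD (z w : PD n m) : ⟪z, w⟫ = ⟪z.fst, w.fst⟫ + ⟪z.snd, w.snd⟫ := rfl

theorem norm_sq_PD (z : PD n m) : ‖z‖ ^ 2 = ‖z.fst‖ ^ 2 + ‖z.snd‖ ^ 2 := by
  rw [← real_inner_self_eq_norm_sq, inner_PD, real_inner_self_eq_norm_sq,
    real_inner_self_eq_norm_sq]

namespace Preconditioner

variable (M : Preconditioner n m)

@[simp] theorem op_fst (z : PD n m) : (M.op z).fst = M.Mx z.fst := rfl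
@[simp] theorem op_snd (z : PD n m) : (M.op z).snd = M.Ml z.snd := rfl

theorem op_symm : M.op.IsSymmetric := by
  intro z w
  rw [inner_PD, inner_PD, op_fst, op_snd, op_fst, op_snd, M.posDef_Mx.1, M.posDef_Ml.1]

theorem symm_Mx : M.Mx.toLinearMap.IsSymmetric := M.posDef_Mx.1
theorem symm_Ml : M.Ml.toLinearMap.IsSymmetric := M.posDef_Ml.1

theorem inner_Mx_nonneg (x : Vec n) : 0 ≤ ⟪x, M.Mx x⟫ := by
  rcases eq_or_ne x 0 with rfl | h
  · simp
  · exact (M.posDef_Mx.2 x h).le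

theorem inner_Ml_nonneg (x : Vec m) : 0 ≤ ⟪x, M.Ml x⟫ := by
  rcases eq_or_ne x 0 with rfl | h
  · simp
  · exact (M.posDef_Ml.2 x h).le

theorem inner_op_nonneg (z : PD n m) : 0 ≤ ⟪z, M.op z⟫ :=
  add_nonneg (M.inner_Mx_nonneg _) (M.inner_Ml_nonneg _)

theorem inner_op_le (z : PD n m) : ⟪z, M.op z⟫ ≤ ‖z‖ ^ 2 := by
  have := le_maxEig_mul M.op_symm z
  rwa [show maxEig M.op = 1 from M.maxEig_eq_one, one_mul] at this

theorem lamMin_mul_le (z : PD n m) : M.lamMin * ‖z‖ ^ 2 ≤ ⟪z, M.op z⟫ := minEig_mul_le M.op_symm z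
theorem lamMinX_mul_le (x : Vec n) : M.lamMinX * ‖x‖ ^ 2 ≤ ⟪x, M.Mx x⟫ := minEig_mul_le M.symm_Mx x
theorem lamMinL_mul_le (x : Vec m) : M.lamMinL * ‖x‖ ^ 2 ≤ ⟪x, M.Ml x⟫ := minEig_mul_le M.symm_Ml x

theorem nontrivial_vec {k : ℕ} (h : 0 < k) : Nontrivial (Vec k) := by
  have : Nonempty (Fin k) := ⟨⟨0, h⟩⟩
  infer_instance

theorem lamMinX_pos (h : 0 < n) : 0 < M.lamMinX := by
  have := nontrivial_vec h
  exact minEig_pos M.symm_Mx M.posDef_Mx.2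

theorem lamMinL_pos (h : 0 < m) : 0 < M.lamMinL := by
  have := nontrivial_vec h
  exact minEig_pos M.symm_Ml M.posDef_Ml.2

/-- An eigenvector of a block, padded by zero, is an eigenvector of `M`. This lets the final
constant depend on `λ_min(M)` instead of the eigenvalues of the blocks. -/
theorem lamMin_le_lamMinX (h : 0 < n) : M.lamMin ≤ M.lamMinX := by
  have := nontrivial_vec h
  refine csInf_le_csInf (finite_eigenvalues M.op).bddBelow (exists_eigenvalue M.symm_Mx) ?_
  intro a ha
  obtain ⟨v, hv⟩ := Module.End.HasEigenvalue.exists_hasEigenvector ha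
  refine Module.End.hasEigenvalue_of_hasEigenvector (x := pair v 0) ⟨?_, ?_⟩
  · rw [Module.End.mem_eigenspace_iff]
    have h1 : M.Mx v = a • v := hv.apply_eq_smul
    refine WithLp.ofLp_injective 2 (Prod.ext ?_ ?_)
    · exact h1
    · change M.Ml 0 = a • (0 : Vec m)
      simp
  · intro h0
    exact hv.2 (congrArg (fun z : PD n m => z.fst) h0)

theorem lamMin_le_lamMinL (h : 0 < m) : M.lamMin ≤ M.lamMinL := by
  have := nontrivial_vec h
  refine csInf_le_csInf (finite_eigenvalues M.op).bddBelow (exists_eigenvalue M.symm_Ml) ?_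
  intro a ha
  obtain ⟨v, hv⟩ := Module.End.HasEigenvalue.exists_hasEigenvector ha
  refine Module.End.hasEigenvalue_of_hasEigenvector (x := pair 0 v) ⟨?_, ?_⟩
  · rw [Module.End.mem_eigenspace_iff]
    have h1 : M.Ml v = a • v := hv.apply_eq_smul
    refine WithLp.ofLp_injective 2 (Prod.ext ?_ ?_)
    · change M.Mx 0 = a • (0 : Vec n)
      simp
    · exact h1
  · intro h0
    exact hv.2 (congrArg (fun z : PD n m => z.snd) h0)

theorem inner_op_comm (z w : PD n m) : ⟪z, M.op w⟫ = ⟪w, M.op z⟫ := by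
  rw [← M.op_symm, real_inner_comm]

/-- Cauchy–Schwarz for the form of `M`, from the discriminant of `t ↦ ⟪z + t w, M (z + t w)⟫ ≥ 0`.
-/
theorem inner_op_sq_le (z w : PD n m) : ⟪z, M.op w⟫ ^ 2 ≤ ⟪z, M.op z⟫ * ⟪w, M.op w⟫ := by
  have h : ∀ t : ℝ, 0 ≤ ⟪w, M.op w⟫ * (t * t) + 2 * ⟪z, M.op w⟫ * t + ⟪z, M.op z⟫ := by
    intro t
    have h1 := M.inner_op_nonneg (z + t • w)
    rw [map_add, map_smul, inner_add_left, inner_add_right, inner_add_right, real_inner_smul_right,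
      real_inner_smul_right, real_inner_smul_left, real_inner_smul_left, M.inner_op_comm w z] at h1
    linarith
  have := discrim_le_zero h
  rw [discrim] at this
  nlinarith

end Preconditioner

section WeightedNorm

variable (M : Preconditioner n m)

theorem normM_sq (z : PD n m) : normM M z ^ 2 = ⟪z, M.op z⟫ := Real.sq_sqrt (M.inner_op_nonneg z)

theorem normM_nonneg (z : PD n m) : 0 ≤ normM M z := Real.sqrt_nonneg _

theorem inner_op_le_normM (z w : PD n m) : ⟪z, M.op w⟫ ≤ normM M z * normM M w := by
  refine le_of_sq_le_sq ?_ (mul_nonneg (normM_nonneg _ _) (normM_nonneg _ _))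
  rw [mul_pow, normM_sq, normM_sq]
  exact M.inner_op_sq_le z w

theorem normM_add_sq (z w : PD n m) :
    normM M (z + w) ^ 2 = normM M z ^ 2 + 2 * ⟪z, M.op w⟫ + normM M w ^ 2 := by
  rw [normM_sq, normM_sq, normM_sq, map_add, inner_add_left, inner_add_right, inner_add_right,
    M.inner_op_comm w z]
  ring

theorem normM_add_le (z w : PD n m) : normM M (z + w) ≤ normM M z + normM M w := by
  refine le_of_sq_le_sq ?_ (add_nonneg (normM_nonneg _ _) (normM_nonneg _ _))
  rw [normM_add_sq]
  nlinarith [inner_op_le_normM M z w]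

theorem normM_smul (t : ℝ) (z : PD n m) : normM M (t • z) = |t| * normM M z := by
  rw [normM, map_smul, real_inner_smul_left, real_inner_smul_right, ← mul_assoc,
    Real.sqrt_mul (mul_self_nonneg t), Real.sqrt_mul_self_eq_abs, normM]

theorem normM_neg (z : PD n m) : normM M (-z) = normM M z := by
  rw [← neg_one_smul ℝ, normM_smul, abs_neg, abs_one, one_mul]

theorem normM_sub_comm (z w : PD n m) : normM M (z - w) = normM M (w - z) := by
  rw [← neg_sub, normM_neg]

theorem normM_sub_le (x y z : PD n m) : normM M (x - z) ≤ normM M (x - y) + normM M (y - z) := by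
  rw [← sub_add_sub_cancel x y z]
  exact normM_add_le M _ _

theorem normM_le_norm (z : PD n m) : normM M z ≤ ‖z‖ := by
  rw [normM, Real.sqrt_le_left (norm_nonneg _)]
  exact M.inner_op_le z

theorem sqrt_lamMin_mul_norm_le (h : 0 ≤ M.lamMin) (z : PD n m) :
    √M.lamMin * ‖z‖ ≤ normM M z := by
  refine Real.le_sqrt_of_sq_le ?_
  rw [mul_pow, Real.sq_sqrt h]
  exact M.lamMin_mul_le z

theorem sqrt_lamMinX_mul_norm_le (h : 0 ≤ M.lamMinX) (z : PD n m) :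
    √M.lamMinX * ‖z.fst‖ ≤ normM M z := by
  refine Real.le_sqrt_of_sq_le ?_
  rw [mul_pow, Real.sq_sqrt h, inner_PD]
  have := M.lamMinX_mul_le z.fst
  have := M.inner_Ml_nonneg z.snd
  simp only [Preconditioner.op_fst, Preconditioner.op_snd]
  linarith

/-- Cauchy–Schwarz for `M z` and `z`, together with `λ_max(M) = 1`. It measures the resolvent
residual `M (z - w) / σ` in the Euclidean norm without an extra constant. -/
theorem norm_op_le (z : PD n m) : ‖M.op z‖ ≤ normM M z := by
  refine Real.le_sqrt_of_sq_le ?_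
  have h1 := M.inner_op_sq_le (M.op z) z
  have h2 := M.inner_op_le (M.op z)
  rw [real_inner_self_eq_norm_sq] at h1
  have h3 := M.inner_op_nonneg z
  rcases (sq_nonneg ‖M.op z‖).eq_or_lt with h0 | h0
  · rw [← h0]; exact h3
  · nlinarith

theorem continuous_fst_PD : Continuous fun z : PD n m => z.fst :=
  continuous_fst.comp (WithLp.prod_continuous_ofLp 2 _ _)

theorem continuous_snd_PD : Continuous fun z : PD n m => z.snd :=
  continuous_snd.comp (WithLp.prod_continuous_ofLp 2 _ _)

theorem continuous_pair {X : Type*} [TopologicalSpace X] {f : X → Vec n} {g : X → Vec m}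
    (hf : Continuous f) (hg : Continuous g) : Continuous fun x => pair (f x) (g x) :=
  (WithLp.prod_continuous_toLp 2 _ _).comp (hf.prodMk hg)

theorem continuous_normM : Continuous (normM M) :=
  Real.continuous_sqrt.comp ((continuous_fst_PD.inner (M.Mx.continuous.comp continuous_fst_PD)).add
    (continuous_snd_PD.inner (M.Ml.continuous.comp continuous_snd_PD)))

section Dist

variable {D : Set (PD n m)}

theorem distM_bddBelow (z : PD n m) : BddBelow ((fun d => normM M (d - z)) '' D) :=
  ⟨0, by rintro _ ⟨d, _, rfl⟩; exact normM_nonneg M _⟩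

theorem distM_nonneg (z : PD n m) : 0 ≤ distM M z D :=
  Real.sInf_nonneg (by rintro _ ⟨d, _, rfl⟩; exact normM_nonneg M _)

theorem distM_le {p : PD n m} (hp : p ∈ D) (z : PD n m) : distM M z D ≤ normM M (p - z) :=
  csInf_le (distM_bddBelow M z) ⟨p, hp, rfl⟩

theorem le_distM (hD : D.Nonempty) {z : PD n m} {c : ℝ} (h : ∀ p ∈ D, c ≤ normM M (p - z)) :
    c ≤ distM M z D :=
  le_csInf (hD.image _) (by rintro _ ⟨d, hd, rfl⟩; exact h d hd)

theorem exists_normM_lt (hD : D.Nonempty) (z : PD n m) {c : ℝ} (h : distM M z D < c) :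
    ∃ p ∈ D, normM M (p - z) < c := by
  obtain ⟨_, ⟨p, hp, rfl⟩, h⟩ := exists_lt_of_csInf_lt (hD.image _) h
  exact ⟨p, hp, h⟩

theorem distM_le_add (hD : D.Nonempty) (z w : PD n m) :
    distM M z D ≤ distM M w D + normM M (z - w) := by
  rw [← sub_le_iff_le_add]
  refine le_distM M hD fun p hp => ?_
  have h1 := distM_le M hp z
  have h2 := normM_sub_le M p w z
  rw [normM_sub_comm M w z] at h2
  linarith

theorem distM_le_infDist (hD : D.Nonempty) (z : PD n m) : distM M z D ≤ Metric.infDist z D := by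
  refine le_of_forall_gt fun c hc => ?_
  obtain ⟨p, hp, h⟩ := (Metric.infDist_lt_iff hD).1 hc
  refine (distM_le M hp z).trans_lt ((normM_le_norm M _).trans_lt ?_)
  rwa [← dist_eq_norm, dist_comm]

theorem infDist_le_distM (hD : D.Nonempty) (hM : 0 < M.lamMin) (z : PD n m) :
    √M.lamMin * Metric.infDist z D ≤ distM M z D := by
  refine le_distM M hD fun p hp => ?_
  refine le_trans ?_ (sqrt_lamMin_mul_norm_le M hM.le _)
  gcongr
  rw [← dist_eq_norm, dist_comm]
  exact Metric.infDist_le_dist_of_mem hp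

/-- The distance to a convex set is convex; near-minimizers are used, so no projection is needed. -/
theorem distM_combo_le (hD : D.Nonempty) (hc : Convex ℝ D) (z w : PD n m) {a b : ℝ} (ha : 0 ≤ a)
    (hb : 0 ≤ b) (hab : a + b = 1) :
    distM M (a • z + b • w) D ≤ a * distM M z D + b * distM M w D := by
  refine le_of_forall_pos_le_add fun ε hε => ?_
  obtain ⟨p, hp, h1⟩ := exists_normM_lt M hD z (lt_add_of_pos_right _ hε)
  obtain ⟨p', hp', h2⟩ := exists_normM_lt M hD w (lt_add_of_pos_right _ hε)
  have h3 := distM_le M (hc hp hp' ha hb hab) (a • z + b • w)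
  have e : a • p + b • p' - (a • z + b • w) = a • (p - z) + b • (p' - w) := by module
  rw [e] at h3
  have h4 := normM_add_le M (a • (p - z)) (b • (p' - w))
  rw [normM_smul, normM_smul, abs_of_nonneg ha, abs_of_nonneg hb] at h4
  have h5 : a * normM M (p - z) ≤ a * (distM M z D + ε) := by gcongr
  have h6 : b * normM M (p' - w) ≤ b * (distM M w D + ε) := by gcongr
  calc _ ≤ a * (distM M z D + ε) + b * (distM M w D + ε) := by linarith
    _ = a * distM M z D + b * distM M w D + (a + b) * ε := by ring
    _ = _ := by rw [hab, one_mul]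

end Dist

end WeightedNorm

end AGPPA

end

/-! ### Smooth convex functions; the saddle-point operator and its solution set. -/

noncomputable section

namespace AGPPA

section SmoothConvex

variable {E : Type*} [NormedAddCommGroup E] [InnerProductSpace ℝ E] [CompleteSpace E] {f : E → ℝ}

theorem hasDerivAt_segment (hf : Differentiable ℝ f) (x d : E) (t : ℝ) :
    HasDerivAt (fun s : ℝ => f (x + s • d)) ⟪gradient f (x + t • d), d⟫ t := by
  have h1 := (hf (x + t • d)).hasGradientAt.hasFDerivAt
  have h2 : HasDerivAt (fun s : ℝ => x + s • d) d t := by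
    simpa using ((hasDerivAt_id t).smul_const d).const_add x
  exact h1.comp_hasDerivAt t h2

theorem gradient_le_of_convex (hc : ConvexOn ℝ Set.univ f) (hf : Differentiable ℝ f) (x y : E) :
    f x + ⟪gradient f x, y - x⟫ ≤ f y := by
  have h1 : ConvexOn ℝ Set.univ (fun s : ℝ => f (x + s • (y - x))) := by
    have := hc.comp_affineMap (AffineMap.lineMap x y : ℝ →ᵃ[ℝ] E)
    rw [Set.preimage_univ] at this
    refine this.congr fun s _ => ?_
    simp only [Function.comp_apply, AffineMap.lineMap_apply, vsub_eq_sub, vadd_eq_add]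
    rw [add_comm]
  have h2 := hasDerivAt_segment hf x (y - x) 0
  have h3 := h1.le_slope_of_hasDerivAt (Set.mem_univ 0) (Set.mem_univ 1) one_pos h2
  simp only [slope_def_field, zero_smul, add_zero, one_smul, sub_zero, div_one,
    add_sub_cancel] at h3
  linarith

/-- Descent lemma without integration: the auxiliary function `φ` along the segment has nonpositive
derivative on `t > 0`, by Cauchy–Schwarz and the Lipschitz bound. -/
theorem le_quadratic_of_lipschitz (hf : Differentiable ℝ f) {L : ℝ}
    (hL : ∀ x y, ‖gradient f x - gradient f y‖ ≤ L * ‖x - y‖) (x y : E) :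
    f y ≤ f x + ⟪gradient f x, y - x⟫ + L / 2 * ‖y - x‖ ^ 2 := by
  set d := y - x with hd
  set φ : ℝ → ℝ := fun t => f (x + t • d) - t * ⟪gradient f x, d⟫ - L / 2 * ‖d‖ ^ 2 * t ^ 2 with hφ
  have hder : ∀ t, HasDerivAt φ (⟪gradient f (x + t • d), d⟫ - ⟪gradient f x, d⟫
      - L / 2 * ‖d‖ ^ 2 * (2 * t)) t := by
    intro t
    have h1 := hasDerivAt_segment hf x d t
    have h2 := (hasDerivAt_id t).mul_const ⟪gradient f x, d⟫
    have h3 := (hasDerivAt_pow 2 t).const_mul (L / 2 * ‖d‖ ^ 2)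
    refine ((h1.sub h2).sub h3).congr_deriv ?_
    simp only [Nat.cast_ofNat, one_mul, Nat.add_one_sub_one, pow_one]
  have hanti : AntitoneOn φ (Set.Ici 0) := by
    refine antitoneOn_of_deriv_nonpos (convex_Ici 0)
      (fun t _ => (hder t).continuousAt.continuousWithinAt)
      (fun t _ => (hder t).differentiableAt.differentiableWithinAt) fun t ht => ?_
    rw [interior_Ici, Set.mem_Ioi] at ht
    rw [(hder t).deriv, ← inner_sub_left]
    have h1 := real_inner_le_norm (gradient f (x + t • d) - gradient f x) d
    have h2 := hL (x + t • d) x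
    rw [add_sub_cancel_left, norm_smul, Real.norm_of_nonneg ht.le] at h2
    have h3 := mul_le_mul_of_nonneg_right h2 (norm_nonneg d)
    nlinarith
  have := hanti (Set.mem_Ici.2 le_rfl) (Set.mem_Ici.2 zero_le_one) zero_le_one
  simp only [hφ, zero_smul, one_smul, add_zero, hd, add_sub_cancel] at this
  rw [hd]
  linarith

/-- A function squeezed between an affine function and the same plus a quadratic is differentiable
at the contact point. This yields the gradient of the envelope `ψ`. -/
theorem hasGradientAt_of_quadratic {x q : E} {K : ℝ} (h1 : ∀ y, f x + ⟪q, y - x⟫ ≤ f y)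
    (h2 : ∀ y, f y ≤ f x + ⟪q, y - x⟫ + K * ‖y - x‖ ^ 2) : HasGradientAt f q x := by
  rw [hasGradientAt_iff_isLittleO]
  have hO : (fun y => f y - f x - ⟪q, y - x⟫) =O[nhds x] fun y => ‖y - x‖ ^ 2 := by
    refine Asymptotics.IsBigO.of_bound K (Filter.Eventually.of_forall fun y => ?_)
    rw [Real.norm_of_nonneg (by linarith [h1 y]), Real.norm_of_nonneg (sq_nonneg _)]
    linarith [h2 y]
  refine hO.trans_isLittleO ?_
  have : (fun y => ‖y - x‖ ^ 2) =o[nhds x] fun y => ‖y - x‖ ^ 1 := by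
    have h := Asymptotics.isLittleO_norm_pow_norm_pow (E' := E) (show 1 < 2 by norm_num)
    exact h.comp_tendsto (tendsto_sub_nhds_zero_iff.2 Filter.tendsto_id)
  simpa using this.trans_isBigO (Asymptotics.isBigO_refl _ _)

end SmoothConvex

variable {n m : ℕ} (P : Problem n m)

theorem Problem.gradient_le (x y : Vec n) : P.f₀ x + ⟪gradient P.f₀ x, y - x⟫ ≤ P.f₀ y :=
  gradient_le_of_convex P.convex_f₀ P.differentiable_f₀ x y

theorem Problem.le_quadratic (x y : Vec n) :
    P.f₀ y ≤ P.f₀ x + ⟪gradient P.f₀ x, y - x⟫ + P.L₀ / 2 * ‖y - x‖ ^ 2 :=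
  le_quadratic_of_lipschitz P.differentiable_f₀ P.lipschitz_f₀ x y

theorem Problem.continuous_f₀ : Continuous P.f₀ := P.differentiable_f₀.continuous

theorem Problem.continuous_gradient : Continuous (gradient P.f₀) := by
  refine (LipschitzWith.of_dist_le_mul (K := P.L₀.toNNReal) fun b b' => ?_).continuous
  rw [dist_eq_norm, dist_eq_norm, Real.coe_toNNReal _ P.L₀_nonneg]
  exact P.lipschitz_f₀ b b'

theorem lagrangian_coe {x : Vec n} {lam : Vec m} (hx : P.g x ≠ ⊤) (hl : conjugate P.h lam ≠ ⊤) :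
    lagrangian P x lam =
      ((P.f₀ x + (P.g x).toReal + ⟪P.A x, lam⟫ - (conjugate P.h lam).toReal : ℝ) : EReal) := by
  rw [lagrangian, ← P.g_pcc.coe_toReal hx, ← P.h_pcc.conjugate.coe_toReal hl]
  norm_cast

/-- Holds also outside `dom g`, because `⊤ - ⊤ = ⊥` in `EReal`. -/
theorem lagrangian_eq_bot {lam : Vec m} (x : Vec n) (hl : conjugate P.h lam = ⊤) :
    lagrangian P x lam = ⊥ := by
  rw [lagrangian, hl, EReal.sub_top]

theorem lagrangian_eq_top {x : Vec n} {lam : Vec m} (hx : P.g x = ⊤)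
    (hl : conjugate P.h lam ≠ ⊤) : lagrangian P x lam = ⊤ := by
  rw [lagrangian, hx, ← P.h_pcc.conjugate.coe_toReal hl]
  simp

/-- The real form of membership in the graph of `T_ℓ`. -/
structure IsOpT (z w : PD n m) : Prop where
  dom_g : P.g z.fst ≠ ⊤
  dom_h : conjugate P.h z.snd ≠ ⊤
  primal : ∀ y, P.g y ≠ ⊤ → P.f₀ z.fst + (P.g z.fst).toReal + ⟪P.A z.fst, z.snd⟫
    + ⟪w.fst, y - z.fst⟫ ≤ P.f₀ y + (P.g y).toReal + ⟪P.A y, z.snd⟫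
  dual : ∀ l, conjugate P.h l ≠ ⊤ → (conjugate P.h z.snd).toReal - ⟪P.A z.fst, z.snd⟫
    + ⟪w.snd, l - z.snd⟫ ≤ (conjugate P.h l).toReal - ⟪P.A z.fst, l⟫

variable {P}

/-- A subgradient exists only where the Lagrangian is finite, that is, over `dom g × dom h^*`; there
all inequalities become real ones. -/
theorem mem_opT_iff {z w : PD n m} : w ∈ opT P z ↔ IsOpT P z w := by
  constructor
  · rintro ⟨⟨h1, h2, h3⟩, ⟨-, -, h6⟩⟩
    have hl : conjugate P.h z.snd ≠ ⊤ := fun hl => h2 (lagrangian_eq_bot P _ hl)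
    have hx : P.g z.fst ≠ ⊤ := fun hx => h1 (lagrangian_eq_top P hx hl)
    refine ⟨hx, hl, fun y hy => ?_, fun l hl' => ?_⟩
    · have := h3 y
      simp only [lagrangian_coe P hx hl, lagrangian_coe P hy hl] at this
      rw [← EReal.coe_add, EReal.coe_le_coe_iff] at this
      linarith
    · have := h6 l
      simp only [lagrangian_coe P hx hl, lagrangian_coe P hx hl'] at this
      rw [← EReal.coe_neg, ← EReal.coe_neg, ← EReal.coe_add, EReal.coe_le_coe_iff] at this
      linarith
  · rintro ⟨hx, hl, h1, h2⟩
    refine ⟨⟨?_, ?_, fun y => ?_⟩, ⟨?_, ?_, fun l => ?_⟩⟩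
    · simp only [lagrangian_coe P hx hl]; exact EReal.coe_ne_top _
    · simp only [lagrangian_coe P hx hl]; exact EReal.coe_ne_bot _
    · by_cases hy : P.g y = ⊤
      · simp only [lagrangian_eq_top P hy hl, le_top]
      · simp only [lagrangian_coe P hx hl, lagrangian_coe P hy hl]
        rw [← EReal.coe_add, EReal.coe_le_coe_iff]
        linarith [h1 y hy]
    · simp only [lagrangian_coe P hx hl]; rw [← EReal.coe_neg]; exact EReal.coe_ne_top _
    · simp only [lagrangian_coe P hx hl]; rw [← EReal.coe_neg]; exact EReal.coe_ne_bot _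
    · by_cases hl' : conjugate P.h l = ⊤
      · simp only [lagrangian_eq_bot P _ hl', EReal.neg_bot, le_top]
      · simp only [lagrangian_coe P hx hl, lagrangian_coe P hx hl']
        rw [← EReal.coe_neg, ← EReal.coe_neg, ← EReal.coe_add, EReal.coe_le_coe_iff]
        linarith [h2 l hl']

/-- Monotonicity of `T_ℓ`. -/
theorem IsOpT.monotone {z w z' w' : PD n m} (h : IsOpT P z w) (h' : IsOpT P z' w') :
    0 ≤ ⟪w - w', z - z'⟫ := by
  have h1 := h.primal _ h'.dom_g
  have h2 := h.dual _ h'.dom_h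
  have h3 := h'.primal _ h.dom_g
  have h4 := h'.dual _ h.dom_h
  rw [inner_PD]
  simp only [WithLp.sub_fst, WithLp.sub_snd, inner_sub_left, inner_sub_right] at *
  linarith

theorem mem_solSet_iff {z : PD n m} : z ∈ solSet P ↔ IsOpT P z 0 := by
  rw [solSet, Set.mem_ofPred_eq, mem_opT_iff]

/-- The set of saddle points is convex. -/
theorem convex_solSet (P : Problem n m) : Convex ℝ (solSet P) := by
  intro z hz z' hz' a b ha hb hab
  rw [mem_solSet_iff] at *
  obtain ⟨hg, hh, h1, h2⟩ := hz
  obtain ⟨hg', hh', h1', h2'⟩ := hz'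
  have cg := P.g_pcc.combo hg hg' ha hb hab
  have ch := P.h_pcc.conjugate.combo hh hh' ha hb hab
  have cf := P.convex_f₀.2 (Set.mem_univ z.fst) (Set.mem_univ z'.fst) ha hb hab
  have e1 := h1 _ hg'
  have e2 := h2 _ hh'
  have e1' := h1' _ hg
  have e2' := h2' _ hh
  simp only [WithLp.zero_fst, WithLp.zero_snd, inner_zero_left, add_zero] at *
  refine ⟨cg.1, ch.1, fun y hy => ?_, fun l hl => ?_⟩
  · simp only [WithLp.add_fst, WithLp.smul_fst, WithLp.add_snd, WithLp.smul_snd, map_add, map_smul,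
      inner_add_left, inner_add_right, real_inner_smul_left, real_inner_smul_right,
      WithLp.zero_fst, inner_zero_left, add_zero, smul_eq_mul] at *
    -- The saddle inequalities at `z` and `z'`, each tested at the components of the other point,
    -- form a cycle, so all of them are equalities. This determines the bilinear cross terms `c21`
    -- and `c12`.
    have c21 : ⟪P.A z'.fst, z.snd⟫ = P.f₀ z.fst + (P.g z.fst).toReal + ⟪P.A z.fst, z.snd⟫
        - P.f₀ z'.fst - (P.g z'.fst).toReal := by linarith
    have c12 : ⟪P.A z.fst, z'.snd⟫ = P.f₀ z'.fst + (P.g z'.fst).toReal + ⟪P.A z'.fst, z'.snd⟫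
        - P.f₀ z.fst - (P.g z.fst).toReal := by linarith
    have f1 := h1 y hy
    have f1' := h1' y hy
    rw [c21, c12]
    obtain rfl : a = 1 - b := by linarith
    linarith [mul_le_mul_of_nonneg_left f1 ha, mul_le_mul_of_nonneg_left f1' hb, cg.2]
  · simp only [WithLp.add_fst, WithLp.smul_fst, WithLp.add_snd, WithLp.smul_snd, map_add, map_smul,
      inner_add_left, inner_add_right, real_inner_smul_left, real_inner_smul_right,
      WithLp.zero_snd, inner_zero_left, add_zero, smul_eq_mul] at *
    have c21 : ⟪P.A z'.fst, z.snd⟫ = P.f₀ z.fst + (P.g z.fst).toReal + ⟪P.A z.fst, z.snd⟫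
        - P.f₀ z'.fst - (P.g z'.fst).toReal := by linarith
    have c12 : ⟪P.A z.fst, z'.snd⟫ = P.f₀ z'.fst + (P.g z'.fst).toReal + ⟪P.A z'.fst, z'.snd⟫
        - P.f₀ z.fst - (P.g z.fst).toReal := by linarith
    have f2 := h2 l hl
    have f2' := h2' l hl
    rw [c21, c12]
    obtain rfl : a = 1 - b := by linarith
    have e3 : (conjugate P.h z'.snd).toReal = (conjugate P.h z.snd).toReal -
        ⟪P.A z.fst, z.snd⟫ + ⟪P.A z.fst, z'.snd⟫ := by linarith
    rw [e3, c12] at ch f2'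
    linarith [mul_le_mul_of_nonneg_left f2 ha, mul_le_mul_of_nonneg_left f2' hb, ch.2]

end AGPPA

end

/-! ### The dual maximizer, the envelope `ψ` and the gradient of the smooth part. -/

noncomputable section

namespace AGPPA

section Envelope

variable {E : Type*} [NormedAddCommGroup E] [InnerProductSpace ℝ E] [FiniteDimensional ℝ E]
  {φ : E → EReal} {W : E →L[ℝ] E} {ω : ℝ}

/-- The maximal value of `⟪b, y⟫ - φ y - ½⟪y, W y⟫`. -/
def envelope (φ : E → EReal) (W : E →L[ℝ] E) (b : E) : ℝ :=
  ⟪b, proxPt φ W b⟫ - (φ (proxPt φ W b)).toReal - 1 / 2 * ⟪proxPt φ W b, W (proxPt φ W b)⟫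

theorem IsProperClosedConvex.le_envelope (h : IsProperClosedConvex φ) (hW : IsCoercive W ω) (b : E)
    {y : E} (hy : φ y ≠ ⊤) :
    ⟪b, y⟫ - (φ y).toReal - 1 / 2 * ⟪y, W y⟫ +
      1 / 2 * ⟪y - proxPt φ W b, W (y - proxPt φ W b)⟫ ≤ envelope φ W b := by
  have := hW.prox_growth (h.isSubgrad_proxPt hW b) hy
  rw [envelope]
  linarith

/-- The maximizer for `b` is a competitor for `b'`, so it is a subgradient of the envelope at `b`.
-/
theorem IsProperClosedConvex.envelope_ge (h : IsProperClosedConvex φ) (hW : IsCoercive W ω)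
    (b b' : E) : envelope φ W b + ⟪proxPt φ W b, b' - b⟫ ≤ envelope φ W b' := by
  have h1 := h.le_envelope hW b' (h.isSubgrad_proxPt hW b).1
  have h2 := (mul_nonneg hW.pos.le (sq_nonneg _)).trans (hW.le (proxPt φ W b - proxPt φ W b'))
  rw [envelope, inner_sub_right, real_inner_comm b', real_inner_comm b]
  linarith

theorem IsProperClosedConvex.envelope_le (h : IsProperClosedConvex φ) (hW : IsCoercive W ω)
    (b b' : E) : envelope φ W b' ≤
      envelope φ W b + ⟪proxPt φ W b, b' - b⟫ + ω⁻¹ / 2 * ‖b' - b‖ ^ 2 := by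
  have h1 := h.le_envelope hW b (h.isSubgrad_proxPt hW b').1
  set p := proxPt φ W b
  set p' := proxPt φ W b'
  have h2 := hW.le (p' - p)
  have h3 : ⟪b' - b, p' - p⟫ ≤ ‖b' - b‖ * ‖p' - p‖ := real_inner_le_norm _ _
  -- Young's inequality weighted by `ω`, so that the term in `‖p' - p‖²` is absorbed by the
  -- quadratic growth at `p`.
  have h4 : ‖b' - b‖ * ‖p' - p‖ ≤ ω⁻¹ / 2 * ‖b' - b‖ ^ 2 + ω / 2 * ‖p' - p‖ ^ 2 := by
    have := hW.pos
    have e : ω⁻¹ / 2 * ‖b' - b‖ ^ 2 + ω / 2 * ‖p' - p‖ ^ 2 - ‖b' - b‖ * ‖p' - p‖ =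
        ω⁻¹ / 2 * (‖b' - b‖ - ω * ‖p' - p‖) ^ 2 := by field_simp; ring
    have : 0 ≤ ω⁻¹ / 2 * (‖b' - b‖ - ω * ‖p' - p‖) ^ 2 := by positivity
    linarith
  have e : envelope φ W b' = ⟪b', p'⟫ - (φ p').toReal - 1 / 2 * ⟪p', W p'⟫ := rfl
  rw [e]
  simp only [inner_sub_left, inner_sub_right] at h3 ⊢
  rw [real_inner_comm b', real_inner_comm b]
  linarith

theorem IsProperClosedConvex.continuous_envelope (h : IsProperClosedConvex φ)
    (hW : IsCoercive W ω) : Continuous (envelope φ W) :=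
  continuous_iff_continuousAt.2 fun b =>
    (hasGradientAt_of_quadratic (h.envelope_ge hW b) (h.envelope_le hW b)).continuousAt

end Envelope

variable {n m k : ℕ} (P : Problem n m) (M : Preconditioner n m) (σ : ℝ)

/-- The weight `W / σ`. -/
abbrev wt (W : Vec k →L[ℝ] Vec k) (σ : ℝ) : Vec k →L[ℝ] Vec k := (1 / σ) • W

theorem quad_eq (W : Vec k →L[ℝ] Vec k) (σ : ℝ) (v : Vec k) :
    quad W σ v = 1 / 2 * ⟪v, wt W σ v⟫ := by
  rw [quad, smul_apply, real_inner_smul_right, ← mul_assoc]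
  congr 1
  ring

variable {σ} in
theorem coercive_Ml (hm : 0 < m) (hσ : 0 < σ) : IsCoercive (wt M.Ml σ) (M.lamMinL / σ) where
  pos := div_pos (M.lamMinL_pos hm) hσ
  symm x y := by
    simp only [smul_apply, real_inner_smul_left, real_inner_smul_right,
      M.posDef_Ml.1]
  le v := by
    rw [smul_apply, real_inner_smul_right, div_mul_eq_mul_div,
      one_div_mul_eq_div]
    gcongr
    exact M.lamMinL_mul_le v

variable {σ} in
theorem coercive_Mx (hn : 0 < n) (hσ : 0 < σ) : IsCoercive (wt M.Mx σ) (M.lamMinX / σ) where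
  pos := div_pos (M.lamMinX_pos hn) hσ
  symm x y := by
    simp only [smul_apply, real_inner_smul_left, real_inner_smul_right,
      M.posDef_Mx.1]
  le v := by
    rw [smul_apply, real_inner_smul_right, div_mul_eq_mul_div,
      one_div_mul_eq_div]
    gcongr
    exact M.lamMinX_mul_le v

theorem quad_sub {W : Vec k →L[ℝ] Vec k} {ω : ℝ} (hW : IsCoercive (wt W σ) ω) (l lb : Vec k) :
    quad W σ (l - lb) = 1 / 2 * ⟪l, wt W σ l⟫ - ⟪wt W σ lb, l⟫ + quad W σ lb := by
  rw [quad_eq, quad_eq, hW.expand lb l, inner_sub_right, hW.symm lb lb]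
  ring

/-- The dual maximizer as a function of `u = A x`. -/
def dualPt (lb u : Vec m) : Vec m := proxPt (conjugate P.h) (wt M.Ml σ) (u + wt M.Ml σ lb)

/-- The real value of `psi`. -/
def psiR (lb u : Vec m) : ℝ :=
  envelope (conjugate P.h) (wt M.Ml σ) (u + wt M.Ml σ lb) - quad M.Ml σ lb

variable {σ}

theorem isSubgrad_dualPt (hm : 0 < m) (hσ : 0 < σ) (lb u : Vec m) :
    IsSubgrad (conjugate P.h) (dualPt P M σ lb u) (u - wt M.Ml σ (dualPt P M σ lb u - lb)) := by
  have := P.h_pcc.conjugate.isSubgrad_proxPt (coercive_Ml M hm hσ) (u + wt M.Ml σ lb)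
  rw [map_sub, sub_sub_eq_add_sub]
  exact this

theorem Lam_eq (hm : 0 < m) (hσ : 0 < σ) (lb : Vec m) (x : Vec n) : Lam P M σ lb x = dualPt P M σ lb (P.A x) := by
  refine P.h_pcc.conjugate.argminPt_eq (coercive_Ml M hm hσ) (b := P.A x + wt M.Ml σ lb)
    (P.h_pcc.conjugate.isSubgrad_proxPt (coercive_Ml M hm hσ) _) (cst := quad M.Ml σ lb) fun y => ?_
  congr 2
  rw [quad_sub σ (coercive_Ml M hm hσ), inner_add_left]
  ring

theorem psi_eq (hm : 0 < m) (hσ : 0 < σ) (lb u : Vec m) : psi P M σ lb u = (psiR P M σ lb u : EReal) := by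
  have hc := P.h_pcc.conjugate
  have hW := coercive_Ml M hm hσ
  have key : ∀ l, conjugate P.h l ≠ ⊤ →
      ((⟪u, l⟫ : ℝ) : EReal) - conjugate P.h l - (quad M.Ml σ (l - lb) : EReal) =
      ((⟪u + wt M.Ml σ lb, l⟫ - (conjugate P.h l).toReal - 1 / 2 * ⟪l, wt M.Ml σ l⟫
        - quad M.Ml σ lb : ℝ) : EReal) := by
    intro l hl
    rw [← hc.coe_toReal hl, ← EReal.coe_sub, ← EReal.coe_sub, EReal.toReal_coe,
      quad_sub σ hW, inner_add_left]
    congr 1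
    ring
  have hp := hc.isSubgrad_proxPt hW (u + wt M.Ml σ lb)
  refine le_antisymm (iSup_le fun l => ?_) ?_
  · by_cases hl : conjugate P.h l = ⊤
    · rw [hl, EReal.sub_top]
      simp
    · rw [key l hl, EReal.coe_le_coe_iff, psiR]
      have h1 := hc.le_envelope hW (u + wt M.Ml σ lb) hl
      have h2 := (mul_nonneg hW.pos.le (sq_nonneg _)).trans
        (hW.le (l - proxPt (conjugate P.h) (wt M.Ml σ) (u + wt M.Ml σ lb)))
      linarith
  · refine le_trans (le_of_eq ?_) (le_iSup _ (proxPt (conjugate P.h) (wt M.Ml σ) (u + wt M.Ml σ lb)))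
    rw [key _ hp.1]
    rfl

theorem psiR_ge (hm : 0 < m) (hσ : 0 < σ) (lb u u' : Vec m) :
    psiR P M σ lb u + ⟪dualPt P M σ lb u, u' - u⟫ ≤ psiR P M σ lb u' := by
  have := P.h_pcc.conjugate.envelope_ge (coercive_Ml M hm hσ) (u + wt M.Ml σ lb) (u' + wt M.Ml σ lb)
  rw [add_sub_add_right_eq_sub] at this
  rw [psiR, psiR, dualPt]
  linarith

theorem psiR_le (hm : 0 < m) (hσ : 0 < σ) (lb u u' : Vec m) : psiR P M σ lb u' ≤
    psiR P M σ lb u + ⟪dualPt P M σ lb u, u' - u⟫ + σ / M.lamMinL / 2 * ‖u' - u‖ ^ 2 := by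
  have := P.h_pcc.conjugate.envelope_le (coercive_Ml M hm hσ) (u + wt M.Ml σ lb) (u' + wt M.Ml σ lb)
  rw [add_sub_add_right_eq_sub, inv_div] at this
  rw [psiR, psiR, dualPt]
  linarith

theorem dualPt_lipschitz (hm : 0 < m) (hσ : 0 < σ) (lb u u' : Vec m) :
    ‖dualPt P M σ lb u - dualPt P M σ lb u'‖ ≤ σ / M.lamMinL * ‖u - u'‖ := by
  have hW := coercive_Ml M hm hσ
  have := hW.prox_norm_le (P.h_pcc.conjugate.isSubgrad_proxPt hW (u + wt M.Ml σ lb))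
    (P.h_pcc.conjugate.isSubgrad_proxPt hW (u' + wt M.Ml σ lb))
  rwa [add_sub_add_right_eq_sub, inv_div] at this

theorem continuous_dualPt (hm : 0 < m) (hσ : 0 < σ) : Continuous fun w : Vec m × Vec m => dualPt P M σ w.1 w.2 :=
  (P.h_pcc.conjugate.continuous_proxPt (coercive_Ml M hm hσ)).comp (by fun_prop)

theorem continuous_psiR (hm : 0 < m) (hσ : 0 < σ) : Continuous fun w : Vec m × Vec m => psiR P M σ w.1 w.2 := by
  unfold psiR quad
  exact ((P.h_pcc.conjugate.continuous_envelope (coercive_Ml M hm hσ)).comp (by fun_prop)).sub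
    (by fun_prop)

theorem smoothPart_eq (hm : 0 < m) (hσ : 0 < σ) (lb : Vec m) (x : Vec n) :
    smoothPart P M σ lb x = P.f₀ x + psiR P M σ lb (P.A x) := by
  rw [smoothPart, psi_eq P M hm hσ, EReal.toReal_coe]

/-- The gradient of the smooth part. -/
def gradS (P : Problem n m) (M : Preconditioner n m) (σ : ℝ) (lb : Vec m) (x : Vec n) : Vec n :=
  gradient P.f₀ x + ContinuousLinearMap.adjoint P.A (dualPt P M σ lb (P.A x))

theorem inner_gradS (lb : Vec m) (x d : Vec n) :
    ⟪gradS P M σ lb x, d⟫ = ⟪gradient P.f₀ x, d⟫ + ⟪dualPt P M σ lb (P.A x), P.A d⟫ := by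
  rw [gradS, inner_add_left, ContinuousLinearMap.adjoint_inner_left]

theorem smoothPart_ge (hm : 0 < m) (hσ : 0 < σ) (lb : Vec m) (x y : Vec n) :
    smoothPart P M σ lb x + ⟪gradS P M σ lb x, y - x⟫ ≤ smoothPart P M σ lb y := by
  rw [smoothPart_eq P M hm hσ, smoothPart_eq P M hm hσ, inner_gradS, map_sub]
  have := psiR_ge P M hm hσ lb (P.A x) (P.A y)
  have := P.gradient_le x y
  linarith

theorem smoothPart_le (hm : 0 < m) (hσ : 0 < σ) (lb : Vec m) (x y : Vec n) :
    smoothPart P M σ lb y ≤ smoothPart P M σ lb x + ⟪gradS P M σ lb x, y - x⟫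
      + lipL P M σ / 2 * ‖y - x‖ ^ 2 := by
  rw [smoothPart_eq P M hm hσ, smoothPart_eq P M hm hσ, inner_gradS, map_sub, lipL]
  have h1 := psiR_le P M hm hσ lb (P.A x) (P.A y)
  have h2 := P.le_quadratic x y
  have h3 : ‖P.A y - P.A x‖ ^ 2 ≤ (‖P.A‖ * ‖y - x‖) ^ 2 := by
    rw [← map_sub]; gcongr; exact P.A.le_opNorm _
  have h4 : σ / M.lamMinL / 2 * ‖P.A y - P.A x‖ ^ 2 ≤
      σ / M.lamMinL / 2 * (‖P.A‖ * ‖y - x‖) ^ 2 := by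
    have := M.lamMinL_pos hm
    gcongr
  linarith

theorem gradient_smoothPart (hm : 0 < m) (hσ : 0 < σ) (lb : Vec m) (x : Vec n) :
    gradient (smoothPart P M σ lb) x = gradS P M σ lb x :=
  (hasGradientAt_of_quadratic (smoothPart_ge P M hm hσ lb x)
    (smoothPart_le P M hm hσ lb x)).gradient

theorem gradS_lipschitz (hm : 0 < m) (hσ : 0 < σ) (lb : Vec m) (x y : Vec n) :
    ‖gradS P M σ lb x - gradS P M σ lb y‖ ≤ lipL P M σ * ‖x - y‖ := by
  have e : gradS P M σ lb x - gradS P M σ lb y = (gradient P.f₀ x - gradient P.f₀ y) +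
      ContinuousLinearMap.adjoint P.A (dualPt P M σ lb (P.A x) - dualPt P M σ lb (P.A y)) := by
    rw [gradS, gradS, map_sub]; abel
  rw [e]
  refine (norm_add_le _ _).trans ?_
  have h1 := P.lipschitz_f₀ x y
  have h2 := (ContinuousLinearMap.adjoint P.A).le_opNorm
    (dualPt P M σ lb (P.A x) - dualPt P M σ lb (P.A y))
  rw [LinearIsometryEquiv.norm_map] at h2
  have h3 := dualPt_lipschitz P M hm hσ lb (P.A x) (P.A y)
  have h4 := P.A.le_opNorm (x - y)
  rw [map_sub] at h4
  have h5 : 0 ≤ σ / M.lamMinL := (div_pos hσ (M.lamMinL_pos hm)).le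
  have h6 := mul_le_mul_of_nonneg_left (h3.trans (mul_le_mul_of_nonneg_left h4 h5)) (norm_nonneg P.A)
  rw [lipL]
  linarith

theorem continuous_gradS (hm : 0 < m) (hσ : 0 < σ) : Continuous fun w : Vec m × Vec n => gradS P M σ w.1 w.2 := by
  have h1 := P.continuous_gradient
  have h3 : Continuous fun w : Vec m × Vec n => (w.1, P.A w.2) :=
    continuous_fst.prodMk (P.A.continuous.comp continuous_snd)
  have h2 := (continuous_dualPt P M hm hσ).comp h3
  exact (h1.comp continuous_snd).add ((ContinuousLinearMap.adjoint P.A).continuous.comp h2)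

theorem continuous_smoothPart (hm : 0 < m) (hσ : 0 < σ) :
    Continuous fun w : Vec m × Vec n => smoothPart P M σ w.1 w.2 := by
  simp only [smoothPart_eq P M hm hσ]
  have h1 := P.continuous_f₀
  have h3 : Continuous fun w : Vec m × Vec n => (w.1, P.A w.2) :=
    continuous_fst.prodMk (P.A.continuous.comp continuous_snd)
  have h2 := (continuous_psiR P M hm hσ).comp h3
  exact (h1.comp continuous_snd).add h2

end AGPPA

end

/-! ### The inner problem: exact minimizer, resolvent inclusion, proximal gradient step. -/

noncomputable section

namespace AGPPA

variable {n m : ℕ} (P : Problem n m) (M : Preconditioner n m) {σ : ℝ}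

/-- The finite part of the inner objective. -/
def smoothF (P : Problem n m) (M : Preconditioner n m) (σ : ℝ) (z : PD n m) (x : Vec n) : ℝ :=
  smoothPart P M σ z.snd x + quad M.Mx σ (x - z.fst)

/-- The gradient of the finite part of the inner objective. -/
def gradF (P : Problem n m) (M : Preconditioner n m) (σ : ℝ) (z : PD n m) (x : Vec n) : Vec n :=
  gradS P M σ z.snd x + wt M.Mx σ (x - z.fst)

/-- The real value of the inner objective on `dom g`. -/
def valF (P : Problem n m) (M : Preconditioner n m) (σ : ℝ) (z : PD n m) (x : Vec n) : ℝ :=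
  (P.g x).toReal + smoothF P M σ z x

theorem objF_eq (hm : 0 < m) (hσ : 0 < σ) (z : PD n m) (x : Vec n) :
    objF P M σ z x = P.g x + (smoothF P M σ z x : EReal) := by
  rw [objF, psi_eq P M hm hσ, smoothF, smoothPart_eq P M hm hσ, EReal.coe_add, EReal.coe_add]
  abel

theorem objF_eq_valF (hm : 0 < m) (hσ : 0 < σ) (z : PD n m) {x : Vec n} (hx : P.g x ≠ ⊤) :
    objF P M σ z x = (valF P M σ z x : EReal) := by
  rw [objF_eq P M hm hσ, valF, EReal.coe_add, P.g_pcc.coe_toReal hx]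

theorem objF_eq_top (hm : 0 < m) (hσ : 0 < σ) (z : PD n m) {x : Vec n} (hx : P.g x = ⊤) :
    objF P M σ z x = ⊤ := by
  rw [objF_eq P M hm hσ, hx, EReal.top_add_coe]

theorem quad_expand {k : ℕ} {W : Vec k →L[ℝ] Vec k} {ω : ℝ} (hW : IsCoercive (wt W σ) ω)
    (c x y : Vec k) : quad W σ (y - c) =
      quad W σ (x - c) + ⟪wt W σ (x - c), y - x⟫ + 1 / 2 * ⟪y - x, wt W σ (y - x)⟫ := by
  rw [quad_eq, quad_eq, hW.expand (x - c) (y - c), sub_sub_sub_cancel_right]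
  ring

theorem smoothF_ge (hn : 0 < n) (hm : 0 < m) (hσ : 0 < σ) (z : PD n m) (x y : Vec n) :
    smoothF P M σ z x + ⟪gradF P M σ z x, y - x⟫ + M.lamMinX / σ / 2 * ‖y - x‖ ^ 2 ≤
      smoothF P M σ z y := by
  have h1 := smoothPart_ge P M hm hσ z.snd x y
  have h2 := quad_expand (coercive_Mx M hn hσ) z.fst x y
  have h3 := (coercive_Mx M hn hσ).le (y - x)
  rw [smoothF, smoothF, gradF, inner_add_left, h2]
  linarith

theorem smoothF_le (hn : 0 < n) (hm : 0 < m) (hσ : 0 < σ) (z : PD n m) (x y : Vec n) :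
    smoothF P M σ z y ≤ smoothF P M σ z x + ⟪gradF P M σ z x, y - x⟫
      + (lipL P M σ / 2 + ‖wt M.Mx σ‖ / 2) * ‖y - x‖ ^ 2 := by
  have h1 := smoothPart_le P M hm hσ z.snd x y
  have h2 := quad_expand (coercive_Mx M hn hσ) z.fst x y
  have h3 := real_inner_le_norm (y - x) (wt M.Mx σ (y - x))
  have h4 := mul_le_mul_of_nonneg_left ((wt M.Mx σ).le_opNorm (y - x)) (norm_nonneg (y - x))
  rw [smoothF, smoothF, gradF, inner_add_left, h2]
  linarith

theorem continuous_smoothF (hm : 0 < m) (hσ : 0 < σ) :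
    Continuous fun w : PD n m × Vec n => smoothF P M σ w.1 w.2 := by
  have h1 : Continuous fun w : PD n m × Vec n => (w.1.snd, w.2) :=
    (continuous_snd_PD.comp continuous_fst).prodMk continuous_snd
  have h2 : Continuous fun w : PD n m × Vec n => w.2 - w.1.fst :=
    continuous_snd.sub (continuous_fst_PD.comp continuous_fst)
  have h3 : Continuous (quad M.Mx σ) := by unfold quad; fun_prop
  exact ((continuous_smoothPart P M hm hσ).comp h1).add (h3.comp h2)

theorem continuous_smoothF_right (hm : 0 < m) (hσ : 0 < σ) (z : PD n m) :
    Continuous (smoothF P M σ z) :=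
  (continuous_smoothF P M hm hσ).comp (continuous_const.prodMk continuous_id)

/-- Sum rule `∂F = ∂g + ∇(F - g)`. From left to right, `x` minimizes `F - ⟨v, ·⟩`, and the quadratic
upper model of the smooth part gives the first-order condition. -/
theorem mem_subdiff_objF_iff (hn : 0 < n) (hm : 0 < m) (hσ : 0 < σ) (z : PD n m) (x v : Vec n) :
    v ∈ subdiff (objF P M σ z) x ↔ IsSubgrad P.g x (v - gradF P M σ z x) := by
  constructor
  · rintro ⟨h1, -, h3⟩
    have hx : P.g x ≠ ⊤ := fun hx => h1 (objF_eq_top P M hm hσ z hx)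
    have := P.g_pcc.isSubgrad_of_isMin (p := x) (Q := fun y => smoothF P M σ z y - ⟪v, y⟫)
      (q := gradF P M σ z x - v) (K := lipL P M σ / 2 + ‖wt M.Mx σ‖ / 2) hx ?_ ?_
    · rwa [neg_sub] at this
    · intro y hy
      have h4 := h3 y
      rw [objF_eq_valF P M hm hσ z hx, objF_eq_valF P M hm hσ z hy, ← EReal.coe_add,
        EReal.coe_le_coe_iff, valF, valF, inner_sub_right] at h4
      linarith
    · intro y
      have h4 := smoothF_le P M hn hm hσ z x y
      rw [inner_sub_left, inner_sub_right v]
      linarith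
  · rintro ⟨hx, h⟩
    refine ⟨?_, ?_, fun y => ?_⟩
    · rw [objF_eq_valF P M hm hσ z hx]; exact EReal.coe_ne_top _
    · rw [objF_eq_valF P M hm hσ z hx]; exact EReal.coe_ne_bot _
    · by_cases hy : P.g y = ⊤
      · rw [objF_eq_top P M hm hσ z hy]; exact le_top
      · rw [objF_eq_valF P M hm hσ z hx, objF_eq_valF P M hm hσ z hy, ← EReal.coe_add,
          EReal.coe_le_coe_iff, valF, valF]
        have h1 := h y hy
        have h2 := smoothF_ge P M hn hm hσ z x y
        rw [inner_sub_left] at h1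
        have := M.lamMinX_pos hn
        have : 0 ≤ M.lamMinX / σ / 2 * ‖y - x‖ ^ 2 := by positivity
        linarith

/-- The exact minimizer of the inner objective. -/
def xStar (P : Problem n m) (M : Preconditioner n m) (σ : ℝ) (z : PD n m) : Vec n :=
  Classical.epsilon fun x => IsSubgrad P.g x (-gradF P M σ z x)

theorem isSubgrad_xStar (hn : 0 < n) (hm : 0 < m) (hσ : 0 < σ) (z : PD n m) :
    IsSubgrad P.g (xStar P M σ z) (-gradF P M σ z (xStar P M σ z)) := by
  refine Classical.epsilon_spec (p := fun x => IsSubgrad P.g x (-gradF P M σ z x)) ?_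
  obtain ⟨p, hp, hmin⟩ := P.g_pcc.exists_isMin_add (continuous_smoothF_right P M hm hσ z)
    (fun x₀ => ⟨gradF P M σ z x₀, M.lamMinX / σ / 2, by
      have := M.lamMinX_pos hn; positivity, fun y => smoothF_ge P M hn hm hσ z x₀ y⟩)
  exact ⟨p, P.g_pcc.isSubgrad_of_isMin hp hmin (smoothF_le P M hn hm hσ z p)⟩

theorem valF_xStar_le (hn : 0 < n) (hm : 0 < m) (hσ : 0 < σ) (z : PD n m) {y : Vec n}
    (hy : P.g y ≠ ⊤) : valF P M σ z (xStar P M σ z) ≤ valF P M σ z y := by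
  have h1 := (isSubgrad_xStar P M hn hm hσ z).2 y hy
  have h2 := smoothF_ge P M hn hm hσ z (xStar P M σ z) y
  have := M.lamMinX_pos hn
  have : 0 ≤ M.lamMinX / σ / 2 * ‖y - xStar P M σ z‖ ^ 2 := by positivity
  rw [inner_neg_left] at h1
  rw [valF, valF]
  linarith

theorem iInf_objF (hn : 0 < n) (hm : 0 < m) (hσ : 0 < σ) (z : PD n m) :
    ⨅ y, objF P M σ z y = (valF P M σ z (xStar P M σ z) : EReal) := by
  have hx := (isSubgrad_xStar P M hn hm hσ z).1
  refine le_antisymm ((iInf_le _ (xStar P M σ z)).trans_eq (objF_eq_valF P M hm hσ z hx))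
    (le_iInf fun y => ?_)
  by_cases hy : P.g y = ⊤
  · rw [objF_eq_top P M hm hσ z hy]; exact le_top
  · rw [objF_eq_valF P M hm hσ z hy, EReal.coe_le_coe_iff]
    exact valF_xStar_le P M hn hm hσ z hy

theorem gap_eq (hn : 0 < n) (hm : 0 < m) (hσ : 0 < σ) (z : PD n m) {x : Vec n} (hx : P.g x ≠ ⊤) :
    gap P M σ z x = ENNReal.ofReal (valF P M σ z x - valF P M σ z (xStar P M σ z)) := by
  rw [gap, iInf_objF P M hn hm hσ, objF_eq_valF P M hm hσ z hx, ← EReal.coe_sub,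
    EReal.toENNReal_of_ne_top (EReal.coe_ne_top _), EReal.toReal_coe]

@[simp] theorem pair_fst (x : Vec n) (l : Vec m) : (pair x l).fst = x := rfl
@[simp] theorem pair_snd (x : Vec n) (l : Vec m) : (pair x l).snd = l := rfl

/-- The resolvent inclusion satisfied by `(x, Λ(x))` if `v ∈ ∂F(x)`. -/
theorem isOpT_liftPt (hm : 0 < m) (hσ : 0 < σ) {z : PD n m} {x v : Vec n}
    (h : IsSubgrad P.g x (v - gradF P M σ z x)) :
    IsOpT P (liftPt P M σ z x) (pair v 0 + (1 / σ) • M.op (z - liftPt P M σ z x)) := by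
  have hd := isSubgrad_dualPt P M hm hσ z.snd (P.A x)
  rw [liftPt, Lam_eq P M hm hσ]
  refine ⟨h.1, hd.1, fun y hy => ?_, fun l hl => ?_⟩
  · have h1 := h.2 y hy
    have h2 := P.gradient_le x y
    simp only [pair_fst, pair_snd, WithLp.add_fst, WithLp.smul_fst, Preconditioner.op_fst, WithLp.sub_fst] at *
    have e : (1 / σ) • M.Mx (z.fst - x) = - wt M.Mx σ (x - z.fst) := by
      rw [← neg_sub x, map_neg, smul_neg]; rfl
    rw [e, inner_add_left, inner_neg_left]
    rw [gradF, inner_sub_left, inner_add_left, inner_gradS, map_sub, inner_sub_right (dualPt _ _ _ _ _),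
      real_inner_comm (P.A y), real_inner_comm (P.A x)] at h1
    linarith
  · have h1 := hd.2 l hl
    simp only [pair_fst, pair_snd, WithLp.add_snd, WithLp.smul_snd, Preconditioner.op_snd, WithLp.sub_snd,
      zero_add] at *
    have e : (1 / σ) • M.Ml (z.snd - dualPt P M σ z.snd (P.A x)) =
        - wt M.Ml σ (dualPt P M σ z.snd (P.A x) - z.snd) := by
      rw [← neg_sub (dualPt P M σ z.snd (P.A x)), map_neg, smul_neg]; rfl
    rw [e, inner_neg_left]
    rw [inner_sub_left, inner_sub_right (P.A x)] at h1
    linarith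

/-- The exact proximal point `(x*, Λ(x*))`. -/
def wStar (P : Problem n m) (M : Preconditioner n m) (σ : ℝ) (z : PD n m) : PD n m :=
  liftPt P M σ z (xStar P M σ z)

theorem isOpT_wStar (hn : 0 < n) (hm : 0 < m) (hσ : 0 < σ) (z : PD n m) :
    IsOpT P (wStar P M σ z) ((1 / σ) • M.op (z - wStar P M σ z)) := by
  have h := isSubgrad_xStar P M hn hm hσ z
  rw [← zero_sub] at h
  have := isOpT_liftPt P M hm hσ h
  have e : pair (0 : Vec n) (0 : Vec m) = 0 := rfl
  rwa [e, zero_add] at this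

/-- The error of an inexact proximal point is controlled by the residual subgradient. -/
theorem normM_liftPt_sub_wStar_le (hn : 0 < n) (hm : 0 < m) (hσ : 0 < σ) {z : PD n m} {x v : Vec n}
    (h : v ∈ subdiff (objF P M σ z) x) :
    normM M (liftPt P M σ z x - wStar P M σ z) ≤ σ / √M.lamMinX * ‖v‖ := by
  rw [mem_subdiff_objF_iff P M hn hm hσ] at h
  -- Both points satisfy a resolvent inclusion with the same base point. The perturbation `pair v 0`
  -- lives in the primal block only, so only the primal component of the error meets it; hence
  -- `λ_min(Mx)` in the bound.
  have h1 := (isOpT_liftPt P M hm hσ h).monotone (isOpT_wStar P M hn hm hσ z)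
  set w := liftPt P M σ z x
  set w' := wStar P M σ z
  have e : pair v 0 + (1 / σ) • M.op (z - w) - (1 / σ) • M.op (z - w') =
      pair v 0 - (1 / σ) • M.op (w - w') := by
    rw [map_sub, map_sub, map_sub]; module
  rw [e, inner_sub_left, real_inner_smul_left, M.op_symm, ← normM_sq, inner_PD] at h1
  simp only [pair_fst, pair_snd, inner_zero_left, add_zero] at h1
  have h2 := real_inner_le_norm v (w - w').fst
  have h3 := sqrt_lamMinX_mul_norm_le M (M.lamMinX_pos hn).le (w - w')
  have hs : 0 < √M.lamMinX := Real.sqrt_pos.2 (M.lamMinX_pos hn)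
  set N := normM M (w - w')
  have hN : 0 ≤ N := normM_nonneg M _
  have h4 : N ^ 2 ≤ σ * (‖v‖ * ‖(w - w').fst‖) := by
    have : 1 / σ * N ^ 2 ≤ ‖v‖ * ‖(w - w').fst‖ := by linarith
    rwa [one_div_mul_eq_div, div_le_iff₀ hσ, mul_comm] at this
  rw [div_mul_eq_mul_div, le_div_iff₀ hs]
  rcases hN.eq_or_lt with h0 | h0
  · rw [← h0, zero_mul]; positivity
  · have h5 : N ^ 2 * √M.lamMinX ≤ σ * ‖v‖ * N := by
      have := mul_le_mul_of_nonneg_left h3 (mul_nonneg hσ.le (norm_nonneg v))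
      have := mul_le_mul_of_nonneg_right h4 hs.le
      linarith
    have h6 : N * (N * √M.lamMinX) ≤ N * (σ * ‖v‖) := by linarith
    exact le_of_mul_le_mul_left h6 h0

theorem normM_liftPt_sub_wStar_le_infEDist (hn : 0 < n) (hm : 0 < m) (hσ : 0 < σ) {z : PD n m}
    {x : Vec n} {c : ℝ} (hc : 0 ≤ c)
    (h : Metric.infEDist 0 (subdiff (objF P M σ z) x) ≤ ENNReal.ofReal (√M.lamMinX / σ * c)) :
    normM M (liftPt P M σ z x - wStar P M σ z) ≤ c := by
  have hs : 0 < √M.lamMinX := Real.sqrt_pos.2 (M.lamMinX_pos hn)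
  refine le_of_forall_gt_imp_ge_of_dense fun d hd => ?_
  have h1 : Metric.infEDist 0 (subdiff (objF P M σ z) x) < ENNReal.ofReal (√M.lamMinX / σ * d) := by
    refine h.trans_lt ((ENNReal.ofReal_lt_ofReal_iff ?_).2 ?_)
    · have := hc.trans_lt hd; positivity
    · gcongr
  obtain ⟨v, hv, h2⟩ := Metric.infEDist_lt_iff.1 h1
  rw [edist_dist, dist_zero_left, ENNReal.ofReal_lt_ofReal_iff_of_nonneg (norm_nonneg _)] at h2
  refine (normM_liftPt_sub_wStar_le P M hn hm hσ hv).trans ?_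
  calc σ / √M.lamMinX * ‖v‖ ≤ σ / √M.lamMinX * (√M.lamMinX / σ * d) := by gcongr
    _ = d := by field_simp

/-- Resolvents of monotone operators are nonexpansive in their metric. The purpose is continuity in
the base point, hence measurability of the optimal value. -/
theorem wStar_nonexpansive (hn : 0 < n) (hm : 0 < m) (hσ : 0 < σ) (z z' : PD n m) :
    normM M (wStar P M σ z - wStar P M σ z') ≤ normM M (z - z') := by
  have h1 := (isOpT_wStar P M hn hm hσ z).monotone (isOpT_wStar P M hn hm hσ z')
  set w := wStar P M σ z
  set w' := wStar P M σ z'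
  have e : (1 / σ) • M.op (z - w) - (1 / σ) • M.op (z' - w') =
      (1 / σ) • (M.op (z - z') - M.op (w - w')) := by
    simp only [map_sub]; module
  rw [e, real_inner_smul_left] at h1
  have h3 : 0 ≤ ⟪M.op (z - z') - M.op (w - w'), w - w'⟫ :=
    nonneg_of_mul_nonneg_right h1 (one_div_pos.2 hσ)
  rw [inner_sub_left, M.op_symm, M.op_symm, ← normM_sq] at h3
  have h4 := inner_op_le_normM M (z - z') (w - w')
  have h5 := normM_nonneg M (w - w')
  rcases h5.eq_or_lt with h0 | h0
  · rw [← h0]; exact normM_nonneg _ _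
  · exact le_of_mul_le_mul_right (by linarith) h0

theorem continuous_wStar (hn : 0 < n) (hm : 0 < m) (hσ : 0 < σ) (hM : 0 < M.lamMin) :
    Continuous (wStar P M σ) := by
  have hs : 0 < √M.lamMin := Real.sqrt_pos.2 hM
  refine (LipschitzWith.of_dist_le_mul (K := (1 / √M.lamMin).toNNReal) fun z z' => ?_).continuous
  rw [dist_eq_norm, dist_eq_norm, Real.coe_toNNReal _ (by positivity), one_div_mul_eq_div,
    le_div_iff₀ hs, mul_comm]
  exact (sqrt_lamMin_mul_norm_le M hM.le _).trans
    ((wStar_nonexpansive P M hn hm hσ z z').trans (normM_le_norm M _))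

theorem continuous_xStar (hn : 0 < n) (hm : 0 < m) (hσ : 0 < σ) (hM : 0 < M.lamMin) :
    Continuous (xStar P M σ) :=
  continuous_fst_PD.comp (continuous_wStar P M hn hm hσ hM)

section ProxGrad

theorem smul_id_add_apply {k : ℕ} (L : ℝ) (W : Vec k →L[ℝ] Vec k) (v : Vec k) :
    (L • ContinuousLinearMap.id ℝ (Vec k) + W) v = L • v + W v := rfl

theorem coercive_proxGrad (hn : 0 < n) (hσ : 0 < σ) (hL : 0 < lipL P M σ) :
    IsCoercive (lipL P M σ • ContinuousLinearMap.id ℝ (Vec n) + wt M.Mx σ) (lipL P M σ) where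
  pos := hL
  symm x y := by
    rw [smul_id_add_apply, smul_id_add_apply, inner_add_left, inner_add_right,
      real_inner_smul_left, real_inner_smul_right, (coercive_Mx M hn hσ).symm]
  le v := by
    have h1 := (coercive_Mx M hn hσ).le v
    have h2 := mul_nonneg (coercive_Mx M hn hσ).pos.le (sq_nonneg ‖v‖)
    rw [smul_id_add_apply, inner_add_right, real_inner_smul_right, real_inner_self_eq_norm_sq]
    linarith

/-- Expanding the squares turns the step into a proximal point of `g` with weight `L·id + Mx/σ`; the
remaining terms do not depend on `y`. -/
theorem proxGrad_eq (hn : 0 < n) (hm : 0 < m) (hσ : 0 < σ) (hL : 0 < lipL P M σ) (z : PD n m)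
    (x : Vec n) : proxGrad P M σ z x =
      proxPt P.g (lipL P M σ • ContinuousLinearMap.id ℝ (Vec n) + wt M.Mx σ)
        (lipL P M σ • x - gradS P M σ z.snd x + wt M.Mx σ z.fst) := by
  have hW := coercive_proxGrad P M hn hσ hL
  refine P.g_pcc.argminPt_eq hW (P.g_pcc.isSubgrad_proxPt hW _)
    (cst := lipL P M σ / 2 *
      ‖x - (1 / lipL P M σ) • gradS P M σ z.snd x‖ ^ 2 + quad M.Mx σ z.fst) fun y => ?_
  rw [gradient_smoothPart P M hm hσ, add_left_comm, ← EReal.coe_add]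
  congr 2
  rw [quad_sub σ (coercive_Mx M hn hσ), norm_sub_sq_real]
  rw [smul_id_add_apply, inner_add_right, inner_add_left, inner_sub_left, inner_sub_right,
    real_inner_smul_left, real_inner_smul_right, real_inner_smul_right y,
    real_inner_self_eq_norm_sq, real_inner_comm y x, real_inner_comm y (gradS P M σ z.snd x)]
  field_simp
  ring

theorem isSubgrad_proxGrad (hn : 0 < n) (hm : 0 < m) (hσ : 0 < σ) (hL : 0 < lipL P M σ)
    (z : PD n m) (x : Vec n) :
    IsSubgrad P.g (proxGrad P M σ z x) (lipL P M σ • (x - proxGrad P M σ z x) - gradS P M σ z.snd x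
      - wt M.Mx σ (proxGrad P M σ z x - z.fst)) := by
  have := P.g_pcc.isSubgrad_proxPt (coercive_proxGrad P M hn hσ hL)
    (lipL P M σ • x - gradS P M σ z.snd x + wt M.Mx σ z.fst)
  rw [← proxGrad_eq P M hn hm hσ hL] at this
  convert this using 1
  rw [map_sub, smul_id_add_apply]
  module

theorem continuous_proxGrad (hn : 0 < n) (hm : 0 < m) (hσ : 0 < σ) (hL : 0 < lipL P M σ) :
    Continuous fun w : PD n m × Vec n => proxGrad P M σ w.1 w.2 := by
  simp only [proxGrad_eq P M hn hm hσ hL]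
  have h1 : Continuous fun w : PD n m × Vec n => (w.1.snd, w.2) :=
    (continuous_snd_PD.comp continuous_fst).prodMk continuous_snd
  have h2 := (continuous_gradS P M hm hσ).comp h1
  have h3 := (wt M.Mx σ).continuous.comp (continuous_fst_PD.comp (continuous_fst (X := PD n m) (Y := Vec n)))
  have h4 : Continuous fun w : PD n m × Vec n => lipL P M σ • w.2 := by fun_prop
  have h5 := (P.g_pcc.continuous_proxPt (coercive_proxGrad P M hn hσ hL)).comp ((h4.sub h2).add h3)
  exact h5

/-- The fundamental inequality of the proximal gradient step. -/
theorem valF_proxGrad_le (hn : 0 < n) (hm : 0 < m) (hσ : 0 < σ) (hL : 0 < lipL P M σ) (z : PD n m)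
    (x : Vec n) {y : Vec n} (hy : P.g y ≠ ⊤) :
    valF P M σ z (proxGrad P M σ z x) + lipL P M σ / 2 * ‖y - proxGrad P M σ z x‖ ^ 2 ≤
      valF P M σ z y + lipL P M σ / 2 * ‖y - x‖ ^ 2 := by
  have h1 := (isSubgrad_proxGrad P M hn hm hσ hL z x).2 y hy
  set x₁ := proxGrad P M σ z x
  have h2 := smoothPart_le P M hm hσ z.snd x x₁
  have h3 := smoothPart_ge P M hm hσ z.snd x y
  have h4 := quad_expand (coercive_Mx M hn hσ) z.fst x₁ y
  have h5 := mul_nonneg (coercive_Mx M hn hσ).pos.le (sq_nonneg ‖y - x₁‖)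
  have h6 := h5.trans ((coercive_Mx M hn hσ).le (y - x₁))
  have h7 : ‖y - x‖ ^ 2 = ‖y - x₁‖ ^ 2 - 2 * ⟪x - x₁, y - x₁⟫ + ‖x₁ - x‖ ^ 2 := by
    rw [← sub_sub_sub_cancel_right y x x₁, norm_sub_sq_real, real_inner_comm, norm_sub_rev x x₁]
  have h8 : ⟪gradS P M σ z.snd x, y - x⟫ =
      ⟪gradS P M σ z.snd x, y - x₁⟫ + ⟪gradS P M σ z.snd x, x₁ - x⟫ := by
    rw [← inner_add_right, sub_add_sub_cancel]
  rw [inner_sub_left, inner_sub_left, real_inner_smul_left] at h1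
  rw [valF, valF, smoothF, smoothF, h4, h7]
  linarith

/-- The optimality condition of the step involves `∇f(x)`; replacing it by `∇f(x₁)` at the new point
`x₁` costs one more `L ‖x - x₁‖`. -/
theorem exists_subgrad_proxGrad (hn : 0 < n) (hm : 0 < m) (hσ : 0 < σ) (hL : 0 < lipL P M σ)
    (z : PD n m) (x : Vec n) : ∃ v ∈ subdiff (objF P M σ z) (proxGrad P M σ z x),
      ‖v‖ ≤ 2 * lipL P M σ * ‖x - proxGrad P M σ z x‖ := by
  have h1 := isSubgrad_proxGrad P M hn hm hσ hL z x
  set x₁ := proxGrad P M σ z x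
  refine ⟨lipL P M σ • (x - x₁) - (gradS P M σ z.snd x - gradS P M σ z.snd x₁), ?_, ?_⟩
  · rw [mem_subdiff_objF_iff P M hn hm hσ]
    convert h1 using 1
    rw [gradF]
    abel
  · refine (norm_sub_le _ _).trans ?_
    have := gradS_lipschitz P M hm hσ z.snd x x₁
    rw [norm_smul, Real.norm_of_nonneg hL.le]
    linarith

theorem gap_proxGrad_le (hn : 0 < n) (hm : 0 < m) (hσ : 0 < σ) (hL : 0 < lipL P M σ)
    (z : PD n m) {x : Vec n} (hx : P.g x ≠ ⊤) :
    gap P M σ z (proxGrad P M σ z x) ≤ gap P M σ z x := by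
  rw [gap_eq P M hn hm hσ z hx, gap_eq P M hn hm hσ z (isSubgrad_proxGrad P M hn hm hσ hL z x).1]
  refine ENNReal.ofReal_le_ofReal ?_
  have := valF_proxGrad_le P M hn hm hσ hL z x hx
  rw [sub_self, norm_zero] at this
  have : 0 ≤ lipL P M σ / 2 * ‖x - proxGrad P M σ z x‖ ^ 2 := by positivity
  linarith

/-- The fundamental inequality tested at the exact minimizer. No `dom g` condition on the base point
is needed, which is why the inner algorithm starts after one proximal gradient step. -/
theorem gap_proxGrad_base_le (hn : 0 < n) (hm : 0 < m) (hσ : 0 < σ) (hL : 0 < lipL P M σ)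
    (z : PD n m) : gap P M σ z (proxGrad P M σ z z.fst) ≤
      ENNReal.ofReal (lipL P M σ / 2 * ‖xStar P M σ z - z.fst‖ ^ 2) := by
  rw [gap_eq P M hn hm hσ z (isSubgrad_proxGrad P M hn hm hσ hL z z.fst).1]
  refine ENNReal.ofReal_le_ofReal ?_
  have := valF_proxGrad_le P M hn hm hσ hL z z.fst (isSubgrad_xStar P M hn hm hσ z).1
  have : 0 ≤ lipL P M σ / 2 * ‖xStar P M σ z - proxGrad P M σ z z.fst‖ ^ 2 := by positivity
  linarith

/-- Combines `‖v‖ ≤ 2L ‖x - x₁‖` with `(L/2) ‖x - x₁‖² ≤` gap. A small optimality gap therefore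
forces the stopping criterion. -/
theorem exists_subgrad_sq_le (hn : 0 < n) (hm : 0 < m) (hσ : 0 < σ) (hL : 0 < lipL P M σ)
    (z : PD n m) {x : Vec n} (hx : P.g x ≠ ⊤) :
    ∃ v ∈ subdiff (objF P M σ z) (proxGrad P M σ z x),
      ‖v‖ ^ 2 ≤ 8 * lipL P M σ * (valF P M σ z x - valF P M σ z (xStar P M σ z)) := by
  obtain ⟨v, hv, h1⟩ := exists_subgrad_proxGrad P M hn hm hσ hL z x
  refine ⟨v, hv, ?_⟩
  have h2 := valF_proxGrad_le P M hn hm hσ hL z x hx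
  have h3 := valF_xStar_le P M hn hm hσ z (isSubgrad_proxGrad P M hn hm hσ hL z x).1
  rw [sub_self, norm_zero] at h2
  have h4 : ‖v‖ ^ 2 ≤ (2 * lipL P M σ * ‖x - proxGrad P M σ z x‖) ^ 2 := by gcongr
  have h5 : lipL P M σ / 2 * ‖x - proxGrad P M σ z x‖ ^ 2 ≤
      valF P M σ z x - valF P M σ z (xStar P M σ z) := by linarith
  have := mul_le_mul_of_nonneg_left h5 (by positivity : 0 ≤ 8 * lipL P M σ)
  linarith

end ProxGrad

end AGPPA

end

/-! ### One proximal step: contraction of the distance to the solution set. -/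

noncomputable section

namespace AGPPA

variable {n m : ℕ}

theorem Params.sig_pos (q : Params) (s : ℕ) : 0 < q.sig s :=
  mul_pos q.σ₀_pos (pow_pos (zero_lt_one.trans q.one_lt_ϱσ) _)

theorem Params.sig_mono (q : Params) : Monotone q.sig := fun _ _ h =>
  mul_le_mul_of_nonneg_left (pow_le_pow_right₀ q.one_lt_ϱσ.le h) q.σ₀_pos.le

theorem Params.σ₀_le_sig (q : Params) (s : ℕ) : q.σ₀ ≤ q.sig s := by
  simpa [Params.sig] using q.sig_mono s.zero_le

theorem Params.eta_pos (q : Params) (s t : ℕ) : 0 < q.eta s t :=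
  mul_pos (mul_pos q.η₀_pos (pow_pos q.ϱη_pos _)) (Real.rpow_pos_of_pos (by positivity) _)

theorem Params.rho_pos (q : Params) : 0 < q.rho := by
  have h1 := q.δ_pos
  have h2 := q.δ_lt_half
  have h3 : 0 < min q.γ 1 := lt_min q.γ_pos one_pos
  have h4 : 0 < 1 - q.δ := by linarith
  unfold Params.rho
  positivity

/-- `√(1 / (a² + 1))`, the contraction factor of the exact proximal point method. -/
def contr (a : ℝ) : ℝ := √(1 / (a ^ 2 + 1))

theorem contr_lt_one {a : ℝ} (ha : 0 < a) : contr a < 1 := by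
  rw [contr, Real.sqrt_lt' one_pos, one_pow, div_lt_one (by positivity)]
  have := pow_pos ha 2
  linarith

section ProxStep

variable {P : Problem n m} {M : Preconditioner n m} {σ : ℝ}

/-- Firm nonexpansiveness of the exact proximal step towards solutions. -/
theorem wStar_firm (hn : 0 < n) (hm : 0 < m) (hσ : 0 < σ) (z : PD n m) {p : PD n m}
    (hp : p ∈ solSet P) : 0 ≤ ⟪z - wStar P M σ z, M.op (wStar P M σ z - p)⟫ := by
  have h1 := (isOpT_wStar P M hn hm hσ z).monotone (mem_solSet_iff.1 hp)
  rw [sub_zero, real_inner_smul_left, M.op_symm] at h1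
  exact nonneg_of_mul_nonneg_right h1 (one_div_pos.2 hσ)

theorem wStar_pythagoras (hn : 0 < n) (hm : 0 < m) (hσ : 0 < σ) (z : PD n m) {p : PD n m}
    (hp : p ∈ solSet P) : normM M (z - wStar P M σ z) ^ 2 + normM M (wStar P M σ z - p) ^ 2 ≤
      normM M (z - p) ^ 2 := by
  have h1 := wStar_firm (M := M) hn hm hσ z hp
  rw [← sub_add_sub_cancel z (wStar P M σ z) p, normM_add_sq]
  linarith

/-- The over-relaxed exact proximal step. -/
theorem normM_relax_sq_le (hn : 0 < n) (hm : 0 < m) (hσ : 0 < σ) (z : PD n m) {p : PD n m}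
    (hp : p ∈ solSet P) {γ : ℝ} (hγ : 0 ≤ γ) :
    normM M (γ • wStar P M σ z + (1 - γ) • z - p) ^ 2 ≤
      normM M (z - p) ^ 2 - γ * (2 - γ) * normM M (z - wStar P M σ z) ^ 2 := by
  have h1 := wStar_firm (M := M) hn hm hσ z hp
  set w := wStar P M σ z
  have e : γ • w + (1 - γ) • z - p = (z - p) + (-γ) • (z - w) := by module
  have e2 : M.op (w - p) = M.op (z - p) - M.op (z - w) := by rw [← map_sub]; congr 1; abel
  rw [e2, inner_sub_right, ← normM_sq] at h1
  rw [e, normM_add_sq, map_smul, real_inner_smul_right, normM_smul, mul_pow, sq_abs,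
    M.inner_op_comm]
  nlinarith

theorem normM_relax_le (hn : 0 < n) (hm : 0 < m) (hσ : 0 < σ) (z : PD n m) {p : PD n m}
    (hp : p ∈ solSet P) {γ : ℝ} (hγ : 0 ≤ γ) (hγ2 : γ ≤ 2) :
    normM M (γ • wStar P M σ z + (1 - γ) • z - p) ≤ normM M (z - p) := by
  have h1 := normM_relax_sq_le (M := M) hn hm hσ z hp hγ
  have : 0 ≤ γ * (2 - γ) * normM M (z - wStar P M σ z) ^ 2 :=
    mul_nonneg (mul_nonneg hγ (by linarith)) (sq_nonneg _)
  exact le_of_sq_le_sq (by linarith) (normM_nonneg _ _)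

/-- Centred at `w` instead of `z`: for `γ ≥ 1` the cross term `2 (1 - γ) ⟪z - w, M (w - p)⟫` is
nonpositive by firm nonexpansiveness. -/
theorem normM_relax_sq_le' (hn : 0 < n) (hm : 0 < m) (hσ : 0 < σ) (z : PD n m) {p : PD n m}
    (hp : p ∈ solSet P) {γ : ℝ} (hγ : 1 ≤ γ) :
    normM M (γ • wStar P M σ z + (1 - γ) • z - p) ^ 2 ≤
      normM M (p - wStar P M σ z) ^ 2 + (γ - 1) ^ 2 * normM M (z - wStar P M σ z) ^ 2 := by
  have h1 := wStar_firm (M := M) hn hm hσ z hp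
  set w := wStar P M σ z
  have e : γ • w + (1 - γ) • z - p = (w - p) + (1 - γ) • (z - w) := by module
  rw [e, normM_add_sq, map_smul, real_inner_smul_right, normM_smul, mul_pow, sq_abs,
    M.inner_op_comm, normM_sub_comm M p w]
  nlinarith

theorem distM_wStar_sq_le (hn : 0 < n) (hm : 0 < m) (hσ : 0 < σ) (z : PD n m)
    (hne : (solSet P).Nonempty) :
    normM M (z - wStar P M σ z) ^ 2 + distM M (wStar P M σ z) (solSet P) ^ 2 ≤
      distM M z (solSet P) ^ 2 := by
  have h : √(normM M (z - wStar P M σ z) ^ 2 + distM M (wStar P M σ z) (solSet P) ^ 2) ≤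
      distM M z (solSet P) := by
    refine le_distM M hne fun p hp => Real.sqrt_le_iff.2 ⟨normM_nonneg _ _, ?_⟩
    have h1 := wStar_pythagoras (M := M) hn hm hσ z hp
    have h2 := pow_le_pow_left₀ (distM_nonneg M _) (distM_le M hp (wStar P M σ z)) 2
    rw [normM_sub_comm M p z]
    rw [normM_sub_comm M p] at h2
    linarith
  exact (Real.sqrt_le_left (distM_nonneg _ _)).1 h

/-- Bounded metric subregularity at the exact proximal point. -/
theorem distM_wStar_le (hn : 0 < n) (hm : 0 < m) (hσ : 0 < σ) {r κ : ℝ} (hκ : 0 ≤ κ)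
    (hsub : MetricSubregularOn P r κ) (hne : (solSet P).Nonempty) {z : PD n m}
    (hz : ‖wStar P M σ z‖ ≤ r) :
    σ * distM M (wStar P M σ z) (solSet P) ≤ κ * normM M (z - wStar P M σ z) := by
  have h1 := hsub _ hz
  set w := wStar P M σ z
  -- The resolvent inclusion exhibits `M (z - w) / σ` as an element of `T_ℓ(w)`.
  have h2 : Metric.infEDist 0 (opT P w) ≤ ENNReal.ofReal (1 / σ * normM M (z - w)) := by
    refine (Metric.infEDist_le_edist_of_mem (mem_opT_iff.2 (isOpT_wStar P M hn hm hσ z))).trans ?_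
    rw [edist_dist, dist_zero_left, norm_smul, Real.norm_of_nonneg (one_div_pos.2 hσ).le]
    gcongr
    exact norm_op_le M _
  have h3 : Metric.infEDist w (solSet P) ≤ ENNReal.ofReal (κ * (1 / σ * normM M (z - w))) := by
    rw [ENNReal.ofReal_mul hκ]
    exact h1.trans (by gcongr)
  have h4 : Metric.infDist w (solSet P) ≤ κ * (1 / σ * normM M (z - w)) :=
    ENNReal.toReal_le_of_le_ofReal
      (mul_nonneg hκ (mul_nonneg (one_div_pos.2 hσ).le (normM_nonneg _ _))) h3
  have h5 := (distM_le_infDist M hne w).trans h4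
  calc σ * distM M w (solSet P) ≤ σ * (κ * (1 / σ * normM M (z - w))) := by gcongr
    _ = _ := by field_simp

/-- The quantitative consequences of metric subregularity for one exact proximal step, with
`a ≤ σ / κ`. -/
structure ExactStep (P : Problem n m) (M : Preconditioner n m) (σ a : ℝ) (z : PD n m) : Prop where
  sq_add_sq_le : normM M (z - wStar P M σ z) ^ 2 + distM M (wStar P M σ z) (solSet P) ^ 2 ≤
    distM M z (solSet P) ^ 2
  mul_le : a * distM M (wStar P M σ z) (solSet P) ≤ normM M (z - wStar P M σ z)

variable {a : ℝ} {z : PD n m}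

/-- With `d` and `D` the new and old distances and `b` the displacement, `(a d)² ≤ b²` and `b² + d²
≤ D²` give `(a² + 1) d² ≤ D²`. -/
theorem ExactStep.distM_le (h : ExactStep P M σ a z) (ha : 0 < a) :
    distM M (wStar P M σ z) (solSet P) ≤ contr a * distM M z (solSet P) := by
  have hd := distM_nonneg M (D := solSet P) (wStar P M σ z)
  have h1 := pow_le_pow_left₀ (mul_nonneg ha.le hd) h.mul_le 2
  have h2 := h.sq_add_sq_le
  have hD := distM_nonneg M (D := solSet P) z
  rw [contr]
  have : √(1 / (a ^ 2 + 1)) * distM M z (solSet P) =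
      √(1 / (a ^ 2 + 1) * distM M z (solSet P) ^ 2) := by
    rw [Real.sqrt_mul (by positivity), Real.sqrt_sq hD]
  rw [this]
  refine Real.le_sqrt_of_sq_le ?_
  rw [one_div_mul_eq_div, le_div_iff₀ (by positivity)]
  linarith

theorem ExactStep.normM_le (h : ExactStep P M σ a z) :
    normM M (z - wStar P M σ z) ≤ distM M z (solSet P) := by
  have := h.sq_add_sq_le
  exact le_of_sq_le_sq (by nlinarith) (distM_nonneg _ _)

theorem ExactStep.le_normM (h : ExactStep P M σ a z) (ha : 0 < a) (hne : (solSet P).Nonempty) :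
    (1 - contr a) * distM M z (solSet P) ≤ normM M (z - wStar P M σ z) := by
  have h1 := h.distM_le ha
  have h2 := distM_le_add M hne z (wStar P M σ z)
  linarith

/-- For `γ ≤ 1` the relaxed point is a convex combination of `w` and `z`, so convexity of the
distance suffices. For `γ ≥ 1` it overshoots `w`, and `normM_relax_sq_le'` is used instead. -/
theorem ExactStep.distM_relax_le (h : ExactStep P M σ a z) (ha : 0 < a) (hn : 0 < n) (hm : 0 < m)
    (hσ : 0 < σ) (hne : (solSet P).Nonempty) {γ : ℝ} (hγ : 0 < γ) (hγ2 : γ < 2) :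
    distM M (γ • wStar P M σ z + (1 - γ) • z) (solSet P) ≤
      √(1 - min γ (2 * γ - γ ^ 2) * a ^ 2 / (a ^ 2 + 1)) * distM M z (solSet P) := by
  set w := wStar P M σ z
  set D := distM M z (solSet P)
  set d := distM M w (solSet P)
  set b := normM M (z - w)
  have hD : 0 ≤ D := distM_nonneg M z
  have hd : 0 ≤ d := distM_nonneg M w
  have hb : 0 ≤ b := normM_nonneg M _
  have h1 : b ^ 2 + d ^ 2 ≤ D ^ 2 := h.sq_add_sq_le
  have h2 : (a * d) ^ 2 ≤ b ^ 2 := pow_le_pow_left₀ (mul_nonneg ha.le hd) h.mul_le 2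
  have hA : 0 < a ^ 2 + 1 := by positivity
  rw [← Real.sqrt_sq hD, ← Real.sqrt_mul' _ (sq_nonneg D)]
  refine Real.le_sqrt_of_sq_le ?_
  set X := distM M (γ • w + (1 - γ) • z) (solSet P)
  have hX : 0 ≤ X := distM_nonneg M _
  have e : (1 - min γ (2 * γ - γ ^ 2) * a ^ 2 / (a ^ 2 + 1)) * D ^ 2 =
      (a ^ 2 + 1 - min γ (2 * γ - γ ^ 2) * a ^ 2) * D ^ 2 / (a ^ 2 + 1) := by
    field_simp
  rw [e, le_div_iff₀ hA]
  rcases le_total γ 1 with hγ1 | hγ1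
  · have h3 : X ≤ γ * d + (1 - γ) * D :=
      distM_combo_le M hne (convex_solSet P) w z hγ.le (by linarith) (by ring)
    rw [min_eq_left (by nlinarith)]
    have h4 : X ^ 2 ≤ (γ * d + (1 - γ) * D) ^ 2 := pow_le_pow_left₀ hX h3 2
    have h5 : (γ * d + (1 - γ) * D) ^ 2 ≤ γ * d ^ 2 + (1 - γ) * D ^ 2 := by
      have : γ * d ^ 2 + (1 - γ) * D ^ 2 - (γ * d + (1 - γ) * D) ^ 2 =
        γ * (1 - γ) * (d - D) ^ 2 := by ring
      have : 0 ≤ γ * (1 - γ) * (d - D) ^ 2 :=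
        mul_nonneg (mul_nonneg hγ.le (by linarith)) (sq_nonneg _)
      linarith
    have h6 : (a ^ 2 + 1) * d ^ 2 ≤ D ^ 2 := by linarith
    have h7 := mul_le_mul_of_nonneg_right (h4.trans h5) hA.le
    have h8 := mul_le_mul_of_nonneg_left h6 hγ.le
    linarith
  · have h3 : X ^ 2 ≤ d ^ 2 + (γ - 1) ^ 2 * b ^ 2 := by
      have : √(X ^ 2 - (γ - 1) ^ 2 * b ^ 2) ≤ d := by
        refine le_distM M hne fun p hp => Real.sqrt_le_iff.2 ⟨normM_nonneg _ _, ?_⟩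
        have h4 := normM_relax_sq_le' (M := M) hn hm hσ z hp hγ1
        have h5 := pow_le_pow_left₀ hX (AGPPA.distM_le M hp (γ • w + (1 - γ) • z)) 2
        rw [normM_sub_comm M p] at h5
        linarith
      rw [Real.sqrt_le_left hd] at this
      linarith
    rw [min_eq_right (by nlinarith)]
    have h4 : (a ^ 2 + 1 - (2 * γ - γ ^ 2) * a ^ 2) * (b ^ 2 + d ^ 2) ≤
        (a ^ 2 + 1 - (2 * γ - γ ^ 2) * a ^ 2) * D ^ 2 := by
      refine mul_le_mul_of_nonneg_left h1 ?_
      nlinarith [sq_nonneg ((γ - 1) * a)]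
    have h5 := mul_le_mul_of_nonneg_right h3 hA.le
    have h6 : (γ - 1) ^ 2 ≤ 1 := by nlinarith
    -- Since `(γ - 1)² ≤ 1`, the worst case under `b² + d² ≤ D²` and `a d ≤ b` is `b = a d`.
    have h7 : 0 ≤ (1 - (γ - 1) ^ 2) * (b ^ 2 - (a * d) ^ 2) :=
      mul_nonneg (by linarith) (by linarith)
    nlinarith

end ProxStep

/-- An inexact over-relaxed proximal step from `z` to `z'`. -/
def InexactStep (P : Problem n m) (M : Preconditioner n m) (q : Params) (s t : ℕ)
    (z z' : PD n m) : Prop :=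
  ∃ w, z' = q.γ • w + (1 - q.γ) • z ∧ normM M (w - wStar P M (q.sig s) z) ≤ q.eta s t ∧
    normM M (w - wStar P M (q.sig s) z) ≤ q.δ * normM M (w - z)

section InexactStep

variable {P : Problem n m} {M : Preconditioner n m} {q : Params} {s t : ℕ} {z z' : PD n m}

theorem inexactStep_of_stopCrit (hn : 0 < n) (hm : 0 < m) {x : Vec n}
    (h : stopCrit P M (q.sig s) (q.eta s t) q.δ z x) :
    InexactStep P M q s t z (q.γ • liftPt P M (q.sig s) z x + (1 - q.γ) • z) := by
  have h0 : 0 ≤ min (q.eta s t) (q.δ * normM M (liftPt P M (q.sig s) z x - z)) :=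
    le_min (q.eta_pos s t).le (mul_nonneg q.δ_pos.le (normM_nonneg _ _))
  have := normM_liftPt_sub_wStar_le_infEDist P M hn hm (q.sig_pos s) h0 h
  exact ⟨_, rfl, this.trans (min_le_left _ _), this.trans (min_le_right _ _)⟩

/-- Quasi-Fejér monotonicity: the exact relaxed step does not increase the distance to any solution,
so only the absolute error `γ η` is added. -/
theorem InexactStep.normM_sub_le (h : InexactStep P M q s t z z') (hn : 0 < n) (hm : 0 < m)
    {p : PD n m} (hp : p ∈ solSet P) :
    normM M (z' - p) ≤ normM M (z - p) + q.γ * q.eta s t := by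
  obtain ⟨w, rfl, h1, -⟩ := h
  have h2 := normM_relax_le (M := M) hn hm (q.sig_pos s) z hp q.γ_pos.le q.γ_lt_two.le
  have e : q.γ • w + (1 - q.γ) • z - p = (q.γ • wStar P M (q.sig s) z + (1 - q.γ) • z - p) +
      q.γ • (w - wStar P M (q.sig s) z) := by module
  rw [e]
  refine (normM_add_le M _ _).trans ?_
  rw [normM_smul, abs_of_pos q.γ_pos]
  have := mul_le_mul_of_nonneg_left h1 q.γ_pos.le
  linarith

/-- With the converse `le_normM_step`, this makes the observable step length comparable with the
exact displacement, and through `ExactStep` with the unobservable distance to `Ω`. -/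
theorem InexactStep.normM_step_le (h : InexactStep P M q s t z z') :
    (1 - q.δ) * normM M (z' - z) ≤ q.γ * normM M (z - wStar P M (q.sig s) z) := by
  obtain ⟨w, rfl, -, h2⟩ := h
  have e : q.γ • w + (1 - q.γ) • z - z = q.γ • (w - z) := by module
  rw [e, normM_smul, abs_of_pos q.γ_pos]
  have h3 := AGPPA.normM_sub_le M w (wStar P M (q.sig s) z) z
  rw [normM_sub_comm M (wStar P M (q.sig s) z) z] at h3
  have := mul_le_mul_of_nonneg_left (show (1 - q.δ) * normM M (w - z) ≤ _ by linarith) q.γ_pos.le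
  linarith

theorem InexactStep.le_normM_step (h : InexactStep P M q s t z z') :
    q.γ * normM M (z - wStar P M (q.sig s) z) ≤ (1 + q.δ) * normM M (z' - z) := by
  obtain ⟨w, rfl, -, h2⟩ := h
  have e : q.γ • w + (1 - q.γ) • z - z = q.γ • (w - z) := by module
  rw [e, normM_smul, abs_of_pos q.γ_pos]
  have h3 := AGPPA.normM_sub_le M z w (wStar P M (q.sig s) z)
  rw [normM_sub_comm M z w] at h3
  have := mul_le_mul_of_nonneg_left (show _ ≤ (1 + q.δ) * normM M (w - z) by linarith) q.γ_pos.le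
  linarith

/-- Linear convergence of the inexact step. -/
theorem InexactStep.distM_le (h : InexactStep P M q s t z z') (hn : 0 < n) (hm : 0 < m)
    (hne : (solSet P).Nonempty) (he : ExactStep P M (q.sig s) q.α z) :
    distM M z' (solSet P) ≤ q.rho * distM M z (solSet P) := by
  have hst := h.normM_step_le
  have h1 := he.distM_relax_le q.α_pos hn hm (q.sig_pos s) hne q.γ_pos q.γ_lt_two
  have hb := he.normM_le
  obtain ⟨w, rfl, -, h2⟩ := h
  set ws := wStar P M (q.sig s) z
  set D := distM M z (solSet P)
  have hD : 0 ≤ D := distM_nonneg M z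
  have e : q.γ • w + (1 - q.γ) • z - z = q.γ • (w - z) := by module
  rw [e, normM_smul, abs_of_pos q.γ_pos] at hst
  have h3 := distM_le_add M hne (q.γ • w + (1 - q.γ) • z) (q.γ • ws + (1 - q.γ) • z)
  have e2 : q.γ • w + (1 - q.γ) • z - (q.γ • ws + (1 - q.γ) • z) = q.γ • (w - ws) := by module
  rw [e2, normM_smul, abs_of_pos q.γ_pos] at h3
  have hδ := q.δ_pos
  have hδ2 := q.δ_lt_half
  have hγ := q.γ_pos
  have hγ2 := q.γ_lt_two
  have hα : 0 < q.α ^ 2 := pow_pos q.α_pos 2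
  set R := √(1 - min q.γ (2 * q.γ - q.γ ^ 2) * q.α ^ 2 / (q.α ^ 2 + 1)) with hR
  have hR0 : 0 ≤ R := Real.sqrt_nonneg _
  have hκ0 : 0 ≤ min q.γ 1 / √(q.α ^ 2 + 1) :=
    div_nonneg (le_min hγ.le zero_le_one) (Real.sqrt_nonneg _)
  -- This turns the error `δ γ D` into `δ (R + 1) D`; its part `δ R D` cancels against `(1 - δ) R
  -- D`, leaving `(R + δ) D`. The remaining summand of `rho` is nonnegative slack.
  have hγR : q.γ ≤ R + 1 := by
    rcases le_total q.γ 1 with h1 | h1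
    · linarith
    · have : q.γ - 1 ≤ R := by
        refine Real.le_sqrt_of_sq_le ?_
        have h5 : min q.γ (2 * q.γ - q.γ ^ 2) * q.α ^ 2 / (q.α ^ 2 + 1) ≤ 2 * q.γ - q.γ ^ 2 := by
          rw [div_le_iff₀ (by positivity)]
          have h6 : min q.γ (2 * q.γ - q.γ ^ 2) ≤ 2 * q.γ - q.γ ^ 2 := min_le_right _ _
          have h7 := mul_le_mul_of_nonneg_right h6 hα.le
          nlinarith
        linarith
      linarith
  have hrho : (1 - q.δ) * q.rho = R + q.δ * (min q.γ 1 / √(q.α ^ 2 + 1) + 1) := by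
    rw [Params.rho, ← mul_assoc, mul_one_div_cancel (by linarith), one_mul]
  have h4 : (1 - q.δ) * (q.γ * normM M (w - ws)) ≤ q.δ * (q.γ * D) := by
    have h5 := mul_le_mul_of_nonneg_left h2 (mul_nonneg (sub_nonneg.2 (by linarith : q.δ ≤ 1)) hγ.le)
    have h6 := mul_le_mul_of_nonneg_left (hst.trans (mul_le_mul_of_nonneg_left hb hγ.le)) hδ.le
    linarith
  have h1δ : 0 < 1 - q.δ := by linarith
  refine le_of_mul_le_mul_left ?_ h1δ
  calc (1 - q.δ) * distM M (q.γ • w + (1 - q.γ) • z) (solSet P)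
      ≤ (1 - q.δ) * (R * D + q.γ * normM M (w - ws)) :=
        mul_le_mul_of_nonneg_left (by linarith) h1δ.le
    _ ≤ (1 - q.δ) * R * D + q.δ * (q.γ * D) := by linarith
    _ ≤ (1 - q.δ) * R * D + q.δ * ((R + 1) * D) := by gcongr
    _ = (R + q.δ * (0 + 1)) * D := by ring
    _ ≤ (R + q.δ * (min q.γ 1 / √(q.α ^ 2 + 1) + 1)) * D := by gcongr
    _ = (1 - q.δ) * (q.rho * D) := by rw [← hrho]; ring

end InexactStep

end AGPPA

end

/-! ### Boundedness of the iterates; limits for the outer and proximal-step counters. -/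

noncomputable section

namespace AGPPA

variable {n m : ℕ}

/-- Integral comparison by telescoping: with `v = u + 1`, Bernoulli's inequality gives `(ς - 1)
v^(-ς) ≤ u^(1-ς) - v^(1-ς)`. -/
theorem sum_rpow_neg_le {ς : ℝ} (hς : 1 < ς) (t : ℕ) :
    ∑ i ∈ Finset.range t, (1 + (i : ℝ)) ^ (-ς) ≤ ς / (ς - 1) := by
  have hpos : 0 < ς - 1 := by linarith
  suffices h : ∀ t : ℕ, ∑ i ∈ Finset.range (t + 1), (1 + (i : ℝ)) ^ (-ς) ≤
      ς / (ς - 1) - (1 + (t : ℝ)) ^ (1 - ς) / (ς - 1) by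
    cases t with
    | zero => simp only [Finset.range_zero, Finset.sum_empty]; positivity
    | succ t =>
      refine (h t).trans (sub_le_self _ ?_)
      positivity
  intro t
  induction t with
  | zero =>
    simp only [zero_add, Finset.range_one, Finset.sum_singleton, Nat.cast_zero, add_zero,
      Real.one_rpow]
    rw [← sub_div, div_self hpos.ne']
  | succ t ih =>
    rw [Finset.sum_range_succ]
    suffices (1 + ((t + 1 : ℕ) : ℝ)) ^ (-ς) ≤ (1 + (t : ℝ)) ^ (1 - ς) / (ς - 1)
        - (1 + ((t + 1 : ℕ) : ℝ)) ^ (1 - ς) / (ς - 1) by linarith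
    rw [← sub_div, le_div_iff₀ hpos]
    set u : ℝ := 1 + (t : ℝ) with hu
    have hu0 : 0 < u := by positivity
    have e : 1 + ((t + 1 : ℕ) : ℝ) = u + 1 := by push_cast; ring
    rw [e]
    have hv0 : 0 < u + 1 := by linarith
    have hb : 1 + ς * (1 / u) ≤ (1 + 1 / u) ^ ς :=
      one_add_mul_self_le_rpow_one_add (by have := one_div_pos.2 hu0; linarith) hς.le
    have e1 : (1 + 1 / u) ^ ς = (u + 1) ^ ς / u ^ ς := by
      rw [← Real.div_rpow hv0.le hu0.le]; congr 1; field_simp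
    have e2 : u ^ (1 - ς) = u * (u ^ ς)⁻¹ := by
      rw [Real.rpow_sub hu0, Real.rpow_one]; rfl
    have e3 : (u + 1) ^ (1 - ς) = (u + 1) * ((u + 1) ^ ς)⁻¹ := by
      rw [Real.rpow_sub hv0, Real.rpow_one]; rfl
    have h1 : 0 < u ^ ς := Real.rpow_pos_of_pos hu0 _
    have h2 : 0 < (u + 1) ^ ς := Real.rpow_pos_of_pos hv0 _
    rw [e1, le_div_iff₀ h1] at hb
    rw [e2, e3, Real.rpow_neg hv0.le]
    set A := u ^ ς
    set B := (u + 1) ^ ς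
    have h3 : (u + ς) * A ≤ u * B := by
      calc (u + ς) * A = u * ((1 + ς * (1 / u)) * A) := by field_simp
        _ ≤ u * B := by gcongr
    have h4 : B⁻¹ * (u + ς) ≤ u * A⁻¹ := by
      rw [inv_mul_eq_div, ← div_eq_mul_inv, div_le_div_iff₀ h2 h1]
      exact h3
    linarith

/-- The data of an instance and the standing assumptions of the complexity analysis. -/
structure Setting (P : Problem n m) (M : Preconditioner n m) (q : Params) (E : PD n m → ℝ)
    (ζ : ℝ) (z0 zProj : PD n m) (r κ ε : ℝ) : Prop where
  hn : 0 < n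
  hm : 0 < m
  rho_lt_one : q.rho < 1
  lamMin_pos : 0 < M.lamMin
  measurable_E : Measurable E
  ζ_pos : 0 < ζ
  E_le : ∀ z, E z ≤ ζ * Metric.infDist z (solSet P)
  zProj_mem : zProj ∈ solSet P
  zProj_le : ∀ z ∈ solSet P, ‖z0 - zProj‖ ≤ ‖z0 - z‖
  radius_le : radius P M q z0 zProj ≤ r
  subreg : MetricSubregularOn P r κ
  ε_pos : 0 < ε
  κ_pos : 0 < κ
  σ₀_le : q.σ₀ ≤ q.α * q.ϱσ * κ
  one_le_r : 1 ≤ r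
  one_le : 1 ≤ r * (P.L₀ + cstA P M)

/-- The radius of the weighted ball around the solution `zProj` that contains all iterates. -/
def radM (M : Preconditioner n m) (q : Params) (z0 zProj : PD n m) : ℝ :=
  normM M (z0 - zProj) + q.γ * (q.ς * q.η₀ / ((q.ς - 1) * (1 - q.ϱη)))

/-- The weighted distance from `zProj` that the iterate `z^{s,t}` can have. -/
def budget (M : Preconditioner n m) (q : Params) (z0 zProj : PD n m) (s t : ℕ) : ℝ :=
  normM M (z0 - zProj) + q.γ * (∑ i ∈ Finset.range s, q.η₀ * q.ϱη ^ i * (q.ς / (q.ς - 1))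
    + ∑ j ∈ Finset.range t, q.eta s j)

section Budget

variable (M : Preconditioner n m) (q : Params) (z0 zProj : PD n m)

theorem budget_succ (s t : ℕ) :
    budget M q z0 zProj s (t + 1) = budget M q z0 zProj s t + q.γ * q.eta s t := by
  rw [budget, budget, Finset.sum_range_succ]
  ring

/-- The next outer iteration is charged with the whole error series of the present one. Restarting
from any earlier point of the path therefore respects the budget. -/
theorem budget_le_next (s t : ℕ) : budget M q z0 zProj s t ≤ budget M q z0 zProj (s + 1) 0 := by
  rw [budget, budget, Finset.sum_range_succ, Finset.sum_range_zero, add_zero]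
  have h1 : ∑ j ∈ Finset.range t, q.eta s j ≤ q.η₀ * q.ϱη ^ s * (q.ς / (q.ς - 1)) := by
    simp only [Params.eta]
    rw [← Finset.mul_sum]
    exact mul_le_mul_of_nonneg_left (sum_rpow_neg_le q.one_lt_ς t)
      (mul_nonneg q.η₀_pos.le (pow_nonneg q.ϱη_pos.le _))
  have := q.γ_pos
  gcongr

theorem budget_zero_le (s : ℕ) : budget M q z0 zProj s 0 ≤ radM M q z0 zProj := by
  rw [budget, radM, Finset.sum_range_zero, add_zero, ← Finset.sum_mul, ← Finset.mul_sum]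
  have h1 : ∑ i ∈ Finset.range s, q.ϱη ^ i ≤ 1 / (1 - q.ϱη) := by
    have h := q.ϱη_lt_one
    rw [le_div_iff₀ (by linarith), geom_sum_mul_neg]
    have := pow_pos q.ϱη_pos s
    linarith
  have h2 : 0 ≤ q.ς / (q.ς - 1) := by have := q.one_lt_ς; apply div_nonneg <;> linarith
  have h3 := q.one_lt_ς
  have h4 := q.ϱη_lt_one
  have h5 : q.η₀ * (∑ i ∈ Finset.range s, q.ϱη ^ i) * (q.ς / (q.ς - 1)) ≤
      q.η₀ * (1 / (1 - q.ϱη)) * (q.ς / (q.ς - 1)) := by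
    have := q.η₀_pos
    gcongr
  have e : q.ς * q.η₀ / ((q.ς - 1) * (1 - q.ϱη)) =
      q.η₀ * (1 / (1 - q.ϱη)) * (q.ς / (q.ς - 1)) := by
    have : q.ς - 1 ≠ 0 := by linarith
    have : 1 - q.ϱη ≠ 0 := by linarith
    field_simp
  rw [e]
  have := q.γ_pos
  gcongr

theorem budget_le (s t : ℕ) : budget M q z0 zProj s t ≤ radM M q z0 zProj :=
  (budget_le_next M q z0 zProj s t).trans (budget_zero_le M q z0 zProj _)

end Budget

theorem innerCount_pos (q : Params) (μ ζ r κ ε : ℝ) : 0 < innerCount q μ ζ r κ ε :=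
  Nat.ceil_pos.2 (by
    have := le_max_right (Real.logb (1 / q.rho) (RBar q μ ζ r κ / ε)) 0
    linarith)

namespace Setting

variable {P : Problem n m} {M : Preconditioner n m} {q : Params} {E : PD n m → ℝ}
  {ζ : ℝ} {z0 zProj : PD n m} {r κ ε : ℝ} (S : Setting P M q E ζ z0 zProj r κ ε)
include S

theorem nonempty : (solSet P).Nonempty := ⟨zProj, S.zProj_mem⟩

theorem lamMin_le_one : M.lamMin ≤ 1 := by
  have := Preconditioner.nontrivial_vec S.hn
  obtain ⟨x, hx⟩ := exists_ne (0 : Vec n)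
  have h1 := (M.lamMin_mul_le (pair x 0)).trans (M.inner_op_le _)
  have h2 : 0 < ‖pair x (0 : Vec m)‖ ^ 2 := by
    rw [norm_sq_PD]
    have : 0 < ‖x‖ := norm_pos_iff.2 hx
    simp only [pair_fst, pair_snd]
    positivity
  nlinarith

theorem sqrt_pos : 0 < √M.lamMin := Real.sqrt_pos.2 S.lamMin_pos

theorem sqrt_le_one : √M.lamMin ≤ 1 := Real.sqrt_le_one.2 S.lamMin_le_one

/-- The factor `1/λ_min(M)` in `radius` is spent in two halves `1/√λ_min(M)`: one because `zProj` is
the Euclidean and not the weighted projection, one to pass from the weighted ball to a Euclidean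
ball. -/
theorem radM_le : ‖zProj‖ + radM M q z0 zProj / √M.lamMin ≤ r := by
  refine le_trans ?_ S.radius_le
  rw [radius, radM]
  have hs := S.sqrt_pos
  have hμ := S.lamMin_pos
  have h1 : √M.lamMin * normM M (z0 - zProj) ≤ distM M z0 (solSet P) := by
    refine le_distM M S.nonempty fun p hp => ?_
    refine le_trans ?_ (sqrt_lamMin_mul_norm_le M hμ.le _)
    rw [norm_sub_rev p z0]
    exact mul_le_mul_of_nonneg_left ((normM_le_norm M _).trans (S.zProj_le p hp)) hs.le
  have h2 : 0 ≤ q.γ * q.ς * q.η₀ / ((q.ς - 1) * (1 - q.ϱη)) := by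
    have := q.one_lt_ς
    have := q.ϱη_lt_one
    have := q.γ_pos
    have := q.η₀_pos
    have h3 : 0 < q.ς - 1 := by linarith
    have h4 : 0 < 1 - q.ϱη := by linarith
    positivity
  have e : q.γ * (q.ς * q.η₀ / ((q.ς - 1) * (1 - q.ϱη))) =
      q.γ * q.ς * q.η₀ / ((q.ς - 1) * (1 - q.ϱη)) := by ring
  rw [e]
  set G := q.γ * q.ς * q.η₀ / ((q.ς - 1) * (1 - q.ϱη))
  have e2 : 1 / M.lamMin = 1 / √M.lamMin * (1 / √M.lamMin) := by
    rw [div_mul_div_comm, Real.mul_self_sqrt hμ.le, one_mul]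
  have h5 : normM M (z0 - zProj) + G ≤ 1 / √M.lamMin * (distM M z0 (solSet P) + G) := by
    rw [one_div_mul_eq_div, le_div_iff₀ hs]
    have := mul_le_mul_of_nonneg_left S.sqrt_le_one h2
    linarith
  rw [e2, ← one_div_mul_eq_div, mul_assoc]
  gcongr

theorem radM_le_mul : radM M q z0 zProj ≤ √M.lamMin * r := by
  have h1 := S.radM_le
  have h2 := norm_nonneg zProj
  have h3 : radM M q z0 zProj / √M.lamMin ≤ r := by linarith
  rwa [div_le_iff₀ S.sqrt_pos, mul_comm] at h3

variable {z : PD n m} {σ : ℝ}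

/-- Subregularity is invoked at the exact proximal point, which is no farther from `zProj` in the
weighted norm than the base point is. -/
theorem norm_wStar_le (hσ : 0 < σ) (hz : normM M (z - zProj) ≤ radM M q z0 zProj) :
    ‖wStar P M σ z‖ ≤ r := by
  refine le_trans ?_ S.radM_le
  have h1 := wStar_pythagoras (M := M) S.hn S.hm hσ z S.zProj_mem
  have h2 : normM M (wStar P M σ z - zProj) ≤ normM M (z - zProj) :=
    le_of_sq_le_sq (by nlinarith) (normM_nonneg _ _)
  have h3 := sqrt_lamMin_mul_norm_le M S.lamMin_pos.le (wStar P M σ z - zProj)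
  have h4 := norm_le_norm_add_norm_sub zProj (wStar P M σ z)
  have h5 : ‖wStar P M σ z - zProj‖ ≤ radM M q z0 zProj / √M.lamMin := by
    rw [le_div_iff₀ S.sqrt_pos]
    linarith
  rw [norm_sub_rev] at h4
  linarith [norm_sub_rev zProj (wStar P M σ z)]

theorem normM_sub_wStar_le (hσ : 0 < σ) (hz : normM M (z - zProj) ≤ radM M q z0 zProj) :
    normM M (z - wStar P M σ z) ≤ √M.lamMin * r := by
  have h1 := wStar_pythagoras (M := M) S.hn S.hm hσ z S.zProj_mem
  have h2 : normM M (z - wStar P M σ z) ≤ normM M (z - zProj) :=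
    le_of_sq_le_sq (by nlinarith) (normM_nonneg _ _)
  exact h2.trans (hz.trans S.radM_le_mul)

theorem exactStep (hσ : 0 < σ) {a : ℝ} (ha : a * κ ≤ σ)
    (hz : normM M (z - zProj) ≤ radM M q z0 zProj) : ExactStep P M σ a z where
  sq_add_sq_le := distM_wStar_sq_le S.hn S.hm hσ z S.nonempty
  mul_le := by
    have h1 := distM_wStar_le (M := M) S.hn S.hm hσ S.κ_pos.le S.subreg S.nonempty
      (S.norm_wStar_le hσ hz)
    have h2 := mul_le_mul_of_nonneg_right ha (distM_nonneg M (D := solSet P) (wStar P M σ z))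
    have : κ * (a * distM M (wStar P M σ z) (solSet P)) ≤ κ * normM M (z - wStar P M σ z) := by
      linarith
    exact le_of_mul_le_mul_left this S.κ_pos

/-- The linear-decrease test does not fail once `σ_s ≥ α κ`. -/
theorem not_testFails {s t : ℕ} {path : ℕ → PD n m} (hs : q.α * κ ≤ q.sig s)
    (hstep : ∀ j ≤ t, InexactStep P M q s j (path j) (path (j + 1)))
    (hb : ∀ j ≤ t, normM M (path j - zProj) ≤ radM M q z0 zProj) : ¬ testFails M q path t := by
  rintro ⟨j, hj, hlt⟩
  refine not_le.2 hlt ?_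
  have hx : ∀ i ≤ t, ExactStep P M (q.sig s) q.α (path i) := fun i hi =>
    S.exactStep (q.sig_pos s) hs (hb i hi)
  have hdec : ∀ i, j + i ≤ t →
      distM M (path (j + i)) (solSet P) ≤ q.rho ^ i * distM M (path j) (solSet P) := by
    intro i
    induction i with
    | zero => intro _; simp
    | succ i ih =>
      intro hi
      have h1 := (hstep (j + i) (by omega)).distM_le S.hn S.hm S.nonempty (hx (j + i) (by omega))
      have h2 := mul_le_mul_of_nonneg_left (ih (by omega)) q.rho_pos.le
      rw [pow_succ']
      rw [← add_assoc]
      linarith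
  have h1 := hdec (t - j) (by omega)
  rw [Nat.add_sub_cancel' hj] at h1
  have h2 := (hstep t le_rfl).normM_step_le
  have h3 := (hx t le_rfl).normM_le
  have h4 := (hstep j hj).le_normM_step
  have h5 := (hx j hj).le_normM q.α_pos S.nonempty
  set A := normM M (path (t + 1) - path t)
  set B := normM M (path (j + 1) - path j)
  set Dj := distM M (path j) (solSet P)
  have hδ := q.δ_pos
  have hδ2 := q.δ_lt_half
  have hγ := q.γ_pos
  have h1δ : 0 < 1 - q.δ := by linarith
  have hc : 0 < 1 - contr q.α := sub_pos.2 (contr_lt_one q.α_pos)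
  have hR : 0 ≤ q.rho ^ (t - j) := pow_nonneg q.rho_pos.le _
  -- The step at `t` is bounded above by the distance at `t`, hence by `ρ^(t-j)` times the distance
  -- at `j`; the step at `j` is bounded below by the latter distance. The ratio of the constants is
  -- `testC`.
  have h6 : (1 - q.δ) * A ≤ q.γ * (q.rho ^ (t - j) * Dj) :=
    h2.trans (mul_le_mul_of_nonneg_left (h3.trans h1) hγ.le)
  have h7 : q.γ * ((1 - contr q.α) * Dj) ≤ (1 + q.δ) * B :=
    (mul_le_mul_of_nonneg_left h5 hγ.le).trans h4
  rw [Params.testC, ← contr, div_mul_eq_mul_div, le_div_iff₀ (mul_pos h1δ hc)]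
  have h8 := mul_le_mul_of_nonneg_right h6 hc.le
  have h9 := mul_le_mul_of_nonneg_left h7 hR
  linarith

theorem contr_div : contr (q.σ₀ / κ) = √(κ ^ 2 / (q.σ₀ ^ 2 + κ ^ 2)) := by
  rw [contr]
  congr 1
  have := S.κ_pos
  field_simp

/-- If the test is passed at `t`, the residual at `t` is at most `RBar ρ ^ t`. -/
theorem E_le_of_test {s t : ℕ} {path : ℕ → PD n m}
    (h0 : InexactStep P M q s 0 (path 0) (path 1))
    (ht : InexactStep P M q s t (path t) (path (t + 1)))
    (hb0 : normM M (path 0 - zProj) ≤ radM M q z0 zProj)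
    (hbt : normM M (path t - zProj) ≤ radM M q z0 zProj) (htest : ¬ testFails M q path t) :
    E (path t) ≤ RBar q M.lamMin ζ r κ * q.rho ^ t := by
  have hκ := S.κ_pos
  have hσ₀ := q.σ₀_pos
  have ha : 0 < q.σ₀ / κ := div_pos hσ₀ hκ
  -- Only `σ_s ≥ σ₀` is known here, so the contraction parameter is `σ₀ / κ`, the source of the
  -- factor `1 - √(κ²/(σ₀² + κ²))` in `RBar`.
  have hle : q.σ₀ / κ * κ ≤ q.sig s := by
    rw [div_mul_cancel₀ _ hκ.ne']; exact q.σ₀_le_sig s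
  have hx0 := S.exactStep (q.sig_pos s) hle hb0
  have hxt := S.exactStep (q.sig_pos s) hle hbt
  have h1 : normM M (path (t + 1) - path t) ≤
      q.testC * (q.rho ^ t * normM M (path 1 - path 0)) := by
    by_contra hcon
    -- The test is used with `j = 0`: it compares with the first step, which is bounded by the
    -- radius.
    exact htest ⟨0, t.zero_le, not_le.1 hcon⟩
  have h2 := h0.normM_step_le
  have h3 := hx0.normM_le
  have h4 := ht.le_normM_step
  have h5 := hxt.le_normM ha S.nonempty
  have h6 := infDist_le_distM M S.nonempty S.lamMin_pos (path t)
  have h7 : distM M (path 0) (solSet P) ≤ √M.lamMin * r :=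
    (distM_le M S.zProj_mem _).trans (by rw [normM_sub_comm]; exact hb0.trans S.radM_le_mul)
  have hδ := q.δ_pos
  have hδ2 := q.δ_lt_half
  have hγ := q.γ_pos
  have h1δ : 0 < 1 - q.δ := by linarith
  have hc : 0 < 1 - contr q.α := sub_pos.2 (contr_lt_one q.α_pos)
  have hc2 : 0 < 1 - contr (q.σ₀ / κ) := sub_pos.2 (contr_lt_one ha)
  have hμ := S.lamMin_pos
  have hs := S.sqrt_pos
  have hζ := S.ζ_pos
  have hr : 0 < r := by linarith [S.one_le_r]
  have hR : 0 ≤ q.rho ^ t := pow_nonneg q.rho_pos.le _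
  set A := normM M (path (t + 1) - path t)
  set B := normM M (path 1 - path 0)
  set D0 := distM M (path 0) (solSet P)
  set Dt := distM M (path t) (solSet P)
  set I := Metric.infDist (path t) (solSet P)
  rw [Params.testC, ← contr, div_mul_eq_mul_div, le_div_iff₀ (mul_pos h1δ hc)] at h1
  have k1 : (1 - q.δ) * B ≤ q.γ * (√M.lamMin * r) :=
    h2.trans (mul_le_mul_of_nonneg_left (h3.trans h7) hγ.le)
  have k2 : q.γ * ((1 - contr (q.σ₀ / κ)) * (√M.lamMin * I)) ≤ (1 + q.δ) * A :=
    (mul_le_mul_of_nonneg_left ((mul_le_mul_of_nonneg_left h6 hc2.le).trans h5) hγ.le).trans h4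
  have k3 := mul_le_mul_of_nonneg_left k1 (mul_nonneg (by linarith : 0 ≤ 1 + q.δ) hR)
  have k4 := mul_le_mul_of_nonneg_left h1 h1δ.le
  have k5 := mul_le_mul_of_nonneg_right k2 (mul_pos (mul_pos h1δ h1δ) hc).le
  have k6 : (q.γ * √M.lamMin) * ((1 - q.δ) ^ 2 * (1 - contr q.α) * (1 - contr (q.σ₀ / κ)) * I) ≤
      (q.γ * √M.lamMin) * ((1 + q.δ) ^ 2 * r * q.rho ^ t) := by
    have k7 := mul_le_mul_of_nonneg_left (k4.trans' (le_of_eq rfl)) (by linarith : 0 ≤ 1 + q.δ)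
    have k8 := mul_le_mul_of_nonneg_left k3 (by linarith : 0 ≤ 1 + q.δ)
    linarith
  have k9 := le_of_mul_le_mul_left k6 (mul_pos hγ hs)
  have k10 : E (path t) ≤ ζ * I := S.E_le _
  rw [RBar, ← contr, ← S.contr_div, div_mul_eq_mul_div,
    le_div_iff₀ (mul_pos (mul_pos (mul_pos (pow_pos h1δ 2) hc) hc2) hμ)]
  set Q := (1 - q.δ) ^ 2 * (1 - contr q.α) * (1 - contr (q.σ₀ / κ)) with hQ
  have hQ0 : 0 < Q := mul_pos (mul_pos (pow_pos h1δ 2) hc) hc2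
  have hI : 0 ≤ I := Metric.infDist_nonneg
  calc E (path t) * (Q * M.lamMin) ≤ ζ * I * (Q * M.lamMin) := by gcongr
    -- The factors `√λ_min(M)` have cancelled in `k6`; the factor `1/λ_min(M)` of `RBar` is slack,
    -- as `λ_min(M) ≤ 1`.
    _ ≤ ζ * I * (Q * 1) := by gcongr; exact S.lamMin_le_one
    _ = ζ * (Q * I) := by ring
    _ ≤ ζ * ((1 + q.δ) ^ 2 * r * q.rho ^ t) := by gcongr
    _ = _ := by ring

theorem RBar_pos : 0 < RBar q M.lamMin ζ r κ := by
  have hδ := q.δ_pos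
  have hδ2 := q.δ_lt_half
  have h1δ : 0 < 1 - q.δ := by linarith
  have hc : 0 < 1 - contr q.α := sub_pos.2 (contr_lt_one q.α_pos)
  have hc2 : 0 < 1 - contr (q.σ₀ / κ) :=
    sub_pos.2 (contr_lt_one (div_pos q.σ₀_pos S.κ_pos))
  have hr : 0 < r := by linarith [S.one_le_r]
  have := S.ζ_pos
  have := S.lamMin_pos
  rw [RBar, ← contr, ← S.contr_div]
  positivity

/-- The `+ 1` inside the ceiling of `innerCount` allows `t = innerCount - 1`, the last index before
the counter limit. -/
theorem RBar_mul_rho_le {t : ℕ} (ht : innerCount q M.lamMin ζ r κ ε ≤ t + 1) :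
    RBar q M.lamMin ζ r κ * q.rho ^ t ≤ ε := by
  have hρ := q.rho_pos
  have h1 : (1 : ℝ) < 1 / q.rho := by rw [lt_div_iff₀ hρ, one_mul]; exact S.rho_lt_one
  have h2 : max (Real.logb (1 / q.rho) (RBar q M.lamMin ζ r κ / ε)) 0 + 1 ≤ ((t + 1 : ℕ) : ℝ) :=
    (Nat.le_ceil _).trans (Nat.cast_le.2 ht)
  push_cast at h2
  have h3 : Real.logb (1 / q.rho) (RBar q M.lamMin ζ r κ / ε) ≤ t := by
    have := le_max_left (Real.logb (1 / q.rho) (RBar q M.lamMin ζ r κ / ε)) 0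
    linarith
  rw [Real.logb_le_iff_le_rpow h1 (div_pos S.RBar_pos S.ε_pos), Real.rpow_natCast, one_div, inv_pow,
    ← one_div, div_le_div_iff₀ S.ε_pos (pow_pos hρ _), one_mul] at h3
  exact h3

/-- The strict inequality matters: if the test fails at `s`, the next outer iteration still has `s +
1 ≤ sBar`. -/
theorem lt_sBar {s : ℕ} (hs : q.sig s < q.α * κ) : s < sBar q κ := by
  have hσ₀ := q.σ₀_pos
  have h1 : q.ϱσ ^ s < κ * q.α / q.σ₀ := by
    rw [lt_div_iff₀ hσ₀, mul_comm, mul_comm κ]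
    exact hs
  have h2 : (s : ℝ) < Real.logb q.ϱσ (κ * q.α / q.σ₀) := by
    rw [Real.lt_logb_iff_rpow_lt q.one_lt_ϱσ
      (div_pos (mul_pos S.κ_pos q.α_pos) hσ₀), Real.rpow_natCast]
    exact h1
  have h3 : (s : ℝ) < sBar q κ := h2.trans_le ((le_max_left _ _).trans (Nat.le_ceil _))
  exact_mod_cast h3

theorem sig_le_sigmaBar {s : ℕ} (hs : s ≤ sBar q κ) : q.sig s ≤ sigmaBar q κ := by
  refine (q.sig_mono hs).trans ?_
  rw [sigmaBar]
  have hσ₀ := q.σ₀_pos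
  -- If the logarithm is nonpositive, then `sBar = 0` and the bound is the assumption on `σ₀`;
  -- otherwise rounding up costs at most one factor `ϱσ`.
  rcases le_total (Real.logb q.ϱσ (κ * q.α / q.σ₀)) 0 with h | h
  · rw [sBar, max_eq_right h, Nat.ceil_zero, Params.sig, pow_zero, mul_one]
    have := S.σ₀_le
    linarith
  · have h1 : (sBar q κ : ℝ) ≤ Real.logb q.ϱσ (κ * q.α / q.σ₀) + 1 := by
      rw [sBar, max_eq_left h]
      exact (Nat.ceil_lt_add_one h).le
    have hϱ := zero_lt_one.trans q.one_lt_ϱσ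
    have h2 : q.ϱσ ^ (sBar q κ) ≤ κ * q.α / q.σ₀ * q.ϱσ := by
      rw [← Real.rpow_natCast]
      refine (Real.rpow_le_rpow_of_exponent_le q.one_lt_ϱσ.le h1).trans_eq ?_
      rw [Real.rpow_add hϱ, Real.rpow_one, Real.rpow_logb hϱ q.one_lt_ϱσ.ne'
        (div_pos (mul_pos S.κ_pos q.α_pos) hσ₀)]
    rw [Params.sig]
    calc q.σ₀ * q.ϱσ ^ sBar q κ ≤ q.σ₀ * (κ * q.α / q.σ₀ * q.ϱσ) := by gcongr
      _ = _ := by field_simp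

/-- The assumption `r (L₀ + a) ≥ 1` excludes `L₀ = a = 0`, so the division by `L` in the proximal
gradient step is genuine. -/
theorem lipL_pos (hσ : 0 < σ) : 0 < lipL P M σ := by
  have h1 := S.one_le
  have h2 := P.L₀_nonneg
  have h3 := M.lamMinL_pos S.hm
  have h4 : 0 ≤ cstA P M := by unfold cstA; positivity
  have h5 : lipL P M σ = P.L₀ + σ * cstA P M := by rw [lipL, cstA]; ring
  rw [h5]
  rcases h2.eq_or_lt with h0 | h0
  · have : 0 < cstA P M := by
      refine h4.lt_of_ne fun h => ?_
      rw [← h0, ← h] at h1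
      norm_num at h1
    positivity
  · positivity

end Setting

end AGPPA

end

/-! ### The machine: transitions, counters, invariants, termination on a fixed sample path. -/

noncomputable section

namespace AGPPA

variable {n m : ℕ} {Ξ : Type*}

/-- The counters of a state. -/
def State.idx (st : State n m) : ℕ × ℕ × ℕ := (st.s, st.t, st.k)

/-- The base point of the current proximal step. -/
def State.base (st : State n m) : PD n m := st.path st.t

/-- The lexicographic order of the counters. -/
def LexLT (i j : ℕ × ℕ × ℕ) : Prop :=
  i.1 < j.1 ∨ i.1 = j.1 ∧ (i.2.1 < j.2.1 ∨ i.2.1 = j.2.1 ∧ i.2.2 < j.2.2)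

theorem LexLT.trans {i j k : ℕ × ℕ × ℕ} (h : LexLT i j) (h' : LexLT j k) : LexLT i k := by
  unfold LexLT at *
  omega

theorem LexLT.ne {i j : ℕ × ℕ × ℕ} (h : LexLT i j) : i ≠ j := by
  rintro rfl
  unfold LexLT at h
  omega

section Step

variable (P : Problem n m) (M : Preconditioner n m) (q : Params) (E : PD n m → ℝ) (ε : ℝ)
  (S : InnerSolver n m Ξ)

/-- The result of the call of the inner solver. -/
def solved (S : InnerSolver n m Ξ) (st : State n m) (ξ : Ξ) : Vec n :=
  S.solve st.s st.t st.base st.x ξ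

open Classical in
/-- The better one of the current iterate and the result of the solver. -/
def nextY (st : State n m) (ξ : Ξ) : Vec n :=
  if objF P M (q.sig st.s) st.base st.x < objF P M (q.sig st.s) st.base (solved S st ξ) then st.x
  else solved S st ξ

/-- The next inner iterate. -/
def nextX (st : State n m) (ξ : Ξ) : Vec n :=
  proxGrad P M (q.sig st.s) st.base (nextY P M q S st ξ)

/-- The next outer iterate, if the proximal step is complete. -/
def nextZ (st : State n m) (ξ : Ξ) : PD n m :=
  q.γ • liftPt P M (q.sig st.s) st.base (nextX P M q S st ξ) + (1 - q.γ) • st.base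

/-- The path extended by the next outer iterate. -/
def nextPath (st : State n m) (ξ : Ξ) : ℕ → PD n m :=
  Function.update st.path (st.t + 1) (nextZ P M q S st ξ)

/-- The number of operations after the next iteration. -/
def nextOps (S : InnerSolver n m Ξ) (st : State n m) (ξ : Ξ) : ℕ :=
  st.ops + S.cost st.s st.t st.base st.x ξ

/-- The inner stopping criterion is met at the next inner iterate. -/
def Stops (st : State n m) (ξ : Ξ) : Prop :=
  stopCrit P M (q.sig st.s) (q.eta st.s st.t) q.δ st.base (nextX P M q S st ξ)

theorem step_of_some {st : State n m} {z : PD n m} (h : st.out = some z) (ξ : Ξ) :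
    step P M q E ε S st ξ = st := by
  unfold step
  rw [h]

open Classical in
theorem step_of_none {st : State n m} (h : st.out = none) (ξ : Ξ) :
    step P M q E ε S st ξ =
      if Stops P M q S st ξ then
        if E st.base ≤ ε then { st with ops := nextOps S st ξ, out := some st.base }
        else if testFails M q (nextPath P M q S st ξ) st.t then
          enterOuter P M q E ε (st.s + 1) (nextPath P M q S st ξ
            (bestIdx E (nextPath P M q S st ξ) (st.t + 1))) (nextOps S st ξ)
        else
          { s := st.s, t := st.t + 1, k := 0, path := nextPath P M q S st ξ,
            x := proxGrad P M (q.sig st.s) (nextZ P M q S st ξ) (nextZ P M q S st ξ).fst,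
            ops := nextOps S st ξ, out := none }
      else { st with k := st.k + 1, x := nextX P M q S st ξ, ops := nextOps S st ξ } := by
  unfold step
  rw [h]
  rfl

variable {P M q E ε S}

/-- The case distinction for a step that does not terminate the algorithm. -/
theorem step_none_cases {st : State n m} {ξ : Ξ} (h : (step P M q E ε S st ξ).out = none) :
    st.out = none ∧
    ((¬ Stops P M q S st ξ ∧ step P M q E ε S st ξ =
        { st with k := st.k + 1, x := nextX P M q S st ξ, ops := nextOps S st ξ }) ∨
      (Stops P M q S st ξ ∧ ε < E st.base ∧ testFails M q (nextPath P M q S st ξ) st.t ∧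
        step P M q E ε S st ξ = enterOuter P M q E ε (st.s + 1) (nextPath P M q S st ξ
            (bestIdx E (nextPath P M q S st ξ) (st.t + 1))) (nextOps S st ξ)) ∨
      (Stops P M q S st ξ ∧ ε < E st.base ∧ ¬ testFails M q (nextPath P M q S st ξ) st.t ∧
        step P M q E ε S st ξ =
          { s := st.s, t := st.t + 1, k := 0, path := nextPath P M q S st ξ,
            x := proxGrad P M (q.sig st.s) (nextZ P M q S st ξ) (nextZ P M q S st ξ).fst,
            ops := nextOps S st ξ, out := none })) := by
  have h0 : st.out = none := by
    cases hst : st.out with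
    | none => rfl
    | some z => rw [step_of_some P M q E ε S hst, hst] at h; cases h
  refine ⟨h0, ?_⟩
  have e := step_of_none P M q E ε S h0 ξ
  by_cases h1 : Stops P M q S st ξ
  · rw [if_pos h1] at e
    by_cases h2 : E st.base ≤ ε
    · rw [if_pos h2] at e
      rw [e] at h
      cases h
    · rw [if_neg h2] at e
      by_cases h3 : testFails M q (nextPath P M q S st ξ) st.t
      · rw [if_pos h3] at e
        exact Or.inr (Or.inl ⟨h1, not_le.1 h2, h3, e⟩)
      · rw [if_neg h3] at e
        exact Or.inr (Or.inr ⟨h1, not_le.1 h2, h3, e⟩)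
  · rw [if_neg h1] at e
    exact Or.inl ⟨h1, e⟩

/-- Strict growth of the counters while running ensures that no random choice `ω i` is read twice.
-/
theorem step_idx {st : State n m} {ξ : Ξ} (h : (step P M q E ε S st ξ).out = none) :
    LexLT st.idx (step P M q E ε S st ξ).idx := by
  obtain ⟨-, ⟨-, e⟩ | ⟨-, -, -, e⟩ | ⟨-, -, -, e⟩⟩ := step_none_cases h <;> rw [e] <;>
    simp [LexLT, State.idx, enterOuter]

theorem step_ops (st : State n m) (ξ : Ξ) :
    (step P M q E ε S st ξ).ops = st.ops ∨
      st.out = none ∧ (step P M q E ε S st ξ).ops = nextOps S st ξ := by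
  cases hst : st.out with
  | some z => rw [step_of_some P M q E ε S hst]; exact Or.inl rfl
  | none =>
    refine Or.inr ⟨rfl, ?_⟩
    rw [step_of_none P M q E ε S hst]
    split_ifs <;> rfl

theorem enterOuter_out {s : ℕ} {z w : PD n m} {ops : ℕ}
    (h : (enterOuter P M q E ε s z ops).out = some w) : E w ≤ ε := by
  unfold enterOuter at h
  simp only at h
  split_ifs at h with h1
  cases h
  exact h1

theorem step_out {st : State n m} {ξ : Ξ} (h0 : ∀ z, st.out = some z → E z ≤ ε) {z : PD n m}
    (h : (step P M q E ε S st ξ).out = some z) : E z ≤ ε := by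
  cases hst : st.out with
  | some z' => rw [step_of_some P M q E ε S hst] at h; exact h0 z h
  | none =>
    rw [step_of_none P M q E ε S hst] at h
    split_ifs at h with h1 h2 h3
    · cases h; exact h2
    · exact enterOuter_out h
    · simp [hst] at h

variable {z0 : PD n m} {ω : ℕ × ℕ × ℕ → Ξ}

theorem run_succ (N : ℕ) : run P M q E ε S z0 ω (N + 1) =
    step P M q E ε S (run P M q E ε S z0 ω N) (ω (run P M q E ε S z0 ω N).idx) := rfl

theorem run_out (N : ℕ) {z : PD n m} (h : (run P M q E ε S z0 ω N).out = some z) : E z ≤ ε := by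
  induction N generalizing z with
  | zero => exact enterOuter_out h
  | succ N ih => exact step_out (fun z => ih) h

theorem run_none_of_succ {N : ℕ} (h : (run P M q E ε S z0 ω (N + 1)).out = none) :
    (run P M q E ε S z0 ω N).out = none := (step_none_cases h).1

theorem run_idx_lt {N N' : ℕ} (hN : N < N') (h : (run P M q E ε S z0 ω N').out = none) :
    (run P M q E ε S z0 ω N).out = none ∧
      LexLT (run P M q E ε S z0 ω N).idx (run P M q E ε S z0 ω N').idx := by
  induction N', hN using Nat.le_induction with
  | base => exact ⟨run_none_of_succ h, step_idx h⟩
  | succ k hk ih =>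
    obtain ⟨h1, h2⟩ := ih (run_none_of_succ h)
    exact ⟨h1, h2.trans (step_idx h)⟩

/-- As long as the algorithm has not used the random choice `i`, it does not depend on it. -/
theorem run_update {N : ℕ} {i : ℕ × ℕ × ℕ} (ξ : Ξ) (h : (run P M q E ε S z0 ω N).out = none)
    (hi : (run P M q E ε S z0 ω N).idx = i) :
    run P M q E ε S z0 (Function.update ω i ξ) N = run P M q E ε S z0 ω N := by
  have : ∀ N' ≤ N, run P M q E ε S z0 (Function.update ω i ξ) N' = run P M q E ε S z0 ω N' := by
    intro N' hN'
    induction N' with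
    | zero => rfl
    | succ N' ih =>
      rw [run_succ, run_succ, ih (by omega)]
      congr 1
      refine Function.update_of_ne ?_ _ _
      rw [← hi]
      exact (run_idx_lt (by omega) h).2.ne
  exact this N le_rfl

theorem testFails_congr {path path' : ℕ → PD n m} {t : ℕ} (h : ∀ j ≤ t + 1, path j = path' j) :
    testFails M q path t ↔ testFails M q path' t := by
  unfold testFails
  refine exists_congr fun j => and_congr_right fun hj => ?_
  rw [h j (by omega), h (j + 1) (by omega), h t (by omega), h (t + 1) le_rfl]

theorem bestIdx_le (E : PD n m → ℝ) (path : ℕ → PD n m) (N : ℕ) : bestIdx E path N ≤ N := by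
  unfold bestIdx
  rcases Set.eq_empty_or_nonempty {j | j ≤ N ∧ ∀ i ≤ N, E (path j) ≤ E (path i)} with h | h
  -- The infimum of the empty set of naturals is `0`, so the bound needs no existence of a
  -- minimizer.
  · rw [h, Nat.sInf_empty]; exact N.zero_le
  · exact (Nat.sInf_mem h).1

end Step

/-- The invariants of the running algorithm. -/
structure Inv (P : Problem n m) (M : Preconditioner n m) (q : Params) (E : PD n m → ℝ)
    (z0 zProj : PD n m) (κ ε : ℝ) (st : State n m) : Prop where
  dom : P.g st.x ≠ ⊤
  start : st.k = 0 → st.x = proxGrad P M (q.sig st.s) st.base st.base.fst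
  steps : ∀ j < st.t, InexactStep P M q st.s j (st.path j) (st.path (j + 1))
  bound : ∀ j ≤ st.t, normM M (st.path j - zProj) ≤ budget M q z0 zProj st.s j
  test : ∀ j < st.t, ¬ testFails M q st.path j
  res : ∀ j < st.t, ε < E (st.path j)
  s_le : st.s ≤ sBar q κ

section Invariants

variable {P : Problem n m} {M : Preconditioner n m} {q : Params} {E : PD n m → ℝ}
  {ζ : ℝ} {z0 zProj : PD n m} {r κ ε : ℝ} (H : Setting P M q E ζ z0 zProj r κ ε)
  {S : InnerSolver n m Ξ} {ω : ℕ × ℕ × ℕ → Ξ}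

theorem Inv.normM_base_le {st : State n m} (h : Inv P M q E z0 zProj κ ε st) :
    normM M (st.base - zProj) ≤ radM M q z0 zProj :=
  (h.bound st.t le_rfl).trans (budget_le _ _ _ _ _ _)

include H

theorem Setting.proxGrad_dom (s : ℕ) (z : PD n m) (x : Vec n) :
    P.g (proxGrad P M (q.sig s) z x) ≠ ⊤ :=
  (isSubgrad_proxGrad P M H.hn H.hm (q.sig_pos s) (H.lipL_pos (q.sig_pos s)) z x).1

theorem Setting.inv_enterOuter {s : ℕ} {z : PD n m} {ops : ℕ}
    (hz : normM M (z - zProj) ≤ budget M q z0 zProj s 0) (hs : s ≤ sBar q κ) :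
    Inv P M q E z0 zProj κ ε (enterOuter P M q E ε s z ops) where
  dom := H.proxGrad_dom s _ _
  start _ := rfl
  steps j hj := absurd hj (Nat.not_lt_zero j)
  bound j hj := by
    obtain rfl : j = 0 := Nat.le_zero.1 hj
    exact hz
  test j hj := absurd hj (Nat.not_lt_zero j)
  res j hj := absurd hj (Nat.not_lt_zero j)
  s_le := hs

theorem Setting.inv_step {st : State n m} {ξ : Ξ} (h : Inv P M q E z0 zProj κ ε st)
    (hout : (step P M q E ε S st ξ).out = none) :
    Inv P M q E z0 zProj κ ε (step P M q E ε S st ξ) := by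
  obtain ⟨-, hc⟩ := step_none_cases hout
  have hpath : ∀ j ≤ st.t, nextPath P M q S st ξ j = st.path j := fun j hj =>
    Function.update_of_ne (by omega) _ _
  have hpath' : nextPath P M q S st ξ (st.t + 1) = nextZ P M q S st ξ := Function.update_self ..
  have hstep : Stops P M q S st ξ → ∀ j ≤ st.t, InexactStep P M q st.s j
      (nextPath P M q S st ξ j) (nextPath P M q S st ξ (j + 1)) := by
    intro hs j hj
    rcases hj.lt_or_eq with hj | rfl
    · rw [hpath j hj.le, hpath (j + 1) hj]
      exact h.steps j hj
    · rw [hpath _ le_rfl, hpath']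
      exact inexactStep_of_stopCrit H.hn H.hm hs
  have hbound : Stops P M q S st ξ → ∀ j ≤ st.t + 1,
      normM M (nextPath P M q S st ξ j - zProj) ≤ budget M q z0 zProj st.s j := by
    intro hs j hj
    rcases hj.lt_or_eq with hj | rfl
    · rw [hpath j (by omega)]
      exact h.bound j (by omega)
    · have h1 := (hstep hs st.t le_rfl).normM_sub_le H.hn H.hm H.zProj_mem
      rw [budget_succ]
      have h2 := h.bound st.t le_rfl
      rw [hpath _ le_rfl] at h1
      linarith
  rcases hc with ⟨h1, e⟩ | ⟨h1, h2, h3, e⟩ | ⟨h1, h2, h3, e⟩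
  · rw [e]
    exact ⟨H.proxGrad_dom _ _ _, fun h => absurd h (Nat.succ_ne_zero _), h.steps, h.bound, h.test,
      h.res, h.s_le⟩
  · rw [e]
    refine H.inv_enterOuter ?_ ?_
    · exact (hbound h1 _ (bestIdx_le _ _ _)).trans (budget_le_next _ _ _ _ _ _)
    -- A failed test excludes `σ_s ≥ α κ`, hence `s < sBar`.
    · refine H.lt_sBar (not_le.1 fun hle => ?_)
      exact H.not_testFails hle (hstep h1) (fun j hj =>
        (hbound h1 j (by omega)).trans (budget_le _ _ _ _ _ _)) h3
  · rw [e]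
    refine ⟨H.proxGrad_dom _ _ _, fun _ => ?_, fun j hj => hstep h1 j (Nat.lt_succ_iff.1 hj),
      fun j hj => hbound h1 j hj, fun j hj => ?_, fun j hj => ?_, h.s_le⟩
    · simp only [State.base, hpath']
    · simp only at hj
      rcases (Nat.lt_succ_iff.1 hj).lt_or_eq with hj | rfl
      · rw [testFails_congr (path' := st.path) fun i hi => hpath i (by omega)]
        exact h.test j hj
      · exact h3
    · simp only at hj
      simp only
      rw [hpath j (by omega)]
      rcases (Nat.lt_succ_iff.1 hj).lt_or_eq with hj | rfl
      · exact h.res j hj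
      · exact h2

theorem Setting.inv_run (N : ℕ) (h : (run P M q E ε S z0 ω N).out = none) :
    Inv P M q E z0 zProj κ ε (run P M q E ε S z0 ω N) := by
  induction N with
  | zero =>
    refine H.inv_enterOuter ?_ (Nat.zero_le _)
    simp [budget]
  | succ N ih => exact H.inv_step (ih (run_none_of_succ h)) h

/-- If `innerCount` proximal steps of one outer iteration were complete, then at the last of them
the test was passed with residual above `ε`, contradicting `RBar ρ^T ≤ ε`. -/
theorem Setting.t_lt {st : State n m} (h : Inv P M q E z0 zProj κ ε st) :
    st.t < innerCount q M.lamMin ζ r κ ε := by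
  by_contra! hcon
  obtain ⟨T, hT⟩ : ∃ T, innerCount q M.lamMin ζ r κ ε = T + 1 :=
    Nat.exists_eq_add_one.2 (innerCount_pos q M.lamMin ζ r κ ε)
  have hTt : T < st.t := by omega
  have h1 := h.res T hTt
  have h2 := H.E_le_of_test (h.steps 0 (by omega)) (h.steps T hTt)
    ((h.bound 0 (by omega)).trans (budget_le _ _ _ _ _ _))
    ((h.bound T hTt.le).trans (budget_le _ _ _ _ _ _)) (h.test T hTt)
  have h3 := H.RBar_mul_rho_le (t := T) hT.le
  linarith

/-- If no proximal step takes more than `K` inner iterations, then the algorithm terminates. -/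
theorem Setting.solvesWithin {K : ℕ} {T : ℝ → ℝ} (hT : MonotoneOn T (Set.Ioi 0))
    (hcost : ∀ s t zBar x ξ, P.g x ≠ ⊤ → (S.cost s t zBar x ξ : ℝ) ≤ T (q.sig s))
    (hT0 : 0 ≤ T (sigmaBar q κ)) {B : ℝ}
    (hB : (((sBar q κ + 1) * innerCount q M.lamMin ζ r κ ε * K : ℕ) : ℝ) * T (sigmaBar q κ) ≤ B)
    (hK : ∀ N, (run P M q E ε S z0 ω N).out = none → (run P M q E ε S z0 ω N).k < K) :
    SolvesWithin P M q E ε S z0 ω B := by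
  set nb := innerCount q M.lamMin ζ r κ ε
  have hops : ∀ N, ((run P M q E ε S z0 ω N).ops : ℝ) ≤ N * T (sigmaBar q κ) := by
    intro N
    induction N with
    | zero => simp [run, enterOuter]
    | succ N ih =>
      rw [run_succ]
      rcases step_ops (P := P) (M := M) (q := q) (E := E) (ε := ε) (S := S)
        (run P M q E ε S z0 ω N) (ω (run P M q E ε S z0 ω N).idx) with e | ⟨h, e⟩
      · rw [e]; push_cast; linarith
      · rw [e]
        have hi := H.inv_run N h
        have h1 := hcost (run P M q E ε S z0 ω N).s (run P M q E ε S z0 ω N).t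
          (run P M q E ε S z0 ω N).base (run P M q E ε S z0 ω N).x
          (ω (run P M q E ε S z0 ω N).idx) hi.dom
        have h3 := H.sig_le_sigmaBar hi.s_le
        have h2 := hT (Set.mem_Ioi.2 (q.sig_pos _))
          (Set.mem_Ioi.2 ((q.sig_pos (run P M q E ε S z0 ω N).s).trans_le h3)) h3
        rw [nextOps]
        push_cast
        linarith
  -- The quantity `(s * nb + t) * K + k` enumerates the counters in lexicographic order. It grows by
  -- at least one per step and stays below `Nmax`, so the machine must halt.
  have hrank : ∀ N, (run P M q E ε S z0 ω N).out = none →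
      N ≤ ((run P M q E ε S z0 ω N).s * nb + (run P M q E ε S z0 ω N).t) * K +
        (run P M q E ε S z0 ω N).k := by
    intro N
    induction N with
    | zero => intro _; exact Nat.zero_le _
    | succ N ih =>
      intro h
      have h0 := run_none_of_succ h
      have h1 := ih h0
      have h2 := hK N h0
      have h3 := H.t_lt (H.inv_run N h0)
      rw [run_succ] at h ⊢
      obtain ⟨-, ⟨-, e⟩ | ⟨-, -, -, e⟩ | ⟨-, -, -, e⟩⟩ := step_none_cases h
      · rw [e]
        simp only
        omega
      · rw [e]
        simp only [enterOuter]
        have : ((run P M q E ε S z0 ω N).s * nb + (run P M q E ε S z0 ω N).t + 1) * K ≤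
            (((run P M q E ε S z0 ω N).s + 1) * nb + 0) * K := by
          apply Nat.mul_le_mul_right
          rw [add_mul]
          omega
        rw [add_mul _ 1 K, one_mul] at this
        omega
      · rw [e]
        simp only
        have : ((run P M q E ε S z0 ω N).s * nb + ((run P M q E ε S z0 ω N).t + 1)) * K =
          ((run P M q E ε S z0 ω N).s * nb + (run P M q E ε S z0 ω N).t) * K + K := by ring
        omega
  set Nmax := (sBar q κ + 1) * nb * K
  have hterm : (run P M q E ε S z0 ω Nmax).out ≠ none := by
    intro h
    have h1 := hrank _ h
    have h2 := hK _ h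
    have hi := H.inv_run _ h
    have h3 := H.t_lt hi
    have h4 := hi.s_le
    have h5 : ((run P M q E ε S z0 ω Nmax).s * nb + (run P M q E ε S z0 ω Nmax).t + 1) * K ≤
        (sBar q κ + 1) * nb * K := by
      apply Nat.mul_le_mul_right
      have := Nat.mul_le_mul_right nb (Nat.add_le_add_right h4 1)
      rw [add_mul, one_mul] at this
      omega
    rw [add_mul _ 1 K, one_mul] at h5
    omega
  obtain ⟨z, hz⟩ := Option.ne_none_iff_exists'.1 hterm
  exact ⟨Nmax, z, hz, run_out _ hz, (hops Nmax).trans hB⟩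

end Invariants

end AGPPA

end

/-! ### A failed stopping criterion forces a relatively large optimality gap. -/

noncomputable section

namespace AGPPA

variable {n m : ℕ} {P : Problem n m} {M : Preconditioner n m} {q : Params} {E : PD n m → ℝ}
  {ζ : ℝ} {z0 zProj : PD n m} {r κ ε : ℝ}

section NotStop

theorem gap_mono {σ : ℝ} {z : PD n m} {x y : Vec n} (h : objF P M σ z x ≤ objF P M σ z y) :
    gap P M σ z x ≤ gap P M σ z y :=
  EReal.toENNReal_le_toENNReal (EReal.sub_le_sub h le_rfl)

theorem Setting.lipL_mul_le (H : Setting P M q E ζ z0 zProj r κ ε) {s : ℕ} (hs : s ≤ sBar q κ) :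
    lipL P M (q.sig s) * q.sig s ≤ P.L₀ * sigmaBar q κ + cstA P M * sigmaBar q κ ^ 2 := by
  have h1 := H.sig_le_sigmaBar hs
  have h2 := q.sig_pos s
  have h3 := P.L₀_nonneg
  have h4 := M.lamMinL_pos H.hm
  have h5 : 0 ≤ cstA P M := by unfold cstA; positivity
  have e : lipL P M (q.sig s) * q.sig s = P.L₀ * q.sig s + cstA P M * q.sig s ^ 2 := by
    rw [lipL, cstA]; ring
  rw [e]
  gcongr

theorem Setting.etaBar_le (_H : Setting P M q E ζ z0 zProj r κ ε) {s t : ℕ} (hs : s ≤ sBar q κ)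
    (ht : t < innerCount q M.lamMin ζ r κ ε) : etaBar q M.lamMin ζ r κ ε ≤ q.eta s t := by
  rw [etaBar, Params.eta]
  have h1 := q.η₀_pos
  have h2 := q.ϱη_pos
  have h3 : q.ϱη ^ sBar q κ ≤ q.ϱη ^ s := pow_le_pow_of_le_one h2.le q.ϱη_lt_one.le hs
  have h4 : (innerCount q M.lamMin ζ r κ ε : ℝ) ^ (-q.ς) ≤ (1 + (t : ℝ)) ^ (-q.ς) := by
    refine Real.rpow_le_rpow_of_nonpos (by positivity) ?_ (by have := q.one_lt_ς; linarith)
    have : t + 1 ≤ innerCount q M.lamMin ζ r κ ε := ht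
    have : ((t + 1 : ℕ) : ℝ) ≤ innerCount q M.lamMin ζ r κ ε := Nat.cast_le.2 this
    push_cast at this
    linarith
  gcongr

theorem etaBar_pos (q : Params) (μ ζ r κ ε : ℝ) : 0 < etaBar q μ ζ r κ ε := by
  have h1 := q.η₀_pos
  have h2 := q.ϱη_pos
  have h3 : (0 : ℝ) < innerCount q μ ζ r κ ε := Nat.cast_pos.2 (innerCount_pos q μ ζ r κ ε)
  rw [etaBar]
  positivity

/-- If the inner algorithm does not stop after an iteration, then the optimality gap before the
proximal gradient step is not small compared with the initial one. -/
theorem Setting.gap_base_le_of_not_stopCrit (H : Setting P M q E ζ z0 zProj r κ ε) {s t : ℕ}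
    (hs : s ≤ sBar q κ) (ht : t < innerCount q M.lamMin ζ r κ ε) {z : PD n m}
    (hz : normM M (z - zProj) ≤ radM M q z0 zProj) {y : Vec n} (hy : P.g y ≠ ⊤) {p : ℝ}
    (hp : 0 < p)
    (hcrit : ¬ stopCrit P M (q.sig s) (q.eta s t) q.δ z (proxGrad P M (q.sig s) z y)) :
    0 < gap P M (q.sig s) z y ∧ gap P M (q.sig s) z (proxGrad P M (q.sig s) z z.fst) ≤
      ENNReal.ofReal (2 * p * max (zetaBar₁ P M q ζ r κ ε p) (zetaBar₂ P M q κ p)) *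
        gap P M (q.sig s) z y := by
  have hn := H.hn
  have hm := H.hm
  have hσ := q.sig_pos s
  have hL := H.lipL_pos hσ
  have hLσ := H.lipL_mul_le hs
  have hη := H.etaBar_le hs ht
  have hη0 := etaBar_pos q M.lamMin ζ r κ ε
  have hβ := H.normM_sub_wStar_le hσ hz
  set σ := q.sig s
  set η := q.eta s t
  set ηb := etaBar q M.lamMin ζ r κ ε with hηb
  set L := lipL P M σ
  set Q := P.L₀ * sigmaBar q κ + cstA P M * sigmaBar q κ ^ 2 with hQ
  set w := liftPt P M σ z (proxGrad P M σ z y)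
  set β := normM M (z - wStar P M σ z)
  obtain ⟨v, hv, hvg⟩ := exists_subgrad_sq_le P M hn hm hσ hL z hy
  set g := valF P M σ z y - valF P M σ z (xStar P M σ z) with hg
  have hlam := M.lamMinX_pos hn
  have hμ := H.lamMin_pos
  have hδ := q.δ_pos
  have hsl : 0 < √M.lamMinX := Real.sqrt_pos.2 hlam
  have hmin0 : 0 ≤ min η (q.δ * normM M (w - z)) :=
    le_min (q.eta_pos s t).le (mul_nonneg hδ.le (normM_nonneg _ _))
  have h1 : √M.lamMinX / σ * min η (q.δ * normM M (w - z)) < ‖v‖ := by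
    have h2 : ENNReal.ofReal (√M.lamMinX / σ * min η (q.δ * normM M (w - z))) < edist 0 v :=
      (not_le.1 hcrit).trans_le (Metric.infEDist_le_edist_of_mem hv)
    rw [edist_dist, dist_zero_left, ENNReal.ofReal_lt_ofReal_iff_of_nonneg] at h2
    · exact h2
    · positivity
  have hv0 : 0 < ‖v‖ := lt_of_le_of_lt (by positivity) h1
  have hg0 : 0 < g := by
    have : 0 < 8 * L * g := lt_of_lt_of_le (pow_pos hv0 2) hvg
    exact pos_of_mul_pos_right this (by positivity)
  have hgap : gap P M σ z y = ENNReal.ofReal g := gap_eq P M hn hm hσ z hy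
  -- The initial gap is at most `(L/2) e²`, where `e` is the primal displacement; `β` bounds `e`
  -- both absolutely, by `r`, and relatively to the displacement in the criterion.
  have he1 : √M.lamMin * ‖xStar P M σ z - z.fst‖ ≤ β := by
    have h2 := sqrt_lamMin_mul_norm_le M hμ.le (z - wStar P M σ z)
    refine le_trans (mul_le_mul_of_nonneg_left ?_ (Real.sqrt_nonneg _)) h2
    rw [norm_sub_rev]
    have h3 := norm_sq_PD (z - wStar P M σ z)
    exact le_of_sq_le_sq (by
      rw [h3]
      have e : (z - wStar P M σ z).fst = z.fst - xStar P M σ z := rfl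
      rw [e]
      linarith [sq_nonneg ‖(z - wStar P M σ z).snd‖]) (norm_nonneg _)
  have he2 : ‖xStar P M σ z - z.fst‖ ≤ r := le_of_mul_le_mul_left (he1.trans hβ) H.sqrt_pos
  have he3 : M.lamMin * ‖xStar P M σ z - z.fst‖ ^ 2 ≤ β ^ 2 := by
    have := pow_le_pow_left₀ (by positivity) he1 2
    rwa [mul_pow, Real.sq_sqrt hμ.le] at this
  set e := ‖xStar P M σ z - z.fst‖
  have he0 : 0 ≤ e := norm_nonneg _
  have hQL : (L * σ) ^ 2 ≤ Q ^ 2 := pow_le_pow_left₀ (by positivity) hLσ 2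
  refine ⟨by rw [hgap]; exact ENNReal.ofReal_pos.2 hg0, ?_⟩
  refine (gap_proxGrad_base_le P M hn hm hσ hL z).trans ?_
  rw [hgap, ← ENNReal.ofReal_mul' hg0.le]
  refine ENNReal.ofReal_le_ofReal ?_
  change L / 2 * e ^ 2 ≤ _
  rw [div_mul_eq_mul_div, div_lt_iff₀ hσ] at h1
  -- If the absolute tolerance is active, then `e ≤ r` leads to `zetaBar₁`; if the relative one is
  -- active, `β` appears on both sides and leads to `zetaBar₂` without `r` and `η`.
  rcases le_total η (q.δ * normM M (w - z)) with hle | hle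
  · rw [min_eq_left hle] at h1
    have h2 : (√M.lamMinX * η) ^ 2 ≤ (‖v‖ * σ) ^ 2 :=
      pow_le_pow_left₀ (mul_nonneg hsl.le (q.eta_pos s t).le) h1.le 2
    rw [mul_pow, Real.sq_sqrt hlam.le] at h2
    have h3 : M.lamMinX * ηb ^ 2 ≤ 8 * L * g * σ ^ 2 := by
      calc M.lamMinX * ηb ^ 2 ≤ M.lamMinX * η ^ 2 := by gcongr
        _ ≤ ‖v‖ ^ 2 * σ ^ 2 := by rw [← mul_pow ‖v‖]; exact h2
        _ ≤ _ := by gcongr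
    have h4 : L / 2 * e ^ 2 ≤ 2 * p * zetaBar₁ P M q ζ r κ ε p * g := by
      rw [zetaBar₁, ← hQ, ← hηb]
      have e1 : 2 * p * (2 * Q ^ 2 * r ^ 2 / (p * ηb ^ 2 * M.lamMinX)) * g =
          4 * Q ^ 2 * r ^ 2 * g / (ηb ^ 2 * M.lamMinX) := by field_simp; ring
      rw [e1, le_div_iff₀ (by positivity)]
      calc L / 2 * e ^ 2 * (ηb ^ 2 * M.lamMinX) = L / 2 * e ^ 2 * (M.lamMinX * ηb ^ 2) := by ring
        _ ≤ L / 2 * r ^ 2 * (8 * L * g * σ ^ 2) := by gcongr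
        _ = 4 * (L * σ) ^ 2 * r ^ 2 * g := by ring
        _ ≤ 4 * Q ^ 2 * r ^ 2 * g := by gcongr
    refine h4.trans ?_
    gcongr
    exact le_max_left _ _
  · rw [min_eq_right hle] at h1
    have h2 := normM_liftPt_sub_wStar_le P M hn hm hσ hv
    have h3 := normM_sub_le M z w (wStar P M σ z)
    rw [normM_sub_comm M z w] at h3
    -- The exact displacement is at most the computed one plus the error bound `σ ‖v‖ / √λ_min(Mx)`.
    -- As `‖v‖` dominates `δ` times the computed displacement, the factor `1 + δ` results.
    have h4 : √M.lamMinX * β ≤ √M.lamMinX * normM M (w - z) + σ * ‖v‖ := by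
      have h5 := mul_le_mul_of_nonneg_left (h3.trans (add_le_add_right h2 _)) hsl.le
      have e1 : √M.lamMinX * (normM M (w - z) + σ / √M.lamMinX * ‖v‖) =
          √M.lamMinX * normM M (w - z) + σ * ‖v‖ := by field_simp
      rwa [e1] at h5
    have h5 : √M.lamMinX * (q.δ * β) ≤ (1 + q.δ) * (‖v‖ * σ) := by
      have := mul_le_mul_of_nonneg_left h4 hδ.le
      linarith
    have hβ0 : 0 ≤ β := normM_nonneg _ _
    have h6 := pow_le_pow_left₀ (by positivity) h5 2
    rw [mul_pow, Real.sq_sqrt hlam.le] at h6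
    have h7 : M.lamMinX * (q.δ * β) ^ 2 ≤ (1 + q.δ) ^ 2 * (8 * L * g * σ ^ 2) := by
      refine h6.trans ?_
      rw [mul_pow, mul_pow]
      gcongr
    have h8 : L / 2 * e ^ 2 ≤ 2 * p * zetaBar₂ P M q κ p * g := by
      rw [zetaBar₂, ← hQ]
      have e1 : 2 * p * (2 * (1 + q.δ) ^ 2 * Q ^ 2 / (p * q.δ ^ 2 * M.lamMinX * M.lamMin)) * g =
          4 * (1 + q.δ) ^ 2 * Q ^ 2 * g / (q.δ ^ 2 * M.lamMinX * M.lamMin) := by field_simp; ring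
      rw [e1, le_div_iff₀ (by positivity)]
      calc L / 2 * e ^ 2 * (q.δ ^ 2 * M.lamMinX * M.lamMin)
          = L / 2 * (q.δ ^ 2 * M.lamMinX) * (M.lamMin * e ^ 2) := by ring
        _ ≤ L / 2 * (q.δ ^ 2 * M.lamMinX) * β ^ 2 := by gcongr
        _ = L / 2 * (M.lamMinX * (q.δ * β) ^ 2) := by ring
        _ ≤ L / 2 * ((1 + q.δ) ^ 2 * (8 * L * g * σ ^ 2)) := by gcongr
        _ = 4 * (1 + q.δ) ^ 2 * (L * σ) ^ 2 * g := by ring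
        _ ≤ 4 * (1 + q.δ) ^ 2 * Q ^ 2 * g := by gcongr
    refine h8.trans ?_
    gcongr
    exact le_max_right _ _

end NotStop

end AGPPA

end

/-! ### Measurability of the run in the random choices. -/

noncomputable section

namespace AGPPA

section Countable

variable {α β γ : Type*} [MeasurableSpace α] [MeasurableSpace β] [MeasurableSpace γ]

/-- Counters take countably many values, so measurability can be checked for fixed counters. -/
theorem measurable_nat_family {f : ℕ → β → γ} (hf : ∀ k, Measurable (f k)) {g : α → ℕ}
    (hg : Measurable g) {h : α → β} (hh : Measurable h) : Measurable fun a => f (g a) (h a) :=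
  (measurable_from_prod_countable_right (f := fun p : ℕ × β => f p.1 p.2) hf).comp (hg.prodMk hh)

theorem measurableSet_nat_family {p : ℕ → β → Prop} (hp : ∀ k, MeasurableSet {b | p k b})
    {g : α → ℕ} (hg : Measurable g) {h : α → β} (hh : Measurable h) :
    MeasurableSet {a | p (g a) (h a)} := by
  have e : {a | p (g a) (h a)} = ⋃ k, g ⁻¹' {k} ∩ h ⁻¹' {b | p k b} := by
    ext a
    simp
  rw [e]
  exact MeasurableSet.iUnion fun k => (hg (measurableSet_singleton k)).inter (hh (hp k))

end Countable

variable {n m : ℕ} {P : Problem n m} {M : Preconditioner n m} {q : Params} {E : PD n m → ℝ}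
  {ζ : ℝ} {z0 zProj : PD n m} {r κ ε : ℝ} {σ : ℝ}

section InnerProblem

theorem measurable_objF (hm : 0 < m) (hσ : 0 < σ) :
    Measurable fun w : PD n m × Vec n => objF P M σ w.1 w.2 := by
  simp only [objF_eq P M hm hσ]
  exact (P.g_pcc.lsc.measurable.comp measurable_snd).add
    (continuous_smoothF P M hm hσ).measurable.coe_real_ereal

theorem measurable_gap (hn : 0 < n) (hm : 0 < m) (hσ : 0 < σ) (hM : 0 < M.lamMin) :
    Measurable fun w : PD n m × Vec n => gap P M σ w.1 w.2 := by
  unfold gap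
  simp only [iInf_objF P M hn hm hσ]
  have h1 : Measurable fun w : PD n m × Vec n => xStar P M σ w.1 :=
    (continuous_xStar P M hn hm hσ hM).measurable.comp measurable_fst
  have h3 := (P.g_pcc.lsc.measurable.comp h1).ereal_toReal
  have h4 := (continuous_smoothF P M hm hσ).measurable.comp (measurable_fst.prodMk h1)
  have h2 := (h3.add h4).neg.coe_real_ereal
  have h5 := ((measurable_objF (P := P) (M := M) hm hσ).add h2).ereal_toENNReal
  simp only [sub_eq_add_neg, ← EReal.coe_neg]
  exact h5

theorem continuous_liftPt (hm : 0 < m) (hσ : 0 < σ) :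
    Continuous fun w : PD n m × Vec n => liftPt P M σ w.1 w.2 := by
  simp only [liftPt, Lam_eq P M hm hσ]
  have h3 : Continuous fun w : PD n m × Vec n => (w.1.snd, P.A w.2) :=
    (continuous_snd_PD.comp continuous_fst).prodMk (P.A.continuous.comp continuous_snd)
  have h4 := (continuous_dualPt P M hm hσ).comp h3
  exact continuous_pair continuous_snd h4

theorem continuous_gradF (hm : 0 < m) (hσ : 0 < σ) :
    Continuous fun w : PD n m × Vec n => gradF P M σ w.1 w.2 := by
  have h1 : Continuous fun w : PD n m × Vec n => (w.1.snd, w.2) :=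
    (continuous_snd_PD.comp continuous_fst).prodMk continuous_snd
  have h2 : Continuous fun w : PD n m × Vec n => w.2 - w.1.fst :=
    continuous_snd.sub (continuous_fst_PD.comp continuous_fst)
  exact ((continuous_gradS P M hm hσ).comp h1).add ((wt M.Mx σ).continuous.comp h2)

/-- The subdifferential of the inner objective has a closed graph. -/
theorem isClosed_subdiff_objF (hn : 0 < n) (hm : 0 < m) (hσ : 0 < σ) :
    IsClosed {w : (PD n m × Vec n) × Vec n | w.2 ∈ subdiff (objF P M σ w.1.1) w.1.2} := by
  have e : {w : (PD n m × Vec n) × Vec n | w.2 ∈ subdiff (objF P M σ w.1.1) w.1.2} =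
      ⋂ y : {y : Vec n // P.g y ≠ ⊤}, {w | P.g w.1.2 ≤
        (((P.g y).toReal - ⟪w.2 - gradF P M σ w.1.1 w.1.2, (y : Vec n) - w.1.2⟫ : ℝ) : EReal)} := by
    ext ⟨⟨z, x⟩, v⟩
    simp only [Set.mem_ofPred_eq, Set.mem_iInter, mem_subdiff_objF_iff P M hn hm hσ, Subtype.forall]
    constructor
    · rintro ⟨hx, h⟩ y hy
      rw [← P.g_pcc.coe_toReal hx, EReal.coe_le_coe_iff]
      linarith [h y hy]
    · intro h
      have hx : P.g x ≠ ⊤ := by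
        obtain ⟨y, hy⟩ := P.g_pcc.exists_finite
        exact ne_top_of_le_ne_top (EReal.coe_ne_top _) (h y hy)
      refine ⟨hx, fun y hy => ?_⟩
      have := h y hy
      rw [← P.g_pcc.coe_toReal hx, EReal.coe_le_coe_iff] at this
      linarith
  rw [e]
  refine isClosed_iInter fun y => ?_
  have h1 : Continuous fun w : (PD n m × Vec n) × Vec n => gradF P M σ w.1.1 w.1.2 :=
    (continuous_gradF hm hσ).comp continuous_fst
  have h2 : Continuous fun w : (PD n m × Vec n) × Vec n =>
      (P.g y).toReal - ⟪w.2 - gradF P M σ w.1.1 w.1.2, (y : Vec n) - w.1.2⟫ :=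
    continuous_const.sub ((continuous_snd.sub h1).inner
      (continuous_const.sub (continuous_snd.comp continuous_fst)))
  exact P.g_pcc.lsc.isClosed_epigraph.preimage
    ((continuous_snd.comp continuous_fst).prodMk (continuous_coe_real_ereal.comp h2))

/-- Projection along a compact ball is a closed map. Applied to the closed graph of `∂F`, it makes
the strict sublevel sets of `x ↦ dist(0, ∂F(x))` countable unions of closed sets, with rational
radii, so no measurable selection is needed. -/
theorem isClosed_exists_norm_le {X : Type*} [TopologicalSpace X] {k : ℕ} {C : Set (X × Vec k)}
    (hC : IsClosed C) (τ : ℝ) : IsClosed {w : X | ∃ v, (w, v) ∈ C ∧ ‖v‖ ≤ τ} := by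
  have : CompactSpace (Metric.closedBall (0 : Vec k) τ) :=
    isCompact_iff_compactSpace.1 (isCompact_closedBall _ _)
  have h1 : IsClosed {p : X × Metric.closedBall (0 : Vec k) τ | (p.1, (p.2 : Vec k)) ∈ C} :=
    hC.preimage (continuous_fst.prodMk (continuous_subtype_val.comp continuous_snd))
  convert isClosedMap_fst_of_compactSpace _ h1 using 1
  ext w
  simp only [Set.mem_ofPred_eq, Set.mem_image, Prod.exists, Subtype.exists, mem_closedBall_zero_iff,
    exists_and_right, exists_eq_right, exists_prop]
  exact exists_congr fun v => by tauto

theorem measurable_infEDist_subdiff (hn : 0 < n) (hm : 0 < m) (hσ : 0 < σ) :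
    Measurable fun w : PD n m × Vec n => Metric.infEDist 0 (subdiff (objF P M σ w.1) w.2) := by
  refine measurable_of_Iio fun c => ?_
  have e : (fun w : PD n m × Vec n => Metric.infEDist 0 (subdiff (objF P M σ w.1) w.2)) ⁻¹'
      Set.Iio c = ⋃ (τ : ℚ) (_ : ((τ : ℝ).toNNReal : ℝ≥0∞) < c),
        {w | ∃ v, (w, v) ∈ {w : (PD n m × Vec n) × Vec n | w.2 ∈ subdiff (objF P M σ w.1.1) w.1.2}
          ∧ ‖v‖ ≤ ((τ : ℝ).toNNReal : ℝ)} := by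
    ext w
    simp only [Set.mem_preimage, Set.mem_Iio, Metric.infEDist_lt_iff, Set.mem_iUnion,
      Set.mem_ofPred_eq, exists_prop]
    constructor
    · rintro ⟨v, hv, h⟩
      obtain ⟨τ, -, h1, h2⟩ := ENNReal.lt_iff_exists_rat_btwn.1 h
      refine ⟨τ, h2, v, hv, ?_⟩
      rw [edist_dist, dist_zero_left, ENNReal.ofReal_lt_coe_iff (norm_nonneg _)] at h1
      exact h1.le
    · rintro ⟨τ, h2, v, hv, h⟩
      refine ⟨v, hv, lt_of_le_of_lt ?_ h2⟩
      rw [edist_dist, dist_zero_left]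
      exact ENNReal.ofReal_le_of_le_toReal h
  rw [e]
  exact MeasurableSet.iUnion fun τ => MeasurableSet.iUnion fun _ =>
    (isClosed_exists_norm_le (isClosed_subdiff_objF hn hm hσ) _).measurableSet

theorem measurableSet_stopCrit (hn : 0 < n) (hm : 0 < m) (hσ : 0 < σ) (η δ : ℝ) :
    MeasurableSet {w : PD n m × Vec n | stopCrit P M σ η δ w.1 w.2} := by
  refine measurableSet_le (measurable_infEDist_subdiff hn hm hσ) (ENNReal.measurable_ofReal.comp ?_)
  have h1 : Continuous fun w : PD n m × Vec n => normM M (liftPt P M σ w.1 w.2 - w.1) :=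
    (continuous_normM M).comp ((continuous_liftPt hm hσ).sub continuous_fst)
  exact (continuous_const.mul (continuous_const.min (continuous_const.mul h1))).measurable

end InnerProblem

section Path

theorem measurableSet_testFails (M : Preconditioner n m) (q : Params) (t : ℕ) :
    MeasurableSet {path : ℕ → PD n m | testFails M q path t} := by
  have e : {path : ℕ → PD n m | testFails M q path t} = ⋃ (j : ℕ) (_ : j ≤ t),
      {path | q.testC * (q.rho ^ (t - j) * normM M (path (j + 1) - path j)) <
        normM M (path (t + 1) - path t)} := by
    ext path
    simp [testFails]
  rw [e]
  have h : ∀ j, Measurable fun path : ℕ → PD n m => normM M (path (j + 1) - path j) := fun j =>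
    (continuous_normM M).measurable.comp ((measurable_pi_apply (j + 1)).sub (measurable_pi_apply j))
  exact MeasurableSet.iUnion fun j => MeasurableSet.iUnion fun _ =>
    measurableSet_lt (((h j).const_mul _).const_mul _) (h t)

theorem measurable_bestIdx (hE : Measurable E) (N : ℕ) :
    Measurable fun path : ℕ → PD n m => bestIdx E path N := by
  classical
  have hne : ∀ path : ℕ → PD n m, ∃ j, j ≤ N ∧ ∀ i ≤ N, E (path j) ≤ E (path i) := by
    intro path
    obtain ⟨j, hj, hmin⟩ := (Finset.range (N + 1)).exists_min_image (fun j => E (path j))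
      ⟨0, by simp⟩
    exact ⟨j, by simpa [Nat.lt_succ_iff] using hj, fun i hi =>
      hmin i (by simpa [Nat.lt_succ_iff] using hi)⟩
  have e : (fun path : ℕ → PD n m => bestIdx E path N) = fun path => Nat.find (hne path) := by
    funext path
    refine ((Nat.find_eq_iff (hne path)).2 ⟨Nat.sInf_mem (hne path), fun k hk hk' => ?_⟩).symm
    exact Nat.notMem_of_lt_sInf hk hk'
  rw [e]
  refine measurable_find _ fun j => ?_
  have hEj : ∀ i, Measurable fun path : ℕ → PD n m => E (path i) := fun i =>
    hE.comp (measurable_pi_apply i)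
  have e2 : {path : ℕ → PD n m | j ≤ N ∧ ∀ i ≤ N, E (path j) ≤ E (path i)} =
      {path | j ≤ N} ∩ ⋂ (i : ℕ) (_ : i ≤ N), {path | E (path j) ≤ E (path i)} := by
    ext path
    simp
  rw [e2]
  exact (MeasurableSet.const _).inter (MeasurableSet.iInter fun i => MeasurableSet.iInter fun _ =>
    measurableSet_le (hEj j) (hEj i))

end Path

/-- The part of the state that evolves measurably. -/
def State.code (st : State n m) : (ℕ × ℕ × ℕ) × (ℕ → PD n m) × Vec n × Bool :=
  (st.idx, st.path, st.x, st.out.isSome)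

/-- The operation count is left out, since the cost of the solver is not assumed measurable; it is
bounded path by path. Of the output, only its presence influences the evolution. -/
instance : MeasurableSpace (State n m) := MeasurableSpace.comap State.code inferInstance

theorem measurable_code : Measurable (State.code : State n m → _) := comap_measurable _

theorem measurable_idx : Measurable (State.idx : State n m → _) := measurable_code.fst
theorem measurable_s : Measurable (State.s : State n m → ℕ) := measurable_idx.fst
theorem measurable_t : Measurable (State.t : State n m → ℕ) := measurable_idx.snd.fst
theorem measurable_k : Measurable (State.k : State n m → ℕ) := measurable_idx.snd.snd
theorem measurable_path : Measurable (State.path : State n m → _) := measurable_code.snd.fst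
theorem measurable_x : Measurable (State.x : State n m → _) := measurable_code.snd.snd.fst
theorem measurable_isSome : Measurable fun st : State n m => st.out.isSome :=
  measurable_code.snd.snd.snd

theorem measurable_base : Measurable (State.base : State n m → _) :=
  measurable_nat_family (f := fun t (path : ℕ → PD n m) => path t) (fun t => measurable_pi_apply t)
    measurable_t measurable_path

theorem measurableSet_out_none : MeasurableSet {st : State n m | st.out = none} := by
  have e : {st : State n m | st.out = none} = (fun st => st.out.isSome) ⁻¹' {false} := by
    ext st
    simp
  rw [e]
  exact measurable_isSome (measurableSet_singleton _)

theorem measurable_state {α : Type*} [MeasurableSpace α] {f : α → State n m}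
    (hs : Measurable fun a => (f a).s) (ht : Measurable fun a => (f a).t)
    (hk : Measurable fun a => (f a).k) (hp : Measurable fun a => (f a).path)
    (hx : Measurable fun a => (f a).x) (ho : Measurable fun a => (f a).out.isSome) :
    Measurable f :=
  measurable_comap_iff.2 ((hs.prodMk (ht.prodMk hk)).prodMk (hp.prodMk (hx.prodMk ho)))

section Step

variable {Ξ : Type*} [MeasurableSpace Ξ] {S : InnerSolver n m Ξ} {α : Type*} [MeasurableSpace α]

theorem Setting.measurable_proxGrad (H : Setting P M q E ζ z0 zProj r κ ε) {s : α → ℕ}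
    {z : α → PD n m} {x : α → Vec n} (hs : Measurable s) (hz : Measurable z) (hx : Measurable x) :
    Measurable fun a => proxGrad P M (q.sig (s a)) (z a) (x a) := by
  have h1 : ∀ s, Measurable ((fun s (w : PD n m × Vec n) => proxGrad P M (q.sig s) w.1 w.2) s) :=
    fun s => (continuous_proxGrad P M H.hn H.hm (q.sig_pos s)
      (H.lipL_pos (q.sig_pos s))).measurable
  have h2 := measurable_nat_family h1 hs (hz.prodMk hx)
  exact h2

theorem Setting.measurable_objF (H : Setting P M q E ζ z0 zProj r κ ε) {s : α → ℕ}
    {z : α → PD n m} {x : α → Vec n} (hs : Measurable s) (hz : Measurable z) (hx : Measurable x) :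
    Measurable fun a => objF P M (q.sig (s a)) (z a) (x a) := by
  have h1 : ∀ s, Measurable ((fun s (w : PD n m × Vec n) => objF P M (q.sig s) w.1 w.2) s) :=
    fun s => AGPPA.measurable_objF H.hm (q.sig_pos s)
  have h2 := measurable_nat_family h1 hs (hz.prodMk hx)
  exact h2

theorem Setting.measurable_gap (H : Setting P M q E ζ z0 zProj r κ ε) {s : α → ℕ}
    {z : α → PD n m} {x : α → Vec n} (hs : Measurable s) (hz : Measurable z) (hx : Measurable x) :
    Measurable fun a => gap P M (q.sig (s a)) (z a) (x a) := by
  have h1 : ∀ s, Measurable ((fun s (w : PD n m × Vec n) => gap P M (q.sig s) w.1 w.2) s) :=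
    fun s => AGPPA.measurable_gap H.hn H.hm (q.sig_pos s) H.lamMin_pos
  have h2 := measurable_nat_family h1 hs (hz.prodMk hx)
  exact h2

theorem Setting.measurable_liftPt (H : Setting P M q E ζ z0 zProj r κ ε) {s : α → ℕ}
    {z : α → PD n m} {x : α → Vec n} (hs : Measurable s) (hz : Measurable z) (hx : Measurable x) :
    Measurable fun a => liftPt P M (q.sig (s a)) (z a) (x a) := by
  have h1 : ∀ s, Measurable ((fun s (w : PD n m × Vec n) => liftPt P M (q.sig s) w.1 w.2) s) :=
    fun s => (continuous_liftPt H.hm (q.sig_pos s)).measurable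
  have h2 := measurable_nat_family h1 hs (hz.prodMk hx)
  exact h2

theorem Setting.measurableSet_stopCrit (H : Setting P M q E ζ z0 zProj r κ ε) {s t : α → ℕ}
    {z : α → PD n m} {x : α → Vec n} (hs : Measurable s) (ht : Measurable t) (hz : Measurable z)
    (hx : Measurable x) :
    MeasurableSet {a | stopCrit P M (q.sig (s a)) (q.eta (s a) (t a)) q.δ (z a) (x a)} := by
  have h1 : ∀ s t, MeasurableSet {w | (fun t (w : PD n m × Vec n) =>
      stopCrit P M (q.sig s) (q.eta s t) q.δ w.1 w.2) t w} :=
    fun s t => AGPPA.measurableSet_stopCrit H.hn H.hm (q.sig_pos s) _ _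
  have h2 : ∀ s, MeasurableSet {w | (fun s (w : ℕ × PD n m × Vec n) =>
      stopCrit P M (q.sig s) (q.eta s w.1) q.δ w.2.1 w.2.2) s w} :=
    fun s => measurableSet_nat_family (h1 s) measurable_fst measurable_snd
  have h3 := measurableSet_nat_family h2 hs (ht.prodMk (hz.prodMk hx))
  exact h3

theorem measurable_fst_PD : Measurable fun z : PD n m => z.fst := continuous_fst_PD.measurable

theorem Setting.measurable_enterOuter (H : Setting P M q E ζ z0 zProj r κ ε) {s : α → ℕ}
    {z : α → PD n m} {ops : α → ℕ} (hs : Measurable s) (hz : Measurable z) :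
    Measurable fun a => enterOuter P M q E ε (s a) (z a) (ops a) := by
  refine measurable_state hs measurable_const measurable_const (measurable_pi_lambda _ fun _ => hz)
    ?_ ?_
  · exact H.measurable_proxGrad hs hz (measurable_fst_PD.comp hz)
  · have e : (fun a => (enterOuter P M q E ε (s a) (z a) (ops a)).out.isSome) =
        fun a => decide (E (z a) ≤ ε) := by
      funext a
      unfold enterOuter
      simp only
      split_ifs with h <;> simp [h]
    rw [e]
    exact (measurable_to_bool (by
      convert measurableSet_le (H.measurable_E.comp hz) (measurable_const (a := ε)) using 1
      ext a
      simp))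

variable (hS : ∀ s t, Measurable fun w : PD n m × Vec n × Ξ => S.solve s t w.1 w.2.1 w.2.2)
include hS

theorem measurable_solved : Measurable fun w : State n m × Ξ => solved S w.1 w.2 := by
  have h1 : Measurable fun w : State n m × Ξ => (w.1.base, w.1.x, w.2) :=
    (measurable_base.comp measurable_fst).prodMk
      ((measurable_x.comp measurable_fst).prodMk measurable_snd)
  exact measurable_nat_family (f := fun s (w : ℕ × PD n m × Vec n × Ξ) =>
      S.solve s w.1 w.2.1 w.2.2.1 w.2.2.2)
    (fun s => measurable_nat_family (f := fun t (w : PD n m × Vec n × Ξ) =>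
      S.solve s t w.1 w.2.1 w.2.2) (hS s) measurable_fst measurable_snd)
    (measurable_s.comp measurable_fst) ((measurable_t.comp measurable_fst).prodMk h1)

variable (H : Setting P M q E ζ z0 zProj r κ ε)
include H

theorem Setting.measurable_nextY : Measurable fun w : State n m × Ξ => nextY P M q S w.1 w.2 := by
  have hb : Measurable fun w : State n m × Ξ => w.1.base := measurable_base.comp measurable_fst
  have hs : Measurable fun w : State n m × Ξ => w.1.s := measurable_s.comp measurable_fst
  have hx : Measurable fun w : State n m × Ξ => w.1.x := measurable_x.comp measurable_fst
  exact Measurable.ite (measurableSet_lt (H.measurable_objF hs hb hx)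
    (H.measurable_objF hs hb (measurable_solved hS))) hx (measurable_solved hS)

theorem Setting.measurable_nextX : Measurable fun w : State n m × Ξ => nextX P M q S w.1 w.2 :=
  H.measurable_proxGrad (measurable_s.comp measurable_fst) (measurable_base.comp measurable_fst)
    (H.measurable_nextY hS)

theorem Setting.measurable_nextZ : Measurable fun w : State n m × Ξ => nextZ P M q S w.1 w.2 := by
  have h1 : Measurable fun w : State n m × Ξ =>
      liftPt P M (q.sig w.1.s) w.1.base (nextX P M q S w.1 w.2) :=
    H.measurable_liftPt (measurable_s.comp measurable_fst) (measurable_base.comp measurable_fst)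
      (H.measurable_nextX hS)
  exact (h1.const_smul q.γ).add ((measurable_base.comp measurable_fst).const_smul (1 - q.γ))

theorem Setting.measurable_nextPath :
    Measurable fun w : State n m × Ξ => nextPath P M q S w.1 w.2 := by
  refine measurable_nat_family
    (f := fun t (w : (ℕ → PD n m) × PD n m) => Function.update w.1 (t + 1) w.2) (fun t => ?_)
    (measurable_t.comp measurable_fst)
    ((measurable_path.comp measurable_fst).prodMk (H.measurable_nextZ hS))
  refine measurable_pi_lambda _ fun j => ?_
  by_cases hj : j = t + 1
  · subst hj
    simpa using measurable_snd
  · simp only [Function.update_of_ne hj]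
    exact (measurable_pi_apply j).comp measurable_fst

theorem Setting.measurableSet_stops :
    MeasurableSet {w : State n m × Ξ | Stops P M q S w.1 w.2} :=
  H.measurableSet_stopCrit (measurable_s.comp measurable_fst) (measurable_t.comp measurable_fst)
    (measurable_base.comp measurable_fst) (H.measurable_nextX hS)

theorem Setting.measurable_step :
    Measurable fun w : State n m × Ξ => step P M q E ε S w.1 w.2 := by
  classical
  have hs : Measurable fun w : State n m × Ξ => w.1.s := measurable_s.comp measurable_fst
  have ht : Measurable fun w : State n m × Ξ => w.1.t := measurable_t.comp measurable_fst
  have hk : Measurable fun w : State n m × Ξ => w.1.k := measurable_k.comp measurable_fst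
  have hp : Measurable fun w : State n m × Ξ => w.1.path := measurable_path.comp measurable_fst
  have hx : Measurable fun w : State n m × Ξ => w.1.x := measurable_x.comp measurable_fst
  have hb : Measurable fun w : State n m × Ξ => w.1.base := measurable_base.comp measurable_fst
  have ho : Measurable fun w : State n m × Ξ => w.1.out.isSome :=
    measurable_isSome.comp measurable_fst
  have hZ := H.measurable_nextZ hS
  have hP := H.measurable_nextPath hS
  have e : (fun w : State n m × Ξ => step P M q E ε S w.1 w.2) = fun w =>
      if w.1.out = none then
        if Stops P M q S w.1 w.2 then
          if E w.1.base ≤ ε then { w.1 with ops := nextOps S w.1 w.2, out := some w.1.base }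
          else if testFails M q (nextPath P M q S w.1 w.2) w.1.t then
            enterOuter P M q E ε (w.1.s + 1) (nextPath P M q S w.1 w.2
              (bestIdx E (nextPath P M q S w.1 w.2) (w.1.t + 1))) (nextOps S w.1 w.2)
          else
            { s := w.1.s, t := w.1.t + 1, k := 0, path := nextPath P M q S w.1 w.2,
              x := proxGrad P M (q.sig w.1.s) (nextZ P M q S w.1 w.2) (nextZ P M q S w.1 w.2).fst,
              ops := nextOps S w.1 w.2, out := none }
        else { w.1 with k := w.1.k + 1, x := nextX P M q S w.1 w.2, ops := nextOps S w.1 w.2 }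
      else w.1 := by
    funext ⟨st, ξ⟩
    by_cases h : st.out = none
    · rw [if_pos h, step_of_none P M q E ε S h]
    · rw [if_neg h]
      obtain ⟨z, hz⟩ := Option.ne_none_iff_exists'.1 h
      exact step_of_some P M q E ε S hz ξ
  rw [e]
  refine Measurable.ite (measurable_fst measurableSet_out_none) ?_ measurable_fst
  refine Measurable.ite (H.measurableSet_stops hS) ?_ ?_
  · refine Measurable.ite (measurableSet_le (H.measurable_E.comp hb) measurable_const) ?_ ?_
    · exact measurable_state hs ht hk hp hx measurable_const
    refine Measurable.ite (measurableSet_nat_family (p := fun t path => testFails M q path t)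
      (measurableSet_testFails M q) ht hP) ?_ ?_
    · refine H.measurable_enterOuter (hs.add_const 1) ?_
      have h1 : Measurable fun w : State n m × Ξ =>
          bestIdx E (nextPath P M q S w.1 w.2) (w.1.t + 1) :=
        measurable_nat_family (f := fun t path => bestIdx E path (t + 1))
          (fun t => measurable_bestIdx H.measurable_E (t + 1)) ht hP
      exact measurable_nat_family (f := fun t (path : ℕ → PD n m) => path t)
        (fun t => measurable_pi_apply t) h1 hP
    · refine measurable_state hs (ht.add_const 1) measurable_const hP ?_ measurable_const
      exact H.measurable_proxGrad hs hZ (measurable_fst_PD.comp hZ)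
  · exact measurable_state hs ht (hk.add_const 1) hp (H.measurable_nextX hS) ho

/-- The state after `N` steps is a measurable function of the random choices. -/
theorem Setting.measurable_run (N : ℕ) :
    Measurable fun ω : ℕ × ℕ × ℕ → Ξ => run P M q E ε S z0 ω N := by
  induction N with
  | zero => exact H.measurable_enterOuter measurable_const measurable_const
  | succ N ih =>
    have h1 : Measurable fun ω : ℕ × ℕ × ℕ → Ξ => ω (run P M q E ε S z0 ω N).idx :=
      (measurable_from_prod_countable_right
        (f := fun p : (ℕ × ℕ × ℕ) × (ℕ × ℕ × ℕ → Ξ) => p.2 p.1)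
        (fun i => measurable_pi_apply i)).comp ((measurable_idx.comp ih).prodMk measurable_id)
    exact (H.measurable_step hS).comp (ih.prodMk h1)

end Step

end AGPPA

end

/-! ### Resampling, the tail of the proximal-step length, and the union bound. -/

noncomputable section

namespace AGPPA

section Resampling

variable {ι Ξ : Type*} [DecidableEq ι] [MeasurableSpace Ξ]

theorem measurable_update_prod (i : ι) :
    Measurable fun w : (ι → Ξ) × Ξ => Function.update w.1 i w.2 := by
  refine measurable_pi_lambda _ fun j => ?_
  by_cases hj : j = i
  · subst hj
    simpa using measurable_snd
  · simp only [Function.update_of_ne hj]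
    exact (measurable_pi_apply j).comp measurable_fst

variable (ν : Measure Ξ) [IsProbabilityMeasure ν]

/-- Resampling one coordinate does not change the law of an i.i.d. family. -/
theorem map_update_infinitePi (i : ι) :
    ((Measure.infinitePi fun _ : ι => ν).prod ν).map (fun w => Function.update w.1 i w.2) =
      Measure.infinitePi fun _ : ι => ν := by
  refine Measure.eq_infinitePi _ fun s t ht => ?_
  rw [Measure.map_apply (measurable_update_prod i)
    (MeasurableSet.pi s.countable_toSet fun j _ => ht j)]
  by_cases hi : i ∈ s
  · have e : (fun w : (ι → Ξ) × Ξ => Function.update w.1 i w.2) ⁻¹' Set.pi s t =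
        Set.pi (s.erase i : Finset ι) t ×ˢ t i := by
      ext ⟨ω, ξ⟩
      simp only [Set.mem_preimage, Set.mem_pi, Finset.mem_coe, Set.mem_prod, Finset.mem_erase]
      constructor
      · intro h
        refine ⟨fun j hj => ?_, ?_⟩
        · simpa [Function.update_of_ne hj.1] using h j hj.2
        · simpa using h i hi
      · rintro ⟨h1, h2⟩ j hj
        by_cases hji : j = i
        · subst hji
          simpa using h2
        · simpa [Function.update_of_ne hji] using h1 j ⟨hji, hj⟩
    rw [e, Measure.prod_prod, Measure.infinitePi_pi _ fun j _ => ht j, mul_comm,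
      Finset.mul_prod_erase s (fun j => ν (t j)) hi]
  · have e : (fun w : (ι → Ξ) × Ξ => Function.update w.1 i w.2) ⁻¹' Set.pi s t =
        Set.pi (s : Set ι) t ×ˢ Set.univ := by
      ext ⟨ω, ξ⟩
      simp only [Set.mem_preimage, Set.mem_pi, Finset.mem_coe, Set.mem_prod, Set.mem_univ, and_true]
      refine forall₂_congr fun j hj => ?_
      rw [Function.update_of_ne (ne_of_mem_of_not_mem hj hi)]
    rw [e, Measure.prod_prod, Measure.infinitePi_pi _ fun j _ => ht j, measure_univ, mul_one]

/-- Independence in the form needed: if `f` ignores coordinate `i` of its first argument, then `ω i`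
may be replaced by a fresh copy and integrated first. -/
theorem lintegral_infinitePi_resample {i : ι} {f : (ι → Ξ) → Ξ → ℝ≥0∞}
    (hf : Measurable (Function.uncurry f))
    (hi : ∀ ω ξ ξ', f (Function.update ω i ξ) ξ' = f ω ξ') :
    ∫⁻ ω, f ω (ω i) ∂(Measure.infinitePi fun _ : ι => ν) =
      ∫⁻ ω, ∫⁻ ξ, f ω ξ ∂ν ∂(Measure.infinitePi fun _ : ι => ν) := by
  have h1 : Measurable fun ω : ι → Ξ => f ω (ω i) :=
    hf.comp (measurable_id.prodMk (measurable_pi_apply i))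
  conv_lhs => rw [← map_update_infinitePi ν i]
  have h2 := (h1.comp (measurable_update_prod i)).aemeasurable
    (μ := (Measure.infinitePi fun _ : ι => ν).prod ν)
  rw [lintegral_map h1 (measurable_update_prod i)]
  refine (lintegral_prod _ h2).trans ?_
  simp only [Function.comp_apply, Function.update_self, hi]

end Resampling

variable {n m : ℕ} {P : Problem n m} {M : Preconditioner n m} {q : Params} {E : PD n m → ℝ}
  {ζ : ℝ} {z0 zProj : PD n m} {r κ ε p : ℝ} {Ξ : Type*} {S : InnerSolver n m Ξ}

theorem cstA_nonneg (P : Problem n m) (hm : 0 < m) : 0 ≤ cstA P M := by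
  have := M.lamMinL_pos hm
  unfold cstA
  positivity

theorem Setting.sigmaBar_pos (H : Setting P M q E ζ z0 zProj r κ ε) : 0 < sigmaBar q κ := by
  have := q.α_pos
  have := q.one_lt_ϱσ
  have := H.κ_pos
  unfold sigmaBar
  positivity

theorem Setting.lipBar_pos (H : Setting P M q E ζ z0 zProj r κ ε) :
    0 < P.L₀ * sigmaBar q κ + cstA P M * sigmaBar q κ ^ 2 := by
  have hσ := H.sigmaBar_pos
  have h2 := H.one_le
  rcases P.L₀_nonneg.lt_or_eq with h | h
  · have := cstA_nonneg P H.hm (M := M)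
    positivity
  · rcases (cstA_nonneg P H.hm (M := M)).lt_or_eq with h' | h'
    · rw [← h]
      positivity
    · rw [← h, ← h'] at h2
      norm_num at h2

theorem Setting.zetaBar₁_pos (H : Setting P M q E ζ z0 zProj r κ ε) (hp : 0 < p) :
    0 < zetaBar₁ P M q ζ r κ ε p := by
  have := M.lamMinX_pos H.hn
  have := H.lipBar_pos
  have := etaBar_pos q M.lamMin ζ r κ ε
  have := H.one_le_r
  rw [zetaBar₁]
  positivity

theorem Setting.zetaBar₂_pos (H : Setting P M q E ζ z0 zProj r κ ε) (hp : 0 < p) :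
    0 < zetaBar₂ P M q κ p := by
  have := M.lamMinX_pos H.hn
  have := H.lamMin_pos
  have := q.δ_pos
  have := H.lipBar_pos
  rw [zetaBar₂]
  positivity

/-- The optimality gap of `x` in the current inner problem, relative to that of its start. -/
def relGap (P : Problem n m) (M : Preconditioner n m) (q : Params) (st : State n m) (x : Vec n) :
    ℝ≥0∞ :=
  gap P M (q.sig st.s) st.base x *
    (gap P M (q.sig st.s) st.base (proxGrad P M (q.sig st.s) st.base st.base.fst))⁻¹

/-- The event that the `N`-th step is the inner iteration with counters `i`. -/
def runningAt (P : Problem n m) (M : Preconditioner n m) (q : Params) (E : PD n m → ℝ) (ε : ℝ)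
    (S : InnerSolver n m Ξ) (z0 : PD n m) (N : ℕ) (i : ℕ × ℕ × ℕ) : Set (ℕ × ℕ × ℕ → Ξ) :=
  {ω | (run P M q E ε S z0 ω N).out = none ∧ (run P M q E ε S z0 ω N).idx = i}

/-- Whether step `N` is the inner iteration `i` is decided before `ω i` is read. -/
theorem mem_runningAt_update {N : ℕ} {i : ℕ × ℕ × ℕ} (ω : ℕ × ℕ × ℕ → Ξ) (ξ : Ξ) :
    Function.update ω i ξ ∈ runningAt P M q E ε S z0 N i ↔ ω ∈ runningAt P M q E ε S z0 N i := by
  have key : ∀ (ω : ℕ × ℕ × ℕ → Ξ) (ξ : Ξ), ω ∈ runningAt P M q E ε S z0 N i →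
      Function.update ω i ξ ∈ runningAt P M q E ε S z0 N i := by
    rintro ω ξ ⟨h1, h2⟩
    have := run_update ξ h1 h2
    exact ⟨by rw [this]; exact h1, by rw [this]; exact h2⟩
  refine ⟨fun h => ?_, key ω ξ⟩
  simpa using key _ (ω i) h

theorem disjoint_runningAt (i : ℕ × ℕ × ℕ) :
    Pairwise (Function.onFun Disjoint fun N => runningAt P M q E ε S z0 N i) := by
  have key : ∀ N N', N < N' →
      Disjoint (runningAt P M q E ε S z0 N i) (runningAt P M q E ε S z0 N' i) := by
    intro N N' hN
    refine Set.disjoint_left.2 fun ω h h' => ?_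
    exact (run_idx_lt hN h'.1).2.ne (h.2.trans h'.2.symm)
  intro N N' hN
  rcases hN.lt_or_gt with h | h
  · exact key _ _ h
  · exact (key _ _ h).symm

/-- An inner iteration that is not the first one continues the previous one. -/
theorem runningAt_succ {N s t k : ℕ} {ω : ℕ × ℕ × ℕ → Ξ}
    (h : ω ∈ runningAt P M q E ε S z0 (N + 1) (s, t, k + 1)) :
    ω ∈ runningAt P M q E ε S z0 N (s, t, k) ∧
      ¬ Stops P M q S (run P M q E ε S z0 ω N) (ω (s, t, k)) ∧
      (run P M q E ε S z0 ω (N + 1)).s = (run P M q E ε S z0 ω N).s ∧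
      (run P M q E ε S z0 ω (N + 1)).base = (run P M q E ε S z0 ω N).base ∧
      (run P M q E ε S z0 ω (N + 1)).x =
        nextX P M q S (run P M q E ε S z0 ω N) (ω (s, t, k)) := by
  obtain ⟨h1, h2⟩ := h
  rw [run_succ] at h1 h2 ⊢
  set st := run P M q E ε S z0 ω N with hst
  obtain ⟨h3, ⟨h4, e⟩ | ⟨-, -, -, e⟩ | ⟨-, -, -, e⟩⟩ := step_none_cases h1
  · rw [e] at h2
    have h5 : st.idx = (s, t, k) := by
      simp only [State.idx, Prod.mk.injEq, add_left_inj] at h2 ⊢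
      exact h2
    rw [h5] at h4 e ⊢
    refine ⟨⟨h3, h5⟩, h4, ?_, ?_, ?_⟩ <;> rw [e]
    rfl
  · rw [e] at h2
    simp [State.idx, enterOuter] at h2
  · rw [e] at h2
    simp [State.idx] at h2

theorem runningAt_zero (s t k : ℕ) : runningAt P M q E ε S z0 0 (s, t, k + 1) = ∅ := by
  ext ω
  simp [runningAt, run, State.idx, enterOuter]

theorem Setting.gap_ne_top (H : Setting P M q E ζ z0 zProj r κ ε) (s : ℕ) (z : PD n m)
    {x : Vec n} (hx : P.g x ≠ ⊤) : gap P M (q.sig s) z x ≠ ⊤ := by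
  rw [gap_eq P M H.hn H.hm (q.sig_pos s) z hx]
  exact ENNReal.ofReal_ne_top

theorem gap_nextY_le (st : State n m) (ξ : Ξ) :
    gap P M (q.sig st.s) st.base (nextY P M q S st ξ) ≤
      gap P M (q.sig st.s) st.base (solved S st ξ) := by
  unfold nextY
  split_ifs with h
  · exact gap_mono h.le
  · exact le_rfl

theorem Setting.measurable_relGap (H : Setting P M q E ζ z0 zProj r κ ε) {α : Type*} [MeasurableSpace α] {f : α → State n m}
    {x : α → Vec n} (hf : Measurable f) (hx : Measurable x) :
    Measurable fun a => relGap P M q (f a) (x a) := by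
  have hs : Measurable fun a => (f a).s := measurable_s.comp hf
  have hb : Measurable fun a => (f a).base := measurable_base.comp hf
  have h1 := H.measurable_proxGrad hs hb (measurable_fst_PD.comp hb)
  exact (H.measurable_gap hs hb hx).mul (H.measurable_gap hs hb h1).inv

section Tail

variable [MeasurableSpace Ξ] {ν : Measure Ξ} (H : Setting P M q E ζ z0 zProj r κ ε)
  (hS : IsHOOD ν P M q S)

include hS in
theorem nextY_dom {st : State n m} (hx : P.g st.x ≠ ⊤) (ξ : Ξ) :
    P.g (nextY P M q S st ξ) ≠ ⊤ := by
  unfold nextY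
  split_ifs with h
  · exact hx
  · exact hS.mem_dom _ _ _ _ _ hx

include H

theorem Setting.relGap_solved {st : State n m} (hS : IsHOOD ν P M q S) (hx : P.g st.x ≠ ⊤) :
    ∫⁻ ξ, relGap P M q st (solved S st ξ) ∂ν ≤
      ENNReal.ofReal (Real.exp (-1)) * relGap P M q st st.x := by
  unfold relGap
  have h1 : Measurable fun ξ => solved S st ξ :=
    (hS.measurable_solve st.s st.t).comp
      (measurable_const.prodMk (measurable_const.prodMk measurable_id))
  have h2 := H.measurable_gap (s := fun _ : Ξ => st.s) (z := fun _ : Ξ => st.base)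
    measurable_const measurable_const h1
  rw [lintegral_mul_const _ h2, ← mul_assoc]
  gcongr
  exact hS.decrease _ _ _ _ hx

include hS

theorem Setting.measurableSet_runningAt (N : ℕ) (i : ℕ × ℕ × ℕ) :
    MeasurableSet (runningAt P M q E ε S z0 N i) := by
  have h := H.measurable_run hS.measurable_solve N
  exact (h measurableSet_out_none).inter ((measurable_idx.comp h) (measurableSet_singleton i))

theorem Setting.relGap_succ_le {N s t k : ℕ} {ω : ℕ × ℕ × ℕ → Ξ}
    (h : ω ∈ runningAt P M q E ε S z0 (N + 1) (s, t, k + 1)) :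
    relGap P M q (run P M q E ε S z0 ω (N + 1)) (run P M q E ε S z0 ω (N + 1)).x ≤
      relGap P M q (run P M q E ε S z0 ω N) (solved S (run P M q E ε S z0 ω N) (ω (s, t, k))) := by
  obtain ⟨h1, -, h3, h4, h5⟩ := runningAt_succ h
  unfold relGap
  rw [h3, h4, h5]
  gcongr
  refine le_trans ?_ (gap_nextY_le _ _)
  have := q.sig_pos (run P M q E ε S z0 ω N).s
  exact gap_proxGrad_le P M H.hn H.hm this (H.lipL_pos this) _
    (nextY_dom hS (H.inv_run N h1.1).dom _)

theorem Setting.one_le_relGap {N s t k : ℕ} {ω : ℕ × ℕ × ℕ → Ξ} (hp : 0 < p)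
    (h : ω ∈ runningAt P M q E ε S z0 (N + 1) (s, t, k + 1)) :
    1 ≤ ENNReal.ofReal (2 * p * max (zetaBar₁ P M q ζ r κ ε p) (zetaBar₂ P M q κ p)) *
      relGap P M q (run P M q E ε S z0 ω N) (solved S (run P M q E ε S z0 ω N) (ω (s, t, k))) := by
  obtain ⟨h1, h2, -⟩ := runningAt_succ h
  have hinv := H.inv_run N h1.1
  set st := run P M q E ε S z0 ω N
  obtain ⟨h3, h4⟩ := H.gap_base_le_of_not_stopCrit hinv.s_le (H.t_lt hinv) hinv.normM_base_le
    (nextY_dom hS hinv.dom (ω (s, t, k))) hp h2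
  unfold relGap
  have h5 := gap_nextY_le (P := P) (M := M) (q := q) (S := S) st (ω (s, t, k))
  rw [← mul_assoc]
  set g0 := gap P M (q.sig st.s) st.base (proxGrad P M (q.sig st.s) st.base st.base.fst)
  have hz : ENNReal.ofReal (2 * p * max (zetaBar₁ P M q ζ r κ ε p) (zetaBar₂ P M q κ p)) ≠ 0 := by
    have := H.zetaBar₂_pos hp
    rw [Ne, ENNReal.ofReal_eq_zero, not_le]
    positivity
  -- If the initial gap vanishes, its inverse is `⊤`; the current gap is positive because the
  -- criterion failed, so the product is `⊤`.
  by_cases h0 : g0 = 0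
  · rw [h0, ENNReal.inv_zero, ENNReal.mul_top (mul_ne_zero hz (h3.trans_le h5).ne')]
    exact le_top
  have h6 : g0 ≠ ⊤ := H.gap_ne_top _ _ (H.proxGrad_dom _ _ _)
  rw [← ENNReal.div_eq_inv_mul.trans (mul_comm _ _), ENNReal.le_div_iff_mul_le (.inl h0) (.inl h6),
    one_mul]
  exact h4.trans (mul_le_mul_right h5 _)

variable [IsProbabilityMeasure ν]

/-- On the event, the state at step `N` does not depend on `ω i`. Resampling that coordinate reduces
the claim to the decrease property of the solver for a fixed state. -/
theorem Setting.lintegral_relGap_solved (N : ℕ) (i : ℕ × ℕ × ℕ) :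
    ∫⁻ ω in runningAt P M q E ε S z0 N i,
        relGap P M q (run P M q E ε S z0 ω N) (solved S (run P M q E ε S z0 ω N) (ω i))
          ∂(Measure.infinitePi fun _ => ν) ≤
      ENNReal.ofReal (Real.exp (-1)) * ∫⁻ ω in runningAt P M q E ε S z0 N i,
        relGap P M q (run P M q E ε S z0 ω N) (run P M q E ε S z0 ω N).x
          ∂(Measure.infinitePi fun _ => ν) := by
  have hA := H.measurableSet_runningAt (z0 := z0) hS N i
  have hr := H.measurable_run hS.measurable_solve N
  have hr' : Measurable fun w : (ℕ × ℕ × ℕ → Ξ) × Ξ => run P M q E ε S z0 w.1 N :=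
    hr.comp measurable_fst
  set f : (ℕ × ℕ × ℕ → Ξ) → Ξ → ℝ≥0∞ := fun ω ξ => (runningAt P M q E ε S z0 N i).indicator
    (fun ω => relGap P M q (run P M q E ε S z0 ω N) (solved S (run P M q E ε S z0 ω N) ξ)) ω with hf
  have h1 : Measurable (Function.uncurry f) := by
    have h2 : Measurable fun w : (ℕ × ℕ × ℕ → Ξ) × Ξ =>
        solved S (run P M q E ε S z0 w.1 N) w.2 :=
      (measurable_solved hS.measurable_solve).comp (hr'.prodMk measurable_snd)
    have h3 := (H.measurable_relGap hr' h2).indicator (measurable_fst hA)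
    exact h3
  have h2 : ∀ ω ξ ξ', f (Function.update ω i ξ) ξ' = f ω ξ' := by
    intro ω ξ ξ'
    by_cases h : ω ∈ runningAt P M q E ε S z0 N i
    · simp only [hf]
      rw [Set.indicator_of_mem h, Set.indicator_of_mem ((mem_runningAt_update ω ξ).2 h),
        run_update ξ h.1 h.2]
    · simp only [hf]
      rw [Set.indicator_of_notMem h,
        Set.indicator_of_notMem (fun h' => h ((mem_runningAt_update ω ξ).1 h'))]
  rw [← lintegral_indicator hA, ← lintegral_indicator hA]
  have h3 := lintegral_infinitePi_resample ν h1 h2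
  have h4 : ∀ ω, f ω (ω i) = (runningAt P M q E ε S z0 N i).indicator (fun ω =>
      relGap P M q (run P M q E ε S z0 ω N) (solved S (run P M q E ε S z0 ω N) (ω i))) ω := by
    intro ω
    simp only [hf, Set.indicator]
  simp only [h4] at h3
  rw [h3, ← lintegral_const_mul' _ _ ENNReal.ofReal_ne_top]
  refine lintegral_mono fun ω => ?_
  by_cases h : ω ∈ runningAt P M q E ε S z0 N i
  · simp only [hf, Set.indicator_of_mem h]
    exact H.relGap_solved hS (H.inv_run N h.1).dom
  · simp only [hf, Set.indicator_of_notMem h, lintegral_zero, zero_le]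

/-- The expected relative gap over the event that the `N`-th step is the inner iteration `i`. -/
def meanRelGap (ν : Measure Ξ) (P : Problem n m) (M : Preconditioner n m) (q : Params)
    (E : PD n m → ℝ) (ε : ℝ) (S : InnerSolver n m Ξ) (z0 : PD n m) (N : ℕ) (i : ℕ × ℕ × ℕ) :
    ℝ≥0∞ :=
  ∫⁻ ω in runningAt P M q E ε S z0 N i,
    relGap P M q (run P M q E ε S z0 ω N) (run P M q E ε S z0 ω N).x
      ∂(Measure.infinitePi fun _ => ν)

theorem Setting.meanRelGap_succ_le (N s t k : ℕ) :
    meanRelGap ν P M q E ε S z0 (N + 1) (s, t, k + 1) ≤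
      ENNReal.ofReal (Real.exp (-1)) * meanRelGap ν P M q E ε S z0 N (s, t, k) := by
  refine le_trans ?_ (H.lintegral_relGap_solved hS N (s, t, k))
  refine (setLIntegral_mono' (H.measurableSet_runningAt hS _ _) fun ω h =>
    H.relGap_succ_le hS h).trans ?_
  exact lintegral_mono_set fun ω h => (runningAt_succ h).1

theorem Setting.measure_runningAt_succ_le (hp : 0 < p) (N s t k : ℕ) :
    Measure.infinitePi (fun _ => ν) (runningAt P M q E ε S z0 (N + 1) (s, t, k + 1)) ≤
      ENNReal.ofReal (2 * p * max (zetaBar₁ P M q ζ r κ ε p) (zetaBar₂ P M q κ p)) *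
      (ENNReal.ofReal (Real.exp (-1)) * meanRelGap ν P M q E ε S z0 N (s, t, k)) := by
  rw [← setLIntegral_one]
  refine (setLIntegral_mono' (H.measurableSet_runningAt hS _ _) fun ω h =>
    H.one_le_relGap hS hp h).trans ?_
  rw [lintegral_const_mul' _ _ ENNReal.ofReal_ne_top]
  gcongr
  exact (lintegral_mono_set fun ω h => (runningAt_succ h).1).trans
    (H.lintegral_relGap_solved hS N (s, t, k))

/-- The step at which given counters are reached is random. Summing over the disjoint events for all
`N` replaces conditioning on it: at `k = 0` the relative gap is at most `1`, and each further
iteration contributes `e⁻¹`. -/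
theorem Setting.tsum_meanRelGap_le (s t k : ℕ) :
    ∑' N, meanRelGap ν P M q E ε S z0 N (s, t, k) ≤ ENNReal.ofReal (Real.exp (-1)) ^ k := by
  induction k with
  | zero =>
    have h1 : ∀ N, meanRelGap ν P M q E ε S z0 N (s, t, 0) ≤
        Measure.infinitePi (fun _ => ν) (runningAt P M q E ε S z0 N (s, t, 0)) := by
      intro N
      rw [← setLIntegral_one]
      refine setLIntegral_mono' (H.measurableSet_runningAt hS _ _) fun ω h => ?_
      have hk : (run P M q E ε S z0 ω N).k = 0 := congrArg (fun i => i.2.2) h.2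
      rw [(H.inv_run N h.1).start hk]
      -- At the start the relative gap is a number times its inverse, at most `1` even if the gap is
      -- `0`.
      exact ENNReal.mul_inv_le_one _
    refine (ENNReal.tsum_le_tsum h1).trans ?_
    rw [← measure_iUnion (disjoint_runningAt _) fun N => H.measurableSet_runningAt hS _ _, pow_zero]
    exact prob_le_one
  | succ k ih =>
    rw [tsum_eq_zero_add' ENNReal.summable, pow_succ']
    have h0 : meanRelGap ν P M q E ε S z0 0 (s, t, k + 1) = 0 := by
      rw [meanRelGap, runningAt_zero, setLIntegral_empty]
    rw [h0, zero_add]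
    refine (ENNReal.tsum_le_tsum fun N => H.meanRelGap_succ_le hS N s t k).trans ?_
    rw [ENNReal.tsum_mul_left]
    gcongr

/-- Long proximal steps are unlikely. -/
theorem Setting.measure_iUnion_runningAt_le (hp : 0 < p) (s t k : ℕ) :
    Measure.infinitePi (fun _ => ν) (⋃ N, runningAt P M q E ε S z0 N (s, t, k + 1)) ≤
      ENNReal.ofReal (2 * p * max (zetaBar₁ P M q ζ r κ ε p) (zetaBar₂ P M q κ p)) *
        ENNReal.ofReal (Real.exp (-1)) ^ (k + 1) := by
  refine (measure_iUnion_le _).trans ?_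
  rw [tsum_eq_zero_add' ENNReal.summable, runningAt_zero, measure_empty, zero_add]
  refine (ENNReal.tsum_le_tsum fun N => H.measure_runningAt_succ_le hS hp N s t k).trans ?_
  rw [ENNReal.tsum_mul_left, ENNReal.tsum_mul_left, pow_succ']
  gcongr
  exact H.tsum_meanRelGap_le hS s t k

/-- The complexity of AGPPA in terms of a bound `K` on the length of the proximal steps. -/
theorem Setting.le_measure_solvesWithin (hp : 0 < p) {K : ℕ} (hK : 0 < K)
    (hexp : 2 * ((sBar q κ + 1 : ℕ) * innerCount q M.lamMin ζ r κ ε : ℝ) *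
      max (zetaBar₁ P M q ζ r κ ε p) (zetaBar₂ P M q κ p) ≤ Real.exp K)
    {T : ℝ → ℝ} (hT : MonotoneOn T (Set.Ioi 0))
    (hcost : ∀ s t zBar x ξ, P.g x ≠ ⊤ → (S.cost s t zBar x ξ : ℝ) ≤ T (q.sig s))
    (hT0 : 0 ≤ T (sigmaBar q κ)) {B : ℝ}
    (hB : (((sBar q κ + 1) * innerCount q M.lamMin ζ r κ ε * K : ℕ) : ℝ) * T (sigmaBar q κ) ≤ B) :
    ENNReal.ofReal (1 - p) ≤ Measure.infinitePi (fun _ : ℕ × ℕ × ℕ => ν)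
      {ω | SolvesWithin P M q E ε S z0 ω B} := by
  set nb := innerCount q M.lamMin ζ r κ ε with hnb
  set zb := max (zetaBar₁ P M q ζ r κ ε p) (zetaBar₂ P M q κ p)
  obtain ⟨k, rfl⟩ : ∃ k, K = k + 1 := Nat.exists_eq_add_one.2 hK
  -- The event that some proximal step reaches the inner counter `K`. The invariants confine `(s,
  -- t)` to this finite range.
  set bad : Set (ℕ × ℕ × ℕ → Ξ) := ⋃ i ∈ Finset.range (sBar q κ + 1) ×ˢ Finset.range nb,
    ⋃ N, runningAt P M q E ε S z0 N (i.1, i.2, k + 1) with hbad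
  have hzb : 0 < zb := (H.zetaBar₂_pos hp).trans_le (le_max_right _ _)
  have hbadm : MeasurableSet bad := Finset.measurableSet_biUnion _ fun i _ =>
    MeasurableSet.iUnion fun N => H.measurableSet_runningAt hS _ _
  have h1 : Measure.infinitePi (fun _ : ℕ × ℕ × ℕ => ν) bad ≤ ENNReal.ofReal p := by
    refine (measure_biUnion_finset_le _ _).trans ?_
    refine (Finset.sum_le_sum fun i _ =>
      H.measure_iUnion_runningAt_le hS hp i.1 i.2 k).trans ?_
    rw [Finset.sum_const, Finset.card_product, Finset.card_range, Finset.card_range, nsmul_eq_mul,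
      ← ENNReal.ofReal_pow (Real.exp_nonneg _), ← ENNReal.ofReal_mul (by positivity),
      ← ENNReal.ofReal_natCast, ← ENNReal.ofReal_mul (by positivity)]
    refine ENNReal.ofReal_le_ofReal ?_
    -- The factor `p` in the tail bound cancels the `1/p` inside `ζ₁` and `ζ₂`; hence the union
    -- bound yields exactly `p` once `e^K` dominates the number of steps times `2 max(ζ₁, ζ₂)`.
    have h2 : Real.exp (-1) ^ (k + 1) * Real.exp ((k + 1 : ℕ) : ℝ) = 1 := by
      rw [← Real.exp_nat_mul, ← Real.exp_add]
      simp
    calc (((sBar q κ + 1) * nb : ℕ) : ℝ) * (2 * p * zb * Real.exp (-1) ^ (k + 1))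
        = p * Real.exp (-1) ^ (k + 1) * (2 * ((sBar q κ + 1 : ℕ) * nb : ℝ) * zb) := by
          push_cast; ring
      _ ≤ p * Real.exp (-1) ^ (k + 1) * Real.exp ((k + 1 : ℕ) : ℝ) := by gcongr
      _ = p := by rw [mul_assoc, h2, mul_one]
  have h2 : badᶜ ⊆ {ω | SolvesWithin P M q E ε S z0 ω B} := by
    intro ω hω
    refine H.solvesWithin hT hcost hT0 hB fun N => ?_
    induction N with
    | zero => exact fun _ => hK
    | succ N ih =>
      intro h
      by_contra! hcon
      have hinv := H.inv_run (N + 1) h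
      -- The inner counter grows by at most one per step, so it equals `K` when it first reaches
      -- `K`.
      have hk : (run P M q E ε S z0 ω (N + 1)).k = k + 1 := by
        have h3 := ih (run_none_of_succ h)
        rw [run_succ] at h hcon ⊢
        obtain ⟨-, ⟨-, e⟩ | ⟨-, -, -, e⟩ | ⟨-, -, -, e⟩⟩ := step_none_cases h <;>
          rw [e] at hcon ⊢ <;> simp [enterOuter] at hcon ⊢
        omega
      refine hω (Set.mem_biUnion (x := ((run P M q E ε S z0 ω (N + 1)).s,
        (run P M q E ε S z0 ω (N + 1)).t)) ?_ (Set.mem_iUnion.2 ⟨N + 1, h, ?_⟩))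
      · simp only [Finset.coe_product, Finset.coe_range, Set.mem_prod, Set.mem_Iio]
        exact ⟨Nat.lt_succ_of_le hinv.s_le, H.t_lt hinv⟩
      · simp only [State.idx, hk]
  calc ENNReal.ofReal (1 - p) = 1 - ENNReal.ofReal p := by
        rw [ENNReal.ofReal_sub _ hp.le, ENNReal.ofReal_one]
    _ ≤ 1 - Measure.infinitePi (fun _ : ℕ × ℕ × ℕ => ν) bad := tsub_le_tsub_left h1 _
    _ = Measure.infinitePi (fun _ : ℕ × ℕ × ℕ => ν) badᶜ := (prob_compl_eq_one_sub hbadm).symm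
    -- Only monotonicity of the measure is used, so the success event itself need not be measurable.
    _ ≤ _ := measure_mono h2

end Tail

end AGPPA

end

/-! ### Logarithmic estimates with constants depending only on the parameters and `λ_min(M)`. -/

noncomputable section

namespace AGPPA

/-- The logarithms that are dominated by the last factor of the complexity bound. -/
theorem log_le_log_mul {κ X Y : ℝ} (hκ : 2 ≤ κ) (hX : κ ≤ X) (hY : Real.log κ ≤ Y) :
    1 ≤ 4 * Real.log (X * Y) ∧ Real.log κ ≤ 3 * Real.log (X * Y) ∧
      Real.log X ≤ 3 * Real.log (X * Y) ∧ Real.log Y ≤ Real.log (X * Y) := by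
  have h2 := Real.log_two_gt_d9
  have h3 : Real.log 2 ≤ Real.log κ := Real.log_le_log two_pos hκ
  have h4 : Real.log κ ≤ Real.log X := Real.log_le_log (by linarith) hX
  have hY0 : 0.6931 ≤ Y := by linarith
  -- As `Y ≥ ln κ ≥ ln 2`, `1 - 1/Y` bounds `ln Y` from below. Then `ln κ - 0.443` is at least both
  -- `1/4` and `(ln κ)/3`, the source of the constants `4` and `3`.
  have h5 : -0.443 ≤ Real.log Y := by
    have h6 := Real.one_sub_inv_le_log_of_pos (show 0 < Y by linarith)
    have h7 : Y⁻¹ ≤ 0.6931⁻¹ := inv_anti₀ (by norm_num) hY0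
    norm_num at h7 ⊢
    linarith
  rw [Real.log_mul (by linarith) (by linarith)]
  norm_num at h2 h5
  refine ⟨?_, ?_, ?_, ?_⟩ <;> linarith

theorem half_le_log {κ : ℝ} (hκ : 2 ≤ κ) : 1 / 2 ≤ Real.log κ := by
  have h2 := Real.log_two_gt_d9
  have h3 : Real.log 2 ≤ Real.log κ := Real.log_le_log two_pos hκ
  norm_num at h2
  linarith

/-- The number of outer iterations is of the order of `ln κ`. -/
theorem exists_sBar_add_one_le (q : Params) :
    ∃ C, 0 < C ∧ ∀ κ, 2 ≤ κ → (sBar q κ : ℝ) + 1 ≤ C * Real.log κ := by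
  have hl : 0 < Real.log q.ϱσ := Real.log_pos q.one_lt_ϱσ
  have hα := q.α_pos
  have hσ := q.σ₀_pos
  refine ⟨4 + (1 + 2 * |Real.log (q.α / q.σ₀)|) / Real.log q.ϱσ, by positivity, fun κ hκ => ?_⟩
  have hκ2 := half_le_log hκ
  have h1 : (sBar q κ : ℝ) ≤ max (Real.logb q.ϱσ (κ * q.α / q.σ₀)) 0 + 1 :=
    (Nat.ceil_lt_add_one (le_max_right _ _)).le
  have h2 : max (Real.logb q.ϱσ (κ * q.α / q.σ₀)) 0 ≤
      (1 + 2 * |Real.log (q.α / q.σ₀)|) / Real.log q.ϱσ * Real.log κ := by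
    refine max_le ?_ (by positivity)
    rw [Real.logb, mul_div_assoc, Real.log_mul (by positivity) (by positivity), div_mul_eq_mul_div]
    gcongr
    have h3 := le_abs_self (Real.log (q.α / q.σ₀))
    nlinarith [abs_nonneg (Real.log (q.α / q.σ₀))]
  rw [add_mul]
  linarith

/-- The number of proximal steps is of the order of `ln (ζ r κ / ε)`. -/
theorem exists_innerCount_le (q : Params) (hρ : q.rho < 1) {μ : ℝ} (hμ : 0 < μ) :
    ∃ C, 0 < C ∧ ∀ ζ r κ ε, 0 < ζ → 0 < ε → 2 ≤ κ → ε ≤ ζ * r → 1 ≤ r →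
      (innerCount q μ ζ r κ ε : ℝ) ≤ C * Real.log (ζ * r * κ / ε) := by
  have hl : 0 < Real.log (1 / q.rho) := Real.log_pos ((one_lt_div q.rho_pos).2 hρ)
  have hσ := q.σ₀_pos
  have hδ := q.δ_pos
  have hδ' : 0 < 1 - q.δ := by linarith [q.δ_lt_half]
  have hs1 : 0 < 1 - √(1 / (q.α ^ 2 + 1)) := by
    rw [sub_pos, Real.sqrt_lt' one_pos, one_pow, div_lt_one (by positivity)]
    have := q.α_pos
    nlinarith
  -- `D` collects the parameter-dependent factors of `RBar`, so that `RBar / ε ≤ D W²`; the square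
  -- only doubles the logarithm.
  set D := (1 + q.δ) ^ 2 * (2 * (q.σ₀ ^ 2 + 1)) /
    ((1 - q.δ) ^ 2 * (1 - √(1 / (q.α ^ 2 + 1))) * q.σ₀ ^ 2 * μ) with hD
  have hD0 : 0 < D := by positivity
  refine ⟨4 + (2 * |Real.log D| + 2) / Real.log (1 / q.rho), by positivity,
    fun ζ r κ ε hζ hε hκ hεr hr => ?_⟩
  have hκ0 : 0 < κ := by linarith
  have hr0 : 0 < r := by linarith
  set W := ζ * r * κ / ε with hW
  have hζr : 1 ≤ ζ * r / ε := (one_le_div hε).2 hεr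
  have hWκ : κ ≤ W := by
    have : W = ζ * r / ε * κ := by rw [hW]; ring
    rw [this]
    nlinarith
  have hY : 1 / 2 ≤ Real.log W := half_le_log (hκ.trans hWκ)
  -- From `√(1 - u) ≤ 1 - u/2` with `u = σ₀²/(σ₀² + κ²)` and `κ ≥ 1`: the small denominator of
  -- `RBar` costs a factor of order `κ²`.
  have hs2 : q.σ₀ ^ 2 / (2 * (q.σ₀ ^ 2 + 1) * κ ^ 2) ≤
      1 - √(κ ^ 2 / (q.σ₀ ^ 2 + κ ^ 2)) := by
    have h1 : √(κ ^ 2 / (q.σ₀ ^ 2 + κ ^ 2)) ≤ 1 - q.σ₀ ^ 2 / (q.σ₀ ^ 2 + κ ^ 2) / 2 := by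
      have e : κ ^ 2 / (q.σ₀ ^ 2 + κ ^ 2) = 1 - q.σ₀ ^ 2 / (q.σ₀ ^ 2 + κ ^ 2) := by
        field_simp
        ring
      have h2 : q.σ₀ ^ 2 / (q.σ₀ ^ 2 + κ ^ 2) ≤ 1 := (div_le_one (by positivity)).2 (by nlinarith)
      rw [e, Real.sqrt_le_left (by linarith)]
      nlinarith [sq_nonneg (q.σ₀ ^ 2 / (q.σ₀ ^ 2 + κ ^ 2))]
    have h3 : q.σ₀ ^ 2 / (2 * (q.σ₀ ^ 2 + 1) * κ ^ 2) ≤ q.σ₀ ^ 2 / (q.σ₀ ^ 2 + κ ^ 2) / 2 := by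
      rw [div_div]
      refine div_le_div_of_nonneg_left (by positivity) (by positivity) ?_
      have : 1 ≤ κ ^ 2 := by nlinarith
      nlinarith [mul_nonneg (sq_nonneg q.σ₀) (sub_nonneg.2 this)]
    linarith
  have hs0 : 0 < q.σ₀ ^ 2 / (2 * (q.σ₀ ^ 2 + 1) * κ ^ 2) := by positivity
  have hR0 : 0 < RBar q μ ζ r κ / ε := by
    have := hs0.trans_le hs2
    unfold RBar
    positivity
  have hR : RBar q μ ζ r κ / ε ≤ D * W ^ 2 := by
    have h1 : RBar q μ ζ r κ / ε ≤ (1 + q.δ) ^ 2 * ζ * r /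
        ((1 - q.δ) ^ 2 * (1 - √(1 / (q.α ^ 2 + 1))) *
          (q.σ₀ ^ 2 / (2 * (q.σ₀ ^ 2 + 1) * κ ^ 2)) * μ) / ε := by
      unfold RBar
      gcongr
    have h2 : (1 + q.δ) ^ 2 * ζ * r / ((1 - q.δ) ^ 2 * (1 - √(1 / (q.α ^ 2 + 1))) *
        (q.σ₀ ^ 2 / (2 * (q.σ₀ ^ 2 + 1) * κ ^ 2)) * μ) / ε = D * (κ ^ 2 * (ζ * r / ε)) := by
      rw [hD]
      field_simp
    have h3 : W ^ 2 = κ ^ 2 * (ζ * r / ε) * (ζ * r / ε) := by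
      rw [hW]
      ring
    rw [h2] at h1
    refine h1.trans ?_
    rw [h3]
    refine mul_le_mul_of_nonneg_left ?_ hD0.le
    exact le_mul_of_one_le_right (by positivity) hζr
  have h1 : (innerCount q μ ζ r κ ε : ℝ) ≤
      max (Real.logb (1 / q.rho) (RBar q μ ζ r κ / ε)) 0 + 1 + 1 :=
    (Nat.ceil_lt_add_one (add_nonneg (le_max_right _ _) zero_le_one)).le
  have h2 : max (Real.logb (1 / q.rho) (RBar q μ ζ r κ / ε)) 0 ≤
      (2 * |Real.log D| + 2) / Real.log (1 / q.rho) * Real.log W := by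
    refine max_le ?_ (by positivity)
    rw [Real.logb, div_mul_eq_mul_div]
    gcongr
    have h3 := Real.log_le_log hR0 hR
    rw [Real.log_mul hD0.ne' (pow_pos (by linarith) 2).ne', Real.log_pow] at h3
    push_cast at h3
    have h4 := le_abs_self (Real.log D)
    nlinarith [abs_nonneg (Real.log D)]
  rw [add_mul]
  linarith

variable {n m : ℕ} {P : Problem n m} {M : Preconditioner n m} {q : Params} {E : PD n m → ℝ}
  {ζ : ℝ} {z0 zProj : PD n m} {r κ ε p : ℝ}

/-- The common factor of `zetaBar₁` and `zetaBar₂`. -/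
theorem Setting.lipBar_sq_mul_le (H : Setting P M q E ζ z0 zProj r κ ε) (hκ : 2 ≤ κ) (hp : 0 < p)
    (hp1 : p < 1) :
    (P.L₀ * sigmaBar q κ + cstA P M * sigmaBar q κ ^ 2) ^ 2 * r ^ 2 / p ≤
      (r * κ * (P.L₀ + cstA P M) / p) ^ 2 *
        ((q.α * q.ϱσ + (q.α * q.ϱσ) ^ 2) ^ 2 * κ ^ 4) := by
  have hα := q.α_pos
  have hϱ := q.one_lt_ϱσ
  have hr := H.one_le_r
  have hL := P.L₀_nonneg
  have ha := cstA_nonneg P H.hm (M := M)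
  have hb : 0 < q.α * q.ϱσ := by positivity
  set b := q.α * q.ϱσ with hb'
  have hσ : sigmaBar q κ = b * κ := by rw [sigmaBar]; ring
  rw [hσ]
  have h1 : P.L₀ * (b * κ) + cstA P M * (b * κ) ^ 2 ≤ (P.L₀ + cstA P M) * ((b + b ^ 2) * κ ^ 2) := by
    have h2 : b * κ ≤ (b + b ^ 2) * κ ^ 2 := by
      have h4 : κ ≤ κ ^ 2 := by nlinarith
      have h5 : 0 ≤ b ^ 2 * κ ^ 2 := by positivity
      linarith [mul_le_mul_of_nonneg_left h4 hb.le]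
    have h3 : (b * κ) ^ 2 ≤ (b + b ^ 2) * κ ^ 2 := by
      have h5 : 0 ≤ b * κ ^ 2 := by positivity
      linarith
    linarith [mul_le_mul_of_nonneg_left h2 hL, mul_le_mul_of_nonneg_left h3 ha]
  have h0 : 0 ≤ P.L₀ * (b * κ) + cstA P M * (b * κ) ^ 2 := by positivity
  calc (P.L₀ * (b * κ) + cstA P M * (b * κ) ^ 2) ^ 2 * r ^ 2 / p
      ≤ ((P.L₀ + cstA P M) * ((b + b ^ 2) * κ ^ 2)) ^ 2 * r ^ 2 / p := by gcongr
    _ = (r * (P.L₀ + cstA P M)) ^ 2 / p * ((b + b ^ 2) ^ 2 * κ ^ 4) := by ring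
    _ ≤ (r * κ * (P.L₀ + cstA P M) / p) ^ 2 * ((b + b ^ 2) ^ 2 * κ ^ 4) := by
        gcongr
        rw [div_pow]
        have h4 : (r * (P.L₀ + cstA P M)) ^ 2 ≤ (r * κ * (P.L₀ + cstA P M)) ^ 2 := by
          gcongr
          nlinarith
        -- Since `p < 1`, `1/p` may be replaced by `1/p²`, which makes the whole expression a
        -- multiple of the square of the argument in the last logarithm.
        have h5 : p ^ 2 ≤ p := by nlinarith
        gcongr

/-- Each factor has a controlled logarithm: powers of `X` and `κ`, a factor geometric in `sBar`, and
a power of `innerCount`. -/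
theorem Setting.zetaBar₁_le (H : Setting P M q E ζ z0 zProj r κ ε) (hκ : 2 ≤ κ) (hp : 0 < p)
    (hp1 : p < 1) :
    zetaBar₁ P M q ζ r κ ε p ≤
      2 * (q.α * q.ϱσ + (q.α * q.ϱσ) ^ 2) ^ 2 / (q.η₀ ^ 2 * M.lamMin) *
        ((r * κ * (P.L₀ + cstA P M) / p) ^ 2 * κ ^ 4) * ((q.ϱη ^ sBar q κ) ^ 2)⁻¹ *
          ((innerCount q M.lamMin ζ r κ ε : ℝ) ^ q.ς) ^ 2 := by
  have hsl := H.lipBar_sq_mul_le hκ hp hp1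
  have hM := H.lamMin_pos
  have hη := q.η₀_pos
  have hϱη := q.ϱη_pos
  have hX := M.lamMin_le_lamMinX H.hn
  have hX0 := M.lamMinX_pos H.hn
  have hn1 : (0 : ℝ) < innerCount q M.lamMin ζ r κ ε :=
    Nat.cast_pos.2 (innerCount_pos q M.lamMin ζ r κ ε)
  have e : zetaBar₁ P M q ζ r κ ε p =
      (P.L₀ * sigmaBar q κ + cstA P M * sigmaBar q κ ^ 2) ^ 2 * r ^ 2 / p *
        (2 / (q.η₀ ^ 2 * M.lamMinX) * ((q.ϱη ^ sBar q κ) ^ 2)⁻¹ *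
          ((innerCount q M.lamMin ζ r κ ε : ℝ) ^ q.ς) ^ 2) := by
    rw [zetaBar₁, etaBar, Real.rpow_neg hn1.le]
    field_simp
  have h3 : 2 / (q.η₀ ^ 2 * M.lamMinX) ≤ 2 / (q.η₀ ^ 2 * M.lamMin) := by gcongr
  rw [e]
  refine (mul_le_mul hsl (mul_le_mul_of_nonneg_right (mul_le_mul_of_nonneg_right h3
    (by positivity)) (by positivity)) (by positivity) (by positivity)).trans (le_of_eq ?_)
  ring

theorem Setting.zetaBar₂_le (H : Setting P M q E ζ z0 zProj r κ ε) (hκ : 2 ≤ κ) (hp : 0 < p)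
    (hp1 : p < 1) :
    zetaBar₂ P M q κ p ≤
      2 * (1 + q.δ) ^ 2 * (q.α * q.ϱσ + (q.α * q.ϱσ) ^ 2) ^ 2 / (q.δ ^ 2 * M.lamMin ^ 2) *
        ((r * κ * (P.L₀ + cstA P M) / p) ^ 2 * κ ^ 4) := by
  have hsl := H.lipBar_sq_mul_le hκ hp hp1
  have hM := H.lamMin_pos
  have hδ := q.δ_pos
  have hX := M.lamMin_le_lamMinX H.hn
  have hX0 := M.lamMinX_pos H.hn
  have hr : 1 ≤ r ^ 2 := one_le_pow₀ H.one_le_r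
  have e : zetaBar₂ P M q κ p =
      (P.L₀ * sigmaBar q κ + cstA P M * sigmaBar q κ ^ 2) ^ 2 * 1 / p *
        (2 * (1 + q.δ) ^ 2 / (q.δ ^ 2 * M.lamMinX * M.lamMin)) := by
    rw [zetaBar₂]
    field_simp
  have h3 : 2 * (1 + q.δ) ^ 2 / (q.δ ^ 2 * M.lamMinX * M.lamMin) ≤
      2 * (1 + q.δ) ^ 2 / (q.δ ^ 2 * M.lamMin * M.lamMin) := by gcongr
  have h4 : (P.L₀ * sigmaBar q κ + cstA P M * sigmaBar q κ ^ 2) ^ 2 * 1 / p ≤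
      (P.L₀ * sigmaBar q κ + cstA P M * sigmaBar q κ ^ 2) ^ 2 * r ^ 2 / p := by gcongr
  rw [e]
  refine (mul_le_mul (h4.trans hsl) h3 (by positivity) (by positivity)).trans (le_of_eq ?_)
  ring

/-- The length of the proximal steps is of the order of the last factor of the bound. -/
theorem exists_log_zetaBar_le (q : Params) (hρ : q.rho < 1) {μ : ℝ} (hμ : 0 < μ) :
    ∃ C, 0 < C ∧ ∀ {n m : ℕ} {P : Problem n m} {M : Preconditioner n m} {E : PD n m → ℝ}
      {ζ : ℝ} {z0 zProj : PD n m} {r κ ε p : ℝ}, Setting P M q E ζ z0 zProj r κ ε →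
      M.lamMin = μ → 2 ≤ κ → ε ≤ ζ * r → 0 < p → p < 1 →
      Real.log (2 * ((sBar q κ + 1 : ℕ) * innerCount q M.lamMin ζ r κ ε : ℝ)) +
        max (max (Real.log (zetaBar₁ P M q ζ r κ ε p)) (Real.log (zetaBar₂ P M q κ p))) 0 + 1 ≤
        C * Real.log (r * κ * (P.L₀ + cstA P M) / p * Real.log (ζ * r * κ / ε)) := by
  obtain ⟨C1, hC1, hs⟩ := exists_sBar_add_one_le q
  obtain ⟨C2, hC2, hn⟩ := exists_innerCount_le q hρ hμ
  have hα := q.α_pos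
  have hϱ := q.one_lt_ϱσ
  have hη := q.η₀_pos
  have hϱη := q.ϱη_pos
  have hς := q.one_lt_ς
  have hδ := q.δ_pos
  set b := (q.α * q.ϱσ + (q.α * q.ϱσ) ^ 2) ^ 2 with hb
  have hb0 : 0 < b := by positivity
  set c0 := |Real.log (2 * C1 * C2)| with hc0
  set c1 := |Real.log (2 * b / (q.η₀ ^ 2 * μ))| with hc1
  set c2 := |Real.log (2 * (1 + q.δ) ^ 2 * b / (q.δ ^ 2 * μ ^ 2))| with hc2
  set c3 := |Real.log q.ϱη| with hc3
  set c4 := |Real.log C2| with hc4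
  refine ⟨4 * c0 + 4 + 4 + 4 * c1 + 4 * c2 + 18 + 6 * C1 * c3 + 2 * q.ς * (4 * c4 + 1),
    by positivity, fun {n m P M E ζ z0 zProj r κ ε p} H hM hκ hεr hp hp1 => ?_⟩
  subst hM
  have hs := hs κ hκ
  have hn := hn ζ r κ ε H.ζ_pos H.ε_pos hκ hεr H.one_le_r
  have hz1 := H.zetaBar₁_pos hp
  have hz2 := H.zetaBar₂_pos hp
  have hr := H.one_le_r
  set X := r * κ * (P.L₀ + cstA P M) / p with hX
  set W := ζ * r * κ / ε with hW
  have hκ0 : 0 < κ := by linarith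
  have hXκ : κ ≤ X := by
    rw [hX, le_div_iff₀ hp]
    nlinarith [H.one_le]
  have hWκ : κ ≤ W := by
    rw [hW, le_div_iff₀ H.ε_pos]
    nlinarith
  have hY := Real.log_le_log hκ0 hWκ
  obtain ⟨f1, f2, f3, f4⟩ := log_le_log_mul hκ hXκ hY
  have hκ2 := half_le_log hκ
  have hX0 : 0 < X := by linarith
  have hY0 : 0 < Real.log W := by linarith
  have hn1 : (0 : ℝ) < innerCount q M.lamMin ζ r κ ε :=
    Nat.cast_pos.2 (innerCount_pos q M.lamMin ζ r κ ε)
  set nb := (innerCount q M.lamMin ζ r κ ε : ℝ) with hnb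
  set Y := Real.log W with hYdef
  set Z := Real.log (X * Y) with hZ
  have hZ0 : 0 < Z := by linarith
  have hconst : ∀ x : ℝ, x ≤ 4 * |x| * Z := fun x => by
    have := mul_le_mul_of_nonneg_left f1 (abs_nonneg x)
    linarith [le_abs_self x]
  have hlogκ : Real.log (Real.log κ) ≤ 3 * Z :=
    (Real.log_le_sub_one_of_pos (by linarith)).trans (by linarith)
  -- the number of proximal steps
  have g1 : Real.log (2 * ((sBar q κ + 1 : ℕ) * nb : ℝ)) ≤ 4 * c0 * Z + 4 * Z := by
    have h1 : 2 * ((sBar q κ + 1 : ℕ) * nb : ℝ) ≤ 2 * C1 * C2 * (Real.log κ * Y) := by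
      push_cast
      have := mul_le_mul hs hn hn1.le (by positivity)
      linarith
    have h2 := Real.log_le_log (by positivity) h1
    have hlκ : 0 < Real.log κ := by linarith
    have e : Real.log (2 * C1 * C2 * (Real.log κ * Y)) =
        Real.log (2 * C1 * C2) + (Real.log (Real.log κ) + Real.log Y) := by
      rw [Real.log_mul (by positivity) (by positivity), Real.log_mul hlκ.ne' hY0.ne']
    have := hconst (Real.log (2 * C1 * C2))
    linarith
  have hlognb : Real.log nb ≤ (4 * c4 + 1) * Z := by
    have h2 := Real.log_le_log hn1 hn
    rw [Real.log_mul (by positivity) (by positivity)] at h2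
    have := hconst (Real.log C2)
    linarith
  have hXb : Real.log (X ^ 2 * κ ^ 4) ≤ 18 * Z := by
    rw [Real.log_mul (by positivity) (by positivity), Real.log_pow, Real.log_pow]
    push_cast
    linarith
  have g2 : Real.log (zetaBar₁ P M q ζ r κ ε p) ≤
      4 * c1 * Z + 18 * Z + 6 * C1 * c3 * Z + 2 * q.ς * (4 * c4 + 1) * Z := by
    have h1 := H.zetaBar₁_le hκ hp hp1
    have h2 := Real.log_le_log hz1 h1
    rw [Real.log_mul (by positivity) (by positivity), Real.log_mul (by positivity) (by positivity),
      Real.log_mul (by positivity) (by positivity), Real.log_inv, Real.log_pow, Real.log_pow,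
      Real.log_pow, Real.log_rpow hn1] at h2
    push_cast at h2
    have h4 := hconst (Real.log (2 * b / (q.η₀ ^ 2 * M.lamMin)))
    -- The shrinking tolerance `ϱη^sBar` contributes a term linear in `sBar`, hence of order `ln κ ≤
    -- 3 Z`.
    have h5 : -(2 * ((sBar q κ : ℝ) * Real.log q.ϱη)) ≤ 6 * C1 * c3 * Z := by
      have h6 : -Real.log q.ϱη ≤ c3 := neg_le_abs _
      have h7 : (sBar q κ : ℝ) ≤ C1 * (3 * Z) :=
        (by linarith : (sBar q κ : ℝ) ≤ C1 * Real.log κ).trans (by gcongr)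
      have h8 : (sBar q κ : ℝ) * -Real.log q.ϱη ≤ C1 * (3 * Z) * c3 :=
        (mul_le_mul_of_nonneg_left h6 (Nat.cast_nonneg _)).trans
          (mul_le_mul_of_nonneg_right h7 (abs_nonneg _))
      linarith
    have h9 : 2 * (q.ς * Real.log nb) ≤ 2 * q.ς * (4 * c4 + 1) * Z := by
      have := mul_le_mul_of_nonneg_left hlognb (by positivity : 0 ≤ 2 * q.ς)
      linarith
    linarith
  have g3 : Real.log (zetaBar₂ P M q κ p) ≤ 4 * c2 * Z + 18 * Z := by
    have h1 := H.zetaBar₂_le hκ hp hp1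
    have h2 := Real.log_le_log hz2 h1
    rw [Real.log_mul (by positivity) (by positivity)] at h2
    have h4 := hconst (Real.log (2 * (1 + q.δ) ^ 2 * b / (q.δ ^ 2 * M.lamMin ^ 2)))
    linarith
  have p1 : 0 ≤ 4 * c1 * Z := by positivity
  have p2 : 0 ≤ 4 * c2 * Z := by positivity
  have p3 : 0 ≤ 6 * C1 * c3 * Z := by positivity
  have p4 : 0 ≤ 2 * q.ς * (4 * c4 + 1) * Z := by positivity
  have g4 : max (max (Real.log (zetaBar₁ P M q ζ r κ ε p)) (Real.log (zetaBar₂ P M q κ p))) 0 ≤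
      4 * c1 * Z + 4 * c2 * Z + 18 * Z + 6 * C1 * c3 * Z + 2 * q.ς * (4 * c4 + 1) * Z :=
    max_le (max_le (by linarith) (by linarith)) (by linarith)
  have e : (4 * c0 + 4 + 4 + 4 * c1 + 4 * c2 + 18 + 6 * C1 * c3 + 2 * q.ς * (4 * c4 + 1)) * Z =
      (4 * c0 * Z + 4 * Z) + (4 * c1 * Z + 4 * c2 * Z + 18 * Z + 6 * C1 * c3 * Z +
        2 * q.ς * (4 * c4 + 1) * Z) + 4 * Z := by ring
  rw [e]
  linarith

/-- `cstA` is quadratic in `‖A‖`, so passing to `L₀ + ‖A‖` squares the argument of the logarithm;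
`r`, `r (L₀ + ‖A‖)` and `κ / p` are at least `1`, which allows squaring all factors. -/
theorem Setting.mul_add_cstA_le (H : Setting P M q E ζ z0 zProj r κ ε) (hκ : 0 < κ) (hp : 0 < p)
    (hpκ : p ≤ κ) (hrA : 1 ≤ r * (P.L₀ + ‖P.A‖)) :
    r * κ * (P.L₀ + cstA P M) / p ≤
      (1 + 1 / M.lamMin) * (r * κ * (P.L₀ + ‖P.A‖) / p) ^ 2 := by
  have hr := H.one_le_r
  have hr0 : 0 ≤ r := by linarith
  have hL := P.L₀_nonneg
  have hA := norm_nonneg P.A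
  have hM := H.lamMin_pos
  have h1 : cstA P M ≤ 1 / M.lamMin * ‖P.A‖ ^ 2 := by
    rw [cstA, div_mul_eq_mul_div, one_mul]
    have := M.lamMin_le_lamMinL H.hm
    gcongr
  have h3 : r * P.L₀ ≤ (r * (P.L₀ + ‖P.A‖)) ^ 2 :=
    (mul_le_mul_of_nonneg_left (le_add_of_nonneg_right hA) hr0).trans (le_self_pow₀ hrA two_ne_zero)
  have h4 : r * ‖P.A‖ ^ 2 ≤ (r * (P.L₀ + ‖P.A‖)) ^ 2 := by
    rw [mul_pow]
    gcongr
    · exact le_self_pow₀ hr two_ne_zero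
    · linarith
  have h7 : r * cstA P M ≤ 1 / M.lamMin * (r * (P.L₀ + ‖P.A‖)) ^ 2 := by
    calc r * cstA P M ≤ r * (1 / M.lamMin * ‖P.A‖ ^ 2) := by gcongr
      _ = 1 / M.lamMin * (r * ‖P.A‖ ^ 2) := by ring
      _ ≤ _ := by gcongr
  have h8 : 1 ≤ κ / p := (one_le_div hp).2 hpκ
  calc r * κ * (P.L₀ + cstA P M) / p = κ / p * (r * P.L₀ + r * cstA P M) := by ring
    _ ≤ (κ / p) ^ 2 * ((1 + 1 / M.lamMin) * (r * (P.L₀ + ‖P.A‖)) ^ 2) := by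
        refine mul_le_mul (le_self_pow₀ h8 two_ne_zero) (by linarith) ?_ (by positivity)
        have := cstA_nonneg P H.hm (M := M)
        positivity
    _ = _ := by ring

/-- For `ι = 1` the explicit bound reduces to the leading term. -/
theorem exists_explicitBound_le (q : Params) {μ : ℝ} (hμ : 0 < μ) :
    ∃ C, 0 < C ∧ ∀ {n m : ℕ} {P : Problem n m} {M : Preconditioner n m} {E : PD n m → ℝ}
      {ζ : ℝ} {z0 zProj : PD n m} {r κ ε p ϑ₁ ϑ₂ Υ c₁ : ℝ}, Setting P M q E ζ z0 zProj r κ ε →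
      M.lamMin = μ → 2 ≤ κ → ε ≤ ζ * r → 0 < p → p < 1 → 0 < ϑ₁ → 0 < ϑ₂ → 0 ≤ Υ → 0 < c₁ →
      ϑ₂ * κ ^ ((1 : ℝ) / 2) + Υ ≤ c₁ * (ϑ₁ * κ) → 1 ≤ r * (P.L₀ + ‖P.A‖) →
      explicitBound P M q ϑ₁ ϑ₂ Υ 1 ζ r κ ε p ≤ C * (1 + c₁) * reducedBound P ϑ₁ ζ r κ ε p := by
  have hα := q.α_pos
  have hϱ := q.one_lt_ϱσ
  have hb : 0 < q.α * q.ϱσ := by positivity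
  set b := q.α * q.ϱσ with hb'
  refine ⟨(b + b ^ ((1 : ℝ) / 2) + 1) * (4 * |Real.log (1 + 1 / μ)| + 7), by positivity,
    fun {n m P M E ζ z0 zProj r κ ε p ϑ₁ ϑ₂ Υ c₁} H hM hκ hεr hp hp1 h₁ h₂ hΥ hc₁ hle hrA => ?_⟩
  subst hM
  have hκ0 : 0 < κ := by linarith
  have hr := H.one_le_r
  have hL := P.L₀_nonneg
  have hA := norm_nonneg P.A
  set X := r * κ * (P.L₀ + cstA P M) / p with hX
  set X' := r * κ * (P.L₀ + ‖P.A‖) / p with hX'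
  set W := ζ * r * κ / ε with hW
  have hXκ : κ ≤ X := by
    rw [hX, le_div_iff₀ hp]
    nlinarith [H.one_le]
  have hXκ' : κ ≤ X' := by
    rw [hX', le_div_iff₀ hp]
    nlinarith
  have hWκ : κ ≤ W := by
    rw [hW, le_div_iff₀ H.ε_pos]
    nlinarith
  have hY := Real.log_le_log hκ0 hWκ
  obtain ⟨f1, -, f3, f4⟩ := log_le_log_mul hκ hXκ' hY
  have hκ2 := half_le_log hκ
  have hY0 : 0 < Real.log W := by linarith
  have hX0 : 0 < X' := by linarith
  have hXX : X ≤ (1 + 1 / M.lamMin) * X' ^ 2 := H.mul_add_cstA_le (by linarith) hp (by linarith) hrA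
  -- The `7` is `2 * 3 + 1`: `ln X'` counts twice and is at most three times the target, and `ln ln
  -- W` is at most the target.
  have hZ : Real.log (X * Real.log W) ≤
      (4 * |Real.log (1 + 1 / M.lamMin)| + 7) * Real.log (X' * Real.log W) := by
    have h1 := Real.log_le_log (by linarith) hXX
    rw [Real.log_mul (by positivity) (by positivity), Real.log_pow] at h1
    push_cast at h1
    rw [Real.log_mul (by linarith) hY0.ne']
    have h2 := mul_le_mul_of_nonneg_left f1 (abs_nonneg (Real.log (1 + 1 / M.lamMin)))
    have h3 := le_abs_self (Real.log (1 + 1 / M.lamMin))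
    linarith
  have hG : ϑ₁ * (b * κ) ^ (1 : ℝ) + ϑ₂ * (b * κ) ^ ((1 : ℝ) / 2) + Υ ≤
      (b + b ^ ((1 : ℝ) / 2) + 1) * (1 + c₁) * (ϑ₁ * κ) := by
    rw [Real.rpow_one, Real.mul_rpow hb.le hκ0.le]
    have h1 : 0 ≤ b ^ ((1 : ℝ) / 2) := by positivity
    have h2 : 0 ≤ ϑ₂ * κ ^ ((1 : ℝ) / 2) := by positivity
    have h3 : ϑ₂ * (b ^ ((1 : ℝ) / 2) * κ ^ ((1 : ℝ) / 2)) + Υ ≤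
        (b ^ ((1 : ℝ) / 2) + 1) * (c₁ * (ϑ₁ * κ)) := by
      refine le_trans ?_ (mul_le_mul_of_nonneg_left hle (by positivity))
      nlinarith
    have h4 : 0 ≤ ϑ₁ * κ := by positivity
    have h5 : 0 ≤ b * (c₁ * (ϑ₁ * κ)) := by positivity
    have h6 : 0 ≤ (b ^ ((1 : ℝ) / 2) + 1) * (ϑ₁ * κ) := by positivity
    nlinarith
  have hZ0 : 0 ≤ Real.log (X * Real.log W) := by
    linarith [(log_le_log_mul hκ hXκ hY).1]
  unfold explicitBound reducedBound
  calc _ ≤ ((b + b ^ ((1 : ℝ) / 2) + 1) * (1 + c₁) * (ϑ₁ * κ)) *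
        (Real.log κ * Real.log W *
          ((4 * |Real.log (1 + 1 / M.lamMin)| + 7) * Real.log (X' * Real.log W))) := by
        have : 0 ≤ Real.log κ := by linarith
        gcongr
    _ = _ := by ring

end AGPPA

end

/-! ### Assembling the complexity bound. -/

noncomputable section

namespace AGPPA

/-- A bound for the number of steps that holds with high probability. -/
def totalSteps {n m : ℕ} (P : Problem n m) (M : Preconditioner n m) (q : Params)
    (ζ r κ ε p : ℝ) : ℝ :=
  ((sBar q κ : ℝ) + 1) * innerCount q M.lamMin ζ r κ ε *
    (Real.log (2 * ((sBar q κ + 1 : ℕ) * innerCount q M.lamMin ζ r κ ε : ℝ)) +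
      max (max (Real.log (zetaBar₁ P M q ζ r κ ε p)) (Real.log (zetaBar₂ P M q κ p))) 0 + 1)

variable {n m : ℕ} {P : Problem n m} {M : Preconditioner n m} {q : Params} {E : PD n m → ℝ}
  {ζ : ℝ} {z0 zProj : PD n m} {r κ ε p : ℝ} {T : ℝ → ℝ}

/-- Makes the logarithm in `totalSteps` positive, so the rounded-up step limit `K` is a positive
integer. -/
theorem one_lt_two_mul_innerCount (q : Params) (μ ζ r κ ε : ℝ) :
    1 < 2 * ((sBar q κ + 1 : ℕ) * innerCount q μ ζ r κ ε : ℝ) := by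
  have h1 : (1 : ℝ) ≤ innerCount q μ ζ r κ ε := Nat.one_le_cast.2 (innerCount_pos q μ ζ r κ ε)
  have h2 : (1 : ℝ) ≤ (sBar q κ + 1 : ℕ) := Nat.one_le_cast.2 (Nat.succ_pos _)
  linarith [one_le_mul_of_one_le_of_one_le h2 h1]

theorem log_NBar_le (q : Params) (μ ζ r κ ε : ℝ) :
    Real.log (NBar q μ ζ r κ ε) ≤
      Real.log (2 * ((sBar q κ + 1 : ℕ) * innerCount q μ ζ r κ ε : ℝ)) := by
  rcases Nat.eq_zero_or_pos (NBar q μ ζ r κ ε) with h | h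
  -- For `NBar = 0` the convention `Real.log 0 = 0` applies; the general bound is then `0` through
  -- its first factor.
  · rw [h, Nat.cast_zero, Real.log_zero]
    exact Real.log_nonneg (one_lt_two_mul_innerCount q μ ζ r κ ε).le
  · refine Real.log_le_log (Nat.cast_pos.2 h) ?_
    rw [NBar]
    push_cast
    have h1 : (0 : ℝ) ≤ sBar q κ * innerCount q μ ζ r κ ε := by positivity
    have h2 : (0 : ℝ) ≤ innerCount q μ ζ r κ ε := by positivity
    linarith

theorem generalBound_le (hT : 0 ≤ T (sigmaBar q κ)) :
    generalBound P M q T ζ r κ ε p ≤ totalSteps P M q ζ r κ ε p * T (sigmaBar q κ) := by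
  have h1 := log_NBar_le q M.lamMin ζ r κ ε
  have h2 := Real.log_pos (one_lt_two_mul_innerCount q M.lamMin ζ r κ ε)
  have h3 : (NBar q M.lamMin ζ r κ ε : ℝ) ≤
      ((sBar q κ : ℝ) + 1) * innerCount q M.lamMin ζ r κ ε := by
    rw [NBar]
    push_cast
    linarith [(Nat.cast_nonneg (innerCount q M.lamMin ζ r κ ε) : (0 : ℝ) ≤ _)]
  rw [generalBound, totalSteps]
  set lz := max (max (Real.log (zetaBar₁ P M q ζ r κ ε p)) (Real.log (zetaBar₂ P M q κ p))) 0
  have h4 : 0 ≤ lz := le_max_right _ _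
  refine mul_le_mul_of_nonneg_right ?_ hT
  refine le_trans (mul_le_mul_of_nonneg_left ?_ (Nat.cast_nonneg _))
    (mul_le_mul_of_nonneg_right h3 (by linarith))
  exact (Int.ceil_lt_add_one _).le.trans (by linarith)

/-- The complexity of AGPPA, with probability at least `1 - p`. -/
theorem Setting.le_measure_solvesWithin_totalSteps (H : Setting P M q E ζ z0 zProj r κ ε)
    {Ξ : Type*} [MeasurableSpace Ξ] {ν : Measure Ξ} [IsProbabilityMeasure ν]
    {S : InnerSolver n m Ξ} (hS : IsHOOD ν P M q S) (hp : 0 < p)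
    (hT : MonotoneOn T (Set.Ioi 0))
    (hcost : ∀ s t zBar x ξ, P.g x ≠ ⊤ → (S.cost s t zBar x ξ : ℝ) ≤ T (q.sig s))
    (hT0 : 0 ≤ T (sigmaBar q κ)) {B : ℝ}
    (hB : totalSteps P M q ζ r κ ε p * T (sigmaBar q κ) ≤ B) :
    ENNReal.ofReal (1 - p) ≤ Measure.infinitePi (fun _ : ℕ × ℕ × ℕ => ν)
      {ω | SolvesWithin P M q E ε S z0 ω B} := by
  have h1 := one_lt_two_mul_innerCount q M.lamMin ζ r κ ε
  have h2 := Real.log_pos h1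
  rw [totalSteps] at hB
  set l := Real.log (2 * ((sBar q κ + 1 : ℕ) * innerCount q M.lamMin ζ r κ ε : ℝ)) with hl
  set lz := max (max (Real.log (zetaBar₁ P M q ζ r κ ε p)) (Real.log (zetaBar₂ P M q κ p))) 0
  have h3 : 0 ≤ lz := le_max_right _ _
  have hK : (⌈l + lz⌉₊ : ℝ) ≤ l + lz + 1 := (Nat.ceil_lt_add_one (by linarith)).le
  -- With this `K`, `e^K` is at least `2 (sBar + 1) innerCount` times `max(1, ζ₁, ζ₂)`, as the union
  -- bound requires.
  refine H.le_measure_solvesWithin hS hp (K := ⌈l + lz⌉₊) (Nat.ceil_pos.2 (by linarith)) ?_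
    hT hcost hT0 (le_trans ?_ hB)
  · refine le_trans ?_ (Real.exp_le_exp.2 (Nat.le_ceil _))
    rw [Real.exp_add, hl, Real.exp_log (by linarith)]
    refine mul_le_mul_of_nonneg_left (max_le ?_ ?_) (by linarith)
    · rw [← Real.log_le_iff_le_exp (H.zetaBar₁_pos hp)]
      exact (le_max_left _ _).trans (le_max_left _ _)
    · rw [← Real.log_le_iff_le_exp (H.zetaBar₂_pos hp)]
      exact (le_max_right _ _).trans (le_max_left _ _)
  · push_cast
    exact mul_le_mul_of_nonneg_right (mul_le_mul_of_nonneg_left hK (by positivity)) hT0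

theorem le_mul_mul_div {A : ℝ} (hκ : 0 < κ) (hp : 0 < p) (hp1 : p ≤ 1) (hA : 1 ≤ r * A) :
    κ ≤ r * κ * A / p := by
  rw [le_div_iff₀ hp]
  nlinarith

theorem le_mul_mul_div' (hκ : 0 < κ) (hε : 0 < ε) (hεr : ε ≤ ζ * r) : κ ≤ ζ * r * κ / ε := by
  rw [le_div_iff₀ hε]
  nlinarith

theorem log_mul_log_nonneg {A : ℝ} (hκ : 2 ≤ κ) (hp : 0 < p) (hp1 : p ≤ 1) (hA : 1 ≤ r * A)
    (hε : 0 < ε) (hεr : ε ≤ ζ * r) :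
    0 ≤ Real.log (r * κ * A / p * Real.log (ζ * r * κ / ε)) := by
  have hκ0 : 0 < κ := by linarith
  linarith [(log_le_log_mul hκ (le_mul_mul_div hκ0 hp hp1 hA)
    (Real.log_le_log hκ0 (le_mul_mul_div' hκ0 hε hεr))).1]

theorem log_div_nonneg (hκ : 2 ≤ κ) (hε : 0 < ε) (hεr : ε ≤ ζ * r) :
    0 ≤ Real.log (ζ * r * κ / ε) := by
  have hκ0 : 0 < κ := by linarith
  linarith [half_le_log (hκ.trans (le_mul_mul_div' hκ0 hε hεr))]

theorem Setting.explicitBound_nonneg (H : Setting P M q E ζ z0 zProj r κ ε) {ϑ₁ ϑ₂ Υ ι : ℝ}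
    (hκ : 2 ≤ κ) (hp : 0 < p) (hp1 : p ≤ 1) (hεr : ε ≤ ζ * r) (h₁ : 0 < ϑ₁) (h₂ : 0 < ϑ₂)
    (hΥ : 0 ≤ Υ) : 0 ≤ explicitBound P M q ϑ₁ ϑ₂ Υ ι ζ r κ ε p := by
  have := q.α_pos
  have := q.one_lt_ϱσ
  have h1 : 0 ≤ Real.log κ := by linarith [half_le_log hκ]
  have h2 := log_div_nonneg hκ H.ε_pos hεr
  have h3 := log_mul_log_nonneg hκ hp hp1 H.one_le H.ε_pos hεr
  unfold explicitBound
  positivity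

theorem Setting.reducedBound_nonneg (H : Setting P M q E ζ z0 zProj r κ ε) {ϑ₁ : ℝ}
    (hκ : 2 ≤ κ) (hp : 0 < p) (hp1 : p ≤ 1) (hεr : ε ≤ ζ * r) (h₁ : 0 < ϑ₁)
    (hA : 1 ≤ r * (P.L₀ + ‖P.A‖)) : 0 ≤ reducedBound P ϑ₁ ζ r κ ε p := by
  have h1 : 0 ≤ Real.log κ := by linarith [half_le_log hκ]
  have h2 := log_div_nonneg hκ H.ε_pos hεr
  have h3 := log_mul_log_nonneg hκ hp hp1 hA H.ε_pos hεr
  unfold reducedBound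
  positivity

/-- Multiplies the order estimates: outer iterations `ln κ`, proximal steps `ln(ζ r κ / ε)`, inner
iterations the last logarithm, and the cost of one iteration. Counting `sBar + 1` outer iterations
instead of `sBar` is harmless because `ln κ ≥ 1/2`. -/
theorem exists_totalSteps_mul_le (q : Params) (hρ : q.rho < 1) {μ c : ℝ} (hμ : 0 < μ)
    (hc : 0 < c) :
    ∃ C, 0 < C ∧ ∀ {n m : ℕ} {P : Problem n m} {M : Preconditioner n m} {E : PD n m → ℝ}
      {ζ : ℝ} {z0 zProj : PD n m} {r κ ε p : ℝ} {T : ℝ → ℝ} {ϑ₁ ϑ₂ Υ ι : ℝ},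
      Setting P M q E ζ z0 zProj r κ ε → M.lamMin = μ → 2 ≤ κ → ε ≤ ζ * r → 0 < p → p < 1 →
      0 ≤ T (sigmaBar q κ) →
      T (sigmaBar q κ) ≤ c * (ϑ₁ * sigmaBar q κ ^ ι + ϑ₂ * sigmaBar q κ ^ (ι / 2) + Υ) →
      totalSteps P M q ζ r κ ε p * T (sigmaBar q κ) ≤
        C * explicitBound P M q ϑ₁ ϑ₂ Υ ι ζ r κ ε p := by
  obtain ⟨C1, hC1, hs⟩ := exists_sBar_add_one_le q
  obtain ⟨C2, hC2, hn⟩ := exists_innerCount_le q hρ hμ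
  obtain ⟨C3, hC3, hlog⟩ := exists_log_zetaBar_le q hρ hμ
  refine ⟨C1 * C2 * C3 * c, by positivity, ?_⟩
  intro n m P M E ζ z0 zProj r κ ε p T ϑ₁ ϑ₂ Υ ι H hM hκ hεr hp hp1 hT0 hT
  subst hM
  have hσ : sigmaBar q κ = q.α * q.ϱσ * κ := by rw [sigmaBar]; ring
  have hlog := hlog H rfl hκ hεr hp hp1
  have h0 := Real.log_pos (one_lt_two_mul_innerCount q M.lamMin ζ r κ ε)
  have h1 : 0 ≤ C1 * Real.log κ := mul_nonneg hC1.le (by linarith [half_le_log hκ])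
  have h2 := mul_nonneg hC2.le (log_div_nonneg hκ H.ε_pos hεr)
  rw [totalSteps]
  set l := Real.log (2 * ((sBar q κ + 1 : ℕ) * innerCount q M.lamMin ζ r κ ε : ℝ))
  set lz := max (max (Real.log (zetaBar₁ P M q ζ r κ ε p)) (Real.log (zetaBar₂ P M q κ p))) 0
  have h3 : 0 ≤ l + lz + 1 := by
    have : 0 ≤ lz := le_max_right _ _
    linarith
  refine (mul_le_mul (mul_le_mul (mul_le_mul (hs κ hκ)
    (hn ζ r κ ε H.ζ_pos H.ε_pos hκ hεr H.one_le_r) (Nat.cast_nonneg _) h1) hlog h3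
    (mul_nonneg h1 h2)) hT hT0 (mul_nonneg (mul_nonneg h1 h2) (h3.trans hlog))).trans
      (le_of_eq ?_)
  rw [explicitBound, hσ]
  ring

end AGPPA

end

open AGPPA in
theorem mainTheorem8 (q : Params) (hρ : q.rho < 1) (μ c : ℝ) (hμ : 0 < μ) (hc : 0 < c) :
    -- `C` depends only on the user-defined parameters, on `λ_min(M) = μ` and on the constant `c`
    ∃ C : ℝ, 0 < C ∧
      ∀ (n m : ℕ) (_ : 0 < n) (_ : 0 < m)
        (P : Problem n m) (M : Preconditioner n m) (_ : M.lamMin = μ)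
        -- residual function and initial point
        (E : PD n m → ℝ) (_ : Measurable E) (_ : ∀ z, 0 ≤ E z)
        (ζ : ℝ) (_ : 0 < ζ) (_ : ∀ z, E z ≤ ζ * Metric.infDist z (solSet P))
        (z0 zProj : PD n m)
        (_ : zProj ∈ solSet P) (_ : ∀ z ∈ solSet P, ‖z0 - zProj‖ ≤ ‖z0 - z‖)
        -- radius and bounded metric subregularity constant
        (r κ : ℝ) (_ : radius P M q z0 zProj ≤ r) (_ : MetricSubregularOn P r κ)
        -- complexity of one iteration of the inner algorithm
        (T : ℝ → ℝ) (_ : ∀ σ, 0 < σ → 0 ≤ T σ) (_ : MonotoneOn T (Set.Ioi 0))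
        (ϑ₁ ϑ₂ Υ ι : ℝ) (_ : 0 < ϑ₁) (_ : 0 < ϑ₂) (_ : 0 ≤ Υ) (_ : 0 < ι)
        (_ : ∀ σ, 0 < σ → T σ ≤ c * (ϑ₁ * σ ^ ι + ϑ₂ * σ ^ (ι / 2) + Υ))
        -- accuracy, failure probability, and the regime in which the logarithms are positive
        (ε p : ℝ) (_ : 0 < ε) (_ : 0 < p) (_ : p < 1)
        (_ : 2 ≤ κ) (_ : q.σ₀ ≤ q.α * q.ϱσ * κ) (_ : ε ≤ ζ * r)
        (_ : 1 ≤ r) (_ : 1 ≤ r * (P.L₀ + cstA P M)),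
        -- the general bound is of the order of the explicit bound
        generalBound P M q T ζ r κ ε p ≤ C * explicitBound P M q ϑ₁ ϑ₂ Υ ι ζ r κ ε p ∧
        -- AGPPA finds an `ε`-solution within that many operations, with probability `≥ 1 - p`
        (∀ (Ξ : Type*) [MeasurableSpace Ξ] (ν : MeasureTheory.Measure Ξ)
            [MeasureTheory.IsProbabilityMeasure ν] (S : InnerSolver n m Ξ),
          IsHOOD ν P M q S →
          (∀ s t zBar x ξ, P.g x ≠ ⊤ → (S.cost s t zBar x ξ : ℝ) ≤ T (q.sig s)) →
          ENNReal.ofReal (1 - p) ≤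
            MeasureTheory.Measure.infinitePi (fun _ : ℕ × ℕ × ℕ => ν)
              {ω | SolvesWithin P M q E ε S z0 ω
                (C * explicitBound P M q ϑ₁ ϑ₂ Υ ι ζ r κ ε p)}) ∧
        -- the reduced form for `ι = 1`
        (∀ c₁ : ℝ, 0 < c₁ → ι = 1 → ϑ₂ * κ ^ ((1 : ℝ) / 2) + Υ ≤ c₁ * (ϑ₁ * κ) →
          1 ≤ r * (P.L₀ + ‖P.A‖) →
          explicitBound P M q ϑ₁ ϑ₂ Υ ι ζ r κ ε p ≤
            C * (1 + c₁) * reducedBound P ϑ₁ ζ r κ ε p) := by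
  obtain ⟨C, hC, hsteps⟩ := exists_totalSteps_mul_le q hρ hμ hc
  obtain ⟨C', hC', hred⟩ := exists_explicitBound_le q hμ
  -- One constant serves all three claims; enlarging it is legitimate because both explicit bounds
  -- are nonnegative in the assumed regime.
  refine ⟨C + C', by positivity, ?_⟩
  intro n m hn hm P M hM E hE _ ζ hζ hEζ z0 zProj hz hz' r κ hr hκr T hT0 hT ϑ₁ ϑ₂ Υ ι h₁ h₂ hΥ _
    hTc ε p hε hp hp1 hκ hσκ hεr hr1 hrL
  subst hM
  have H : Setting P M q E ζ z0 zProj r κ ε :=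
    ⟨hn, hm, hρ, hμ, hE, hζ, hEζ, hz, hz', hr, hκr, hε, by linarith, hσκ, hr1, hrL⟩
  have hT0 := hT0 _ H.sigmaBar_pos
  have key : totalSteps P M q ζ r κ ε p * T (sigmaBar q κ) ≤
      (C + C') * explicitBound P M q ϑ₁ ϑ₂ Υ ι ζ r κ ε p := by
    rw [add_mul]
    exact le_add_of_le_of_nonneg (hsteps H rfl hκ hεr hp hp1 hT0 (hTc _ H.sigmaBar_pos))
      (mul_nonneg hC'.le (H.explicitBound_nonneg hκ hp hp1.le hεr h₁ h₂ hΥ))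
  refine ⟨(generalBound_le hT0).trans key, ?_, ?_⟩
  · intro Ξ _ ν _ S hS hcost
    exact H.le_measure_solvesWithin_totalSteps hS hp hT hcost hT0 key
  · intro c₁ hc₁ hι hle hA
    subst hι
    refine (hred H rfl hκ hεr hp hp1 h₁ h₂ hΥ hc₁ hle hA).trans ?_
    exact mul_le_mul_of_nonneg_right (mul_le_mul_of_nonneg_right (by linarith) (by linarith))
      (H.reducedBound_nonneg hκ hp hp1.le hεr h₁ hA)
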